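/- Let $\Lambda$ be a finite-dimensional algebra over an algebraically closed field $K$, and suppose that $\Lambda$ is cellular in the sense of Graham and Lehrer, i.e. it has a $K$-basis $\{C^i_{S,T}\mid i\in I,\ S,T\in M(i)\}$ (with $I$ a finite poset and $M(i)$ finite sets) such that $C^i_{S,T}\mapsto C^i_{T,S}$ extends to a $K$-linear anti-involution of $\Lambda$, and for all $a\in\Lambda$, $i\in I$, $S\in M(i)$ there are scalars $r_{S'}\in K$ with $aC^i_{S,T}\equiv\sum_{S'\in M(i)}r_{S'}C^i_{S',T}$ modulo the span of the $C^j_{U,V}$ with $j<i$, for all $T\in M(i)$. Let $\mathcal K_\Lambda=\mathsf K^{\mathrm b}(\mathsf{proj}\,\Lambda)$ be the homotopy category of bounded complexes of finitely generated projective right $\Lambda$-modules. Write $T\ge U$ if $\operatorname{Hom}_{\mathcal K_\Lambda}(T,U[i])=0$ for all $i>0$; an object $T$ is silting if $T\ge T$ and the smallest thick subcategory containing $T$ is $\mathcal K_\Lambda$. Let $\mathsf{2silt}\,\Lambda$ be the set of isomorphism classes of basic silting objects $T$ with $\Lambda\ge T\ge\Lambda[1]$. For an object with a decomposition $X\oplus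 M$, its left mutation with respect to $X$ is $\mu^-_X(X\oplus M)=Y\oplus M$, where $Y$ is the cone of a minimal left $\operatorname{add}M$-approximation $X\to M'$; dually, its right mutation is $\mu^+_X(X\oplus M)=Y'\oplus M$, where $Y'$ is the cocone (the cone shifted by $[-1]$) of a minimal right $\operatorname{add}M$-approximation $M'\to X$. Let $P$ be a (finitely generated) indecomposable projective right $\Lambda$-module and put $$\mathcal T_P^-=\{T\in\mathsf{2silt}\,\Lambda\mid \mu_P^-(\Lambda)\ge T\ge\Lambda[1]\},\qquad \mathcal T_P^+=\{T\in\mathsf{2silt}\,\Lambda\mid \Lambda\ge T\ge\mu_{P[1]}^+(\Lambda[1])\},$$ where in forming the mutations $\Lambda$ and $\Lambda[1]$ are replaced by their basic versions (the basic objects with the same additive closure). Then there is a bijection between $\mathcal T_P^-$ and $\mathcal T_P^+$, and $|\mathsf{2silt}\,\Lambda|=2\cdot|\mathcal T_P^-|$ (an equality of cardinal numbers, also if these sets are infinite). -/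

import Mathlib

open CategoryTheory Limits Pretriangulated
open scoped ZeroObject

universe v u

/-! ### Cellular algebras -/

/-- A cell datum (in the sense of Graham and Lehrer) on a `K`-algebra `Λ`: a partially ordered set
`I`, finite sets `M i` for `i ∈ I`, a `K`-basis `C i S T` of `Λ` indexed by `i ∈ I` and
`S, T ∈ M i`, and a `K`-linear anti-involution `inv` of `Λ` exchanging `C i S T` and `C i T S`,
such that
`a * C i S T ≡ ∑ S', r S' • C i S' T` modulo the span of the `C j U V` with `j < i`,
where the coefficients `r` depend on `a` and `S` but not on `T`. -/
structure CellDatum (K : Type v) [Field K] (Λ : Type u) [Ring Λ] [Algebra K Λ]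
    (I : Type) [PartialOrder I] (M : I → Type) [∀ i, Fintype (M i)] where
  /-- the cellular basis -/
  C : Module.Basis (Σ i : I, M i × M i) K Λ
  /-- the anti-involution -/
  inv : Λ →ₗ[K] Λ
  inv_mul : ∀ a b : Λ, inv (a * b) = inv b * inv a
  inv_inv : ∀ a : Λ, inv (inv a) = a
  inv_C : ∀ (i : I) (S T : M i), inv (C ⟨i, S, T⟩) = C ⟨i, T, S⟩
  mul_C : ∀ (a : Λ) (i : I) (S : M i), ∃ r : M i → K, ∀ T : M i,
    a * C ⟨i, S, T⟩ - ∑ S' : M i, r S' • C ⟨i, S', T⟩ ∈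
      Submodule.span K {x : Λ | ∃ (j : I) (U V : M j), j < i ∧ x = C ⟨j, U, V⟩}

/-- A (finite-dimensional) algebra is cellular if it admits a cell datum. Since the dimension is
finite, the poset may be taken finite, and the index types may be taken in `Type`. -/
def IsCellularAlgebra (K : Type v) [Field K] (Λ : Type u) [Ring Λ] [Algebra K Λ] : Prop :=
  ∃ (I : Type) (_ : PartialOrder I) (_ : Finite I) (M : I → Type) (_ : ∀ i, Fintype (M i)),
    Nonempty (CellDatum K Λ I M)

/-! ### The category `K^b(proj R)` -/

/-- Finitely generated projective modules. -/
def fgProj (R : Type u) [Ring R] : ObjectProperty (ModuleCat.{u} R) :=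
  fun M => Module.Finite R M ∧ Module.Projective R M

/-- Bounded cochain complexes of finitely generated projective modules. -/
def bddProjComplex (R : Type u) [Ring R] : ObjectProperty (CochainComplex (ModuleCat.{u} R) ℤ) :=
  fun X => (∀ i, fgProj R (X.X i)) ∧ ∃ a b : ℤ, ∀ i, (i < a ∨ b < i) → IsZero (X.X i)

/-- The objects of the homotopy category given by bounded complexes of finitely generated
projective modules. -/
def bddProj (R : Type u) [Ring R] :
    ObjectProperty (HomotopyCategory (ModuleCat.{u} R) (ComplexShape.up ℤ)) :=
  (bddProjComplex R).strictMap (HomotopyCategory.quotient _ _)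

section Perfect

variable {R : Type u} [Ring R]

lemma fgProj_of_isZero {M : ModuleCat.{u} R} (h : IsZero M) : fgProj R M := by
  have : Subsingleton M := ModuleCat.subsingleton_of_isZero h
  have : Module.Free R M := Module.Free.of_subsingleton R M
  exact ⟨inferInstance, Module.Projective.of_free⟩

lemma fgProj_of_iso {M N : ModuleCat.{u} R} (e : M ≅ N) (h : fgProj R M) : fgProj R N := by
  obtain ⟨h₁, h₂⟩ := h
  exact ⟨Module.Finite.equiv e.toLinearEquiv, Module.Projective.of_equiv e.toLinearEquiv⟩

lemma fgProj_biprod {M N : ModuleCat.{u} R} (hM : fgProj R M) (hN : fgProj R N) :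
    fgProj R (M ⊞ N) := by
  obtain ⟨h₁, h₂⟩ := hM
  obtain ⟨h₃, h₄⟩ := hN
  exact fgProj_of_iso (ModuleCat.biprodIsoProd M N).symm
    ⟨inferInstanceAs (Module.Finite R (M × N)), inferInstanceAs (Module.Projective R (M × N))⟩

lemma bddProj_quotient_obj_iff (X : CochainComplex (ModuleCat.{u} R) ℤ) :
    bddProj R ((HomotopyCategory.quotient _ _).obj X) ↔ bddProjComplex R X := by
  refine ⟨?_, fun h => ⟨_, h⟩⟩
  simp only [bddProj, ObjectProperty.strictMap_iff]
  rintro ⟨L, h, hL⟩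
  obtain rfl : L = X := congr_arg Quotient.as hL
  exact h

instance : (bddProj R).ContainsZero where
  exists_zero := by
    refine ⟨(HomotopyCategory.quotient _ _).obj 0, Functor.map_isZero _ (isZero_zero _), ?_⟩
    rw [bddProj_quotient_obj_iff]
    have h : ∀ i, IsZero ((0 : CochainComplex (ModuleCat.{u} R) ℤ).X i) := fun i =>
      Functor.map_isZero (HomologicalComplex.eval _ _ i) (isZero_zero _)
    exact ⟨fun i => fgProj_of_isZero (h i), 0, 0, fun i _ => h i⟩

instance : (bddProj R).IsStableUnderShift ℤ where
  isStableUnderShiftBy n :=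
    { le_shift := fun X hX => by
        obtain ⟨X : CochainComplex _ _, rfl⟩ := X.quotient_obj_surjective
        rw [bddProj_quotient_obj_iff] at hX
        obtain ⟨h, a, b, hab⟩ := hX
        rw [ObjectProperty.prop_shift_iff, HomotopyCategory.shift_quotient_obj,
          bddProj_quotient_obj_iff]
        exact ⟨fun i => h (i + n), a - n, b - n, fun i hi => hab (i + n) (by lia)⟩ }

instance : (bddProj R).IsTriangulatedClosed₃ where
  ext₃' T hT h₁ h₂ := by
    obtain ⟨p₁, a₁, b₁, z₁⟩ : bddProjComplex R T.obj₁.as := by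
      rw [← bddProj_quotient_obj_iff]; exact h₁
    obtain ⟨p₂, a₂, b₂, z₂⟩ : bddProjComplex R T.obj₂.as := by
      rw [← bddProj_quotient_obj_iff]; exact h₂
    obtain ⟨f : T.obj₁.as ⟶ T.obj₂.as, hf⟩ :=
      (HomotopyCategory.quotient _ _).map_surjective T.mor₁
    refine ⟨(HomotopyCategory.quotient _ _).obj (CochainComplex.mappingCone f), ?_,
      ⟨Triangle.π₃.mapIso (isoTriangleOfIso₁₂ T _ hT
        (HomotopyCategory.mappingCone_triangleh_distinguished f)
        (Iso.refl _) (Iso.refl _) ?_)⟩⟩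
    · rw [bddProj_quotient_obj_iff]
      refine ⟨fun i => ?_, min (a₁ - 1) a₂, max b₁ b₂, fun i hi => ?_⟩
      · exact fgProj_of_iso (HomologicalComplex.homotopyCofiber.XIsoBiprod f i (i + 1) rfl).symm
          (fgProj_biprod (p₁ _) (p₂ _))
      · rw [CochainComplex.mappingCone.isZero_X_iff]
        exact ⟨z₁ _ (by lia), z₂ _ (by lia)⟩
    · exact (Category.comp_id _).trans (hf.symm.trans (Category.id_comp _).symm)

instance : (bddProj R).IsTriangulated where
  toIsTriangulatedClosed₂ := .of_isTriangulatedClosed₃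

end Perfect

/-- The perfect derived category `K^b(proj R)`: bounded complexes of finitely generated projective
left `R`-modules and homotopy classes of chain maps, with its standard triangulated structure. -/
abbrev KbProj (R : Type u) [Ring R] := (bddProj R).FullSubcategory

lemma bddProj_single {R : Type u} [Ring R] (P : ModuleCat.{u} R)
    (h₁ : Module.Finite R P) (h₂ : Module.Projective R P) :
    bddProj R ((HomotopyCategory.singleFunctor (ModuleCat.{u} R) 0).obj P) := by
  rw [← HomotopyCategory.quotient_obj_singleFunctors_obj, bddProj_quotient_obj_iff]
  have hz : ∀ i : ℤ, i ≠ 0 →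
      IsZero (((CochainComplex.singleFunctor (ModuleCat.{u} R) 0).obj P).X i) := fun i hi =>
    HomologicalComplex.isZero_single_obj_X (ComplexShape.up ℤ) 0 P i hi
  refine ⟨fun i => ?_, 0, 0, fun i hi => hz i (by lia)⟩
  by_cases hi : i = 0
  · subst hi
    exact fgProj_of_iso (HomologicalComplex.singleObjXSelf (ComplexShape.up ℤ) 0 P).symm ⟨h₁, h₂⟩
  · exact fgProj_of_isZero (hz i hi)

/-- A finitely generated projective module as a complex concentrated in degree `0`. -/
noncomputable def stalk {R : Type u} [Ring R] (P : ModuleCat.{u} R)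
    [h₁ : Module.Finite R P] [h₂ : Module.Projective R P] : KbProj R :=
  ⟨(HomotopyCategory.singleFunctor (ModuleCat.{u} R) 0).obj P, bddProj_single P h₁ h₂⟩

/-- The regular module `R`, as a complex concentrated in degree `0`. -/
noncomputable def regularStalk (R : Type u) [Ring R] : KbProj R := stalk (ModuleCat.of R R)

/-! ### Silting objects and mutation in a triangulated category -/

section Silting

variable {𝒯 : Type*} [Category* 𝒯] [HasZeroObject 𝒯] [HasShift 𝒯 ℤ] [Preadditive 𝒯]
  [∀ n : ℤ, (shiftFunctor 𝒯 n).Additive] [Pretriangulated 𝒯]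

/-- The relation `T ≥ U`: `Hom(T, U[i]) = 0` for all `i > 0`. -/
def SiltGE (T U : 𝒯) : Prop := ∀ i : ℤ, 0 < i → ∀ f : T ⟶ U⟦i⟧, f = 0

/-- The smallest thick subcategory (triangulated subcategory closed under direct summands)
containing `T`. -/
def thick (T : 𝒯) : ObjectProperty 𝒯 := fun X =>
  ∀ Q : ObjectProperty 𝒯, Q.IsTriangulated → Q.IsStableUnderRetracts → Q T → Q X

/-- Silting objects. -/
def IsSilting (T : 𝒯) : Prop := SiltGE T T ∧ thick T = ⊤

/-- `T` is basic: a finite direct sum of pairwise non-isomorphic indecomposable objects. -/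
def IsBasic (T : 𝒯) : Prop :=
  ∃ (n : ℕ) (X : Fin n → 𝒯), (∀ k, Indecomposable (X k)) ∧
    (∀ k l, Nonempty (X k ≅ X l) → k = l) ∧ Nonempty (T ≅ ⨁ X)

/-- `add M`: the direct summands of finite direct sums of copies of `M`. -/
def addClosure (M : 𝒯) : ObjectProperty 𝒯 := fun X =>
  ∃ n : ℕ, Nonempty (Retract X (⨁ fun _ : Fin n => M))

/-- `B` is the basic object with the same additive closure as `T` (unique up to isomorphism in a
Krull-Schmidt category). -/
def IsBasicVersion (B T : 𝒯) : Prop := IsBasic B ∧ addClosure B = addClosure T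

/-- `f : X ⟶ M'` is a minimal left `add M`-approximation of `X`. -/
def IsMinLeftApprox (M : 𝒯) {X M' : 𝒯} (f : X ⟶ M') : Prop :=
  addClosure M M' ∧ (∀ N : 𝒯, addClosure M N → ∀ g : X ⟶ N, ∃ h : M' ⟶ N, f ≫ h = g) ∧
    ∀ h : M' ⟶ M', f ≫ h = f → IsIso h

/-- `f : M' ⟶ X` is a minimal right `add M`-approximation of `X`. -/
def IsMinRightApprox (M : 𝒯) {X M' : 𝒯} (f : M' ⟶ X) : Prop :=
  addClosure M M' ∧ (∀ N : 𝒯, addClosure M N → ∀ g : N ⟶ X, ∃ h : N ⟶ M', h ≫ f = g) ∧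
    ∀ h : M' ⟶ M', h ≫ f = f → IsIso h

/-- `U` is the left mutation `μ_X^-(T)`: there is a decomposition `T = X ⊕ M`, and `U = Y ⊕ M`
with `Y` the cone of a minimal left `add M`-approximation `X ⟶ M'`. -/
def IsLeftMutation (X T U : 𝒯) : Prop :=
  ∃ (M M' Y : 𝒯) (f : X ⟶ M') (g : M' ⟶ Y) (h : Y ⟶ X⟦(1 : ℤ)⟧),
    Nonempty (T ≅ X ⊞ M) ∧ IsMinLeftApprox M f ∧ Triangle.mk f g h ∈ distTriang 𝒯 ∧
      Nonempty (U ≅ Y ⊞ M)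

/-- `U` is the right mutation `μ_X^+(T)`: there is a decomposition `T = X ⊕ M`, and `U = Y ⊕ M`
with `Y` the cocone of a minimal right `add M`-approximation `M' ⟶ X`. -/
def IsRightMutation (X T U : 𝒯) : Prop :=
  ∃ (M M' Y : 𝒯) (g : Y ⟶ M') (f : M' ⟶ X) (h : X ⟶ Y⟦(1 : ℤ)⟧),
    Nonempty (T ≅ X ⊞ M) ∧ IsMinRightApprox M f ∧ Triangle.mk g f h ∈ distTriang 𝒯 ∧
      Nonempty (U ≅ Y ⊞ M)

end Silting

/-! ### Two-term silting objects -/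

/-- Isomorphism classes of objects of `K^b(proj R)`. -/
abbrev KbProjClass (R : Type u) [Ring R] := Quotient (isIsomorphicSetoid (KbProj R))

/-- The isomorphism class of an object of `K^b(proj R)`. -/
def isoClass {R : Type u} [Ring R] (T : KbProj R) : KbProjClass R :=
  Quotient.mk (isIsomorphicSetoid (KbProj R)) T

/-- `T` is a basic silting object with `R ≥ T ≥ R[1]`. -/
def IsTwoSilt {R : Type u} [Ring R] (T : KbProj R) : Prop :=
  IsBasic T ∧ IsSilting T ∧ SiltGE (regularStalk R) T ∧ SiltGE T ((regularStalk R)⟦(1 : ℤ)⟧)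

/-- The set `2silt R` of isomorphism classes of basic two-term silting objects. -/
def twoSilt (R : Type u) [Ring R] : Set (KbProjClass R) :=
  {t | ∃ T : KbProj R, isoClass T = t ∧ IsTwoSilt T}

/-- The set `𝒯_P^-` of all `T` in `2silt R` with `μ_P^-(R) ≥ T ≥ R[1]`, where the mutation is that
of the basic version of `R`. -/
def twoSiltMinus {R : Type u} [Ring R] (P : ModuleCat.{u} R)
    [Module.Finite R P] [Module.Projective R P] : Set (KbProjClass R) :=
  {t | ∃ T : KbProj R, isoClass T = t ∧ IsTwoSilt T ∧
    ∃ B U : KbProj R, IsBasicVersion B (regularStalk R) ∧ IsLeftMutation (stalk P) B U ∧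
      SiltGE U T ∧ SiltGE T ((regularStalk R)⟦(1 : ℤ)⟧)}

/-- The set `𝒯_P^+` of all `T` in `2silt R` with `R ≥ T ≥ μ_{P[1]}^+(R[1])`, where the mutation is
that of the basic version of `R[1]`. -/
def twoSiltPlus {R : Type u} [Ring R] (P : ModuleCat.{u} R)
    [Module.Finite R P] [Module.Projective R P] : Set (KbProjClass R) :=
  {t | ∃ T : KbProj R, isoClass T = t ∧ IsTwoSilt T ∧
    ∃ B U : KbProj R, IsBasicVersion B ((regularStalk R)⟦(1 : ℤ)⟧) ∧
      IsRightMutation ((stalk P)⟦(1 : ℤ)⟧) B U ∧ SiltGE (regularStalk R) T ∧ SiltGE T U}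

/-! Let `S` be the simple top of `P`, with `π : P ⟶ S` nonzero. For a two-term silting object `T`,
consider nonzero maps from `T` to `S` placed in degree `0` and in degree `-1`; exactly one of the
two kinds exists. Both cannot: a map `b : T ⟶ S[1]` lifts to `T ⟶ P[1]` because `T ≥ R[1]`, a
nonzero `a : T ⟶ S` admits `q : P ⟶ T` with `q ≫ a = π` because `R ≥ T`, and the composite `T ⟶ P[1]
⟶ T[1]` vanishes because `T ≥ T`; following it by `a[1]` returns `b`, so `b = 0`
(`homZero_or_homZero`). One of them must exist: `T` generates `P`, so it maps nontrivially to some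
shift of `S`, and the two-term conditions exclude all other degrees (`not_homZero_and_homZero`).

These two classes are the two sets of the theorem. Let `M₀` be the sum of the other indecomposable
projectives. Having no map `T ⟶ S` is equivalent to every map `P ⟶ T` factoring through `add M₀`
(sums of maps through `M₀`, the subgroup `thru`). By the triangle of the approximation `P ⟶ M'`,
this is the condition that its cone `Y` satisfies `Y ≥ T`, hence that the left mutation is `≥ T`
(`isoClass_mem_twoSiltMinus_iff`). Dually, having no map `T ⟶ S[1]` means that every map `T ⟶ P[1]`
factors through `add M₀[1]`, which characterises `𝒯_P^+` (`isoClass_mem_twoSiltPlus_iff`). So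
`2silt` is the disjoint union of `𝒯_P^-` and `𝒯_P^+`, over any finite-dimensional algebra.

Cellularity is what exchanges the two halves. The anti-involution turns `Hom(-, R)` into a duality
on `K^b(proj R)`; combined with a shift it reverses `≥`, exchanges `R` and `R[1]`, and permutes the
two-term silting objects involutively. If `P* ≅ P`, it also exchanges factoring of `P ⟶ T` through
`add M₀` with the corresponding condition on maps to `P[1]`, hence `𝒯_P^-` with `𝒯_P^+`.

That `P* ≅ P` is the cellular input (`CellDatum.exists_mul_inv_mul_notMem`). Let `e` be an
idempotent for `P`, and `N` the space of those `x` for which `exe` is not invertible in the local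
ring of `P`. In a minimal cell `i` not contained in `N`, products `C_XS a C_TY` are scalar multiples
of `C_XY` modulo lower cells, and the involution matches the scalar for `e` with the one for its
image `e*`. A nonzero scalar for `e` therefore gives `a e* b ∉ N`, so `P` is a summand of `P*`, and
by finite length they are isomorphic. -/

/-! ### Maps to and from stalk complexes up to homotopy -/

section SingleComplexes

variable {V : Type*} [Category* V] [Preadditive V] [HasZeroObject V]

open HomologicalComplex

/-- A cocycle `φ : K.X p ⟶ N` as a morphism to a stalk complex in the homotopy category. -/
noncomputable def toSgl {K : CochainComplex V ℤ} {p : ℤ} {N : V} (φ : K.X p ⟶ N)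
    (hφ : ∀ i, K.d i p ≫ φ = 0) :
    (HomotopyCategory.quotient V _).obj K ⟶ (HomotopyCategory.singleFunctor V p).obj N :=
  (HomotopyCategory.quotient V _).map (mkHomToSingle (c := .up ℤ) φ (fun i _ => hφ i))

/-- A cocycle `φ : N ⟶ K.X p` as a morphism from a stalk complex in the homotopy category. -/
noncomputable def fromSgl {K : CochainComplex V ℤ} {p : ℤ} {N : V} (φ : N ⟶ K.X p)
    (hφ : ∀ i, φ ≫ K.d p i = 0) :
    (HomotopyCategory.singleFunctor V p).obj N ⟶ (HomotopyCategory.quotient V _).obj K :=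
  (HomotopyCategory.quotient V _).map (mkHomFromSingle (c := .up ℤ) φ (fun i _ => hφ i))

lemma toSgl_surjective {K : CochainComplex V ℤ} {p : ℤ} {N : V}
    (f : (HomotopyCategory.quotient V _).obj K ⟶ (HomotopyCategory.singleFunctor V p).obj N) :
    ∃ (φ : K.X p ⟶ N) (hφ : ∀ i, K.d i p ≫ φ = 0), f = toSgl φ hφ := by
  obtain ⟨f, rfl⟩ := (HomotopyCategory.quotient _ _).map_surjective f
  change K ⟶ (single V (.up ℤ) p).obj N at f
  refine ⟨f.f p ≫ (singleObjXSelf (.up ℤ) p N).hom, fun i => ?_, ?_⟩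
  · rw [← f.comm_assoc]; simp
  · dsimp only [toSgl]
    congr 1
    apply to_single_hom_ext
    simp [mkHomToSingle_f]

lemma fromSgl_surjective {K : CochainComplex V ℤ} {p : ℤ} {N : V}
    (f : (HomotopyCategory.singleFunctor V p).obj N ⟶ (HomotopyCategory.quotient V _).obj K) :
    ∃ (φ : N ⟶ K.X p) (hφ : ∀ i, φ ≫ K.d p i = 0), f = fromSgl φ hφ := by
  obtain ⟨f, rfl⟩ := (HomotopyCategory.quotient _ _).map_surjective f
  change (single V (.up ℤ) p).obj N ⟶ K at f
  refine ⟨(singleObjXSelf (.up ℤ) p N).inv ≫ f.f p, fun i => ?_, ?_⟩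
  · simp
  · dsimp only [fromSgl]
    congr 1
    apply from_single_hom_ext
    simp [mkHomFromSingle_f]

/-- A homotopy into a complex concentrated in degree `p` has only one component that matters, namely
`K.X q ⟶ N` with `q = p + 1`. -/
lemma toSgl_eq_zero_iff {K : CochainComplex V ℤ} {p : ℤ} {N : V} (φ : K.X p ⟶ N)
    (hφ : ∀ i, K.d i p ≫ φ = 0) (q : ℤ) (hq : p + 1 = q) :
    toSgl φ hφ = 0 ↔ ∃ ψ : K.X q ⟶ N, K.d p q ≫ ψ = φ := by
  refine (HomotopyCategory.quotient_map_eq_zero_iff (mkHomToSingle (c := .up ℤ) φ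
    (fun i _ => hφ i))).trans ?_
  constructor
  · rintro ⟨h⟩
    have := h.comm p
    refine ⟨h.hom q p ≫ (singleObjXSelf (.up ℤ) p N).hom, ?_⟩
    rw [dNext_eq _ (show (ComplexShape.up ℤ).Rel p q from hq), mkHomToSingle_f] at this
    rw [← cancel_mono (singleObjXSelf (.up ℤ) p N).inv, this,
      prevD_eq _ (show (ComplexShape.up ℤ).Rel (p - 1) p by simp)]
    simp
  · rintro ⟨ψ, rfl⟩
    let h : ∀ i j, (ComplexShape.up ℤ).Rel j i → (K.X i ⟶ ((single V (.up ℤ) p).obj N).X j) :=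
      fun i j _ => if hij : i = q ∧ j = p then (K.XIsoOfEq hij.1).hom ≫ ψ ≫
        (singleObjXIsoOfEq (.up ℤ) p N j hij.2).inv else 0
    refine ⟨(Homotopy.ofEq ?_).trans (Homotopy.nullHomotopy' h)⟩
    apply to_single_hom_ext
    rw [mkHomToSingle_f, Homotopy.nullHomotopicMap'_f (k₂ := p - 1) (k₁ := p) (k₀ := q)
      (by simp) (by simpa using hq)]
    have h1 : h q p (by simpa using hq) = ψ ≫ (singleObjXSelf (.up ℤ) p N).inv := by
      dsimp [h]
      rw [dif_pos ⟨rfl, rfl⟩]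
      simp
      rfl
    rw [h1]
    simp

lemma fromSgl_eq_zero_iff {K : CochainComplex V ℤ} {p : ℤ} {N : V} (φ : N ⟶ K.X p)
    (hφ : ∀ i, φ ≫ K.d p i = 0) (q : ℤ) (hq : q + 1 = p) :
    fromSgl φ hφ = 0 ↔ ∃ ψ : N ⟶ K.X q, ψ ≫ K.d q p = φ := by
  refine (HomotopyCategory.quotient_map_eq_zero_iff (mkHomFromSingle (c := .up ℤ) φ
    (fun i _ => hφ i))).trans ?_
  constructor
  · rintro ⟨h⟩
    have := h.comm p
    refine ⟨(singleObjXSelf (.up ℤ) p N).inv ≫ h.hom p q, ?_⟩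
    rw [prevD_eq _ (show (ComplexShape.up ℤ).Rel q p from hq), mkHomFromSingle_f] at this
    rw [← cancel_epi (singleObjXSelf (.up ℤ) p N).hom, this,
      dNext_eq _ (show (ComplexShape.up ℤ).Rel p (p + 1) by simp)]
    simp
  · rintro ⟨ψ, rfl⟩
    let h : ∀ i j, (ComplexShape.up ℤ).Rel j i → (((single V (.up ℤ) p).obj N).X i ⟶ K.X j) :=
      fun i j _ => if hij : i = p ∧ j = q then (singleObjXIsoOfEq (.up ℤ) p N i hij.1).hom ≫ ψ ≫
        (K.XIsoOfEq hij.2).inv else 0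
    refine ⟨(Homotopy.ofEq ?_).trans (Homotopy.nullHomotopy' h)⟩
    apply from_single_hom_ext
    rw [mkHomFromSingle_f, Homotopy.nullHomotopicMap'_f (k₂ := q) (k₁ := p) (k₀ := p + 1)
      (by simpa using hq) (by simp)]
    have h1 : h p q (by simpa using hq) = (singleObjXSelf (.up ℤ) p N).hom ≫ ψ := by
      dsimp [h]
      rw [dif_pos ⟨rfl, rfl⟩]
      simp
      rfl
    rw [h1]
    simp

lemma toSgl_comp {K : CochainComplex V ℤ} {p : ℤ} {N N' : V} (φ : K.X p ⟶ N)
    (hφ : ∀ i, K.d i p ≫ φ = 0) (g : N ⟶ N') :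
    toSgl φ hφ ≫ (HomotopyCategory.singleFunctor V p).map g =
      toSgl (φ ≫ g) (fun i => by rw [← Category.assoc, hφ, zero_comp]) := by
  change (HomotopyCategory.quotient V _).map _ ≫ (HomotopyCategory.quotient V _).map
    ((single V (.up ℤ) p).map g) = _
  rw [← Functor.map_comp, toSgl]
  congr 1
  apply to_single_hom_ext
  simp [mkHomToSingle_f, single_map_f_self]

lemma comp_fromSgl {K : CochainComplex V ℤ} {p : ℤ} {N N' : V} (φ : N ⟶ K.X p)
    (hφ : ∀ i, φ ≫ K.d p i = 0) (g : N' ⟶ N) :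
    (HomotopyCategory.singleFunctor V p).map g ≫ fromSgl φ hφ =
      fromSgl (g ≫ φ) (fun i => by rw [Category.assoc, hφ, comp_zero]) := by
  change (HomotopyCategory.quotient V _).map ((single V (.up ℤ) p).map g) ≫
    (HomotopyCategory.quotient V _).map _ = _
  rw [← Functor.map_comp, fromSgl]
  congr 1
  apply from_single_hom_ext
  simp [mkHomFromSingle_f, single_map_f_self]

lemma fromSgl_comp_toSgl {K : CochainComplex V ℤ} {p : ℤ} {N N' : V} (φ : N ⟶ K.X p)
    (hφ : ∀ i, φ ≫ K.d p i = 0) (ψ : K.X p ⟶ N') (hψ : ∀ i, K.d i p ≫ ψ = 0) :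
    fromSgl φ hφ ≫ toSgl ψ hψ = (HomotopyCategory.singleFunctor V p).map (φ ≫ ψ) := by
  change (HomotopyCategory.quotient V _).map _ ≫ (HomotopyCategory.quotient V _).map _ =
    (HomotopyCategory.quotient V _).map ((single V (.up ℤ) p).map _)
  rw [← Functor.map_comp]
  congr 1
  apply from_single_hom_ext
  simp [mkHomFromSingle_f, mkHomToSingle_f, single_map_f_self]

lemma toSgl_sub {K : CochainComplex V ℤ} {p : ℤ} {N : V} (φ ψ : K.X p ⟶ N)
    (hφ : ∀ i, K.d i p ≫ φ = 0) (hψ : ∀ i, K.d i p ≫ ψ = 0) :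
    toSgl (φ - ψ) (fun i => by rw [Preadditive.comp_sub, hφ, hψ, sub_zero]) =
      toSgl φ hφ - toSgl ψ hψ := by
  refine Eq.trans (congrArg (HomotopyCategory.quotient V (.up ℤ)).map ?_)
    ((HomotopyCategory.quotient V (.up ℤ)).map_sub (f := mkHomToSingle (c := .up ℤ) φ
    (fun i _ => hφ i)) (g := mkHomToSingle (c := .up ℤ) ψ (fun i _ => hψ i)))
  apply to_single_hom_ext
  simp [mkHomToSingle_f]

lemma fromSgl_add {K : CochainComplex V ℤ} {p : ℤ} {N : V} (φ ψ : N ⟶ K.X p)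
    (hφ : ∀ i, φ ≫ K.d p i = 0) (hψ : ∀ i, ψ ≫ K.d p i = 0) :
    fromSgl (φ + ψ) (fun i => by rw [Preadditive.add_comp, hφ, hψ, add_zero]) =
      fromSgl φ hφ + fromSgl ψ hψ := by
  refine Eq.trans (congrArg (HomotopyCategory.quotient V (.up ℤ)).map ?_)
    ((HomotopyCategory.quotient V (.up ℤ)).map_add (f := mkHomFromSingle (c := .up ℤ) φ
    (fun i _ => hφ i)) (g := mkHomFromSingle (c := .up ℤ) ψ (fun i _ => hψ i)))
  apply from_single_hom_ext
  simp [mkHomFromSingle_f]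

instance (p : ℤ) : (HomotopyCategory.singleFunctor V p).Full where
  map_surjective f := by
    obtain ⟨f, rfl⟩ := (HomotopyCategory.quotient _ _).map_surjective f
    obtain ⟨g, rfl⟩ := (CochainComplex.singleFunctor V p).map_surjective f
    exact ⟨g, rfl⟩

instance (p : ℤ) : (HomotopyCategory.singleFunctor V p).Faithful where
  map_injective {X Y} f g h := by
    rw [← sub_eq_zero, ← Functor.map_sub] at h
    rw [← sub_eq_zero]
    have h' : (HomotopyCategory.quotient V _).map ((single V (.up ℤ) p).map (f - g)) = 0 := h
    rw [HomotopyCategory.quotient_map_eq_zero_iff] at h'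
    obtain ⟨h'⟩ := h'
    have := h'.comm p
    rw [prevD_eq _ (show (ComplexShape.up ℤ).Rel (p - 1) p by simp),
      dNext_eq _ (show (ComplexShape.up ℤ).Rel p (p + 1) by simp), single_map_f_self] at this
    rw [← cancel_epi (singleObjXSelf (.up ℤ) p X).hom,
      ← cancel_mono (singleObjXSelf (.up ℤ) p Y).inv, Category.assoc, this]
    simp

end SingleComplexes

/-! ### Sums of morphisms factoring through a fixed object -/

section Thru

variable {C : Type*} [Category* C] [Preadditive C]

/-- The subgroup of morphisms `X ⟶ Y` that are sums of morphisms factoring through `M`. -/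
def thru (M X Y : C) : AddSubgroup (X ⟶ Y) :=
  AddSubgroup.closure {f | ∃ (a : X ⟶ M) (b : M ⟶ Y), a ≫ b = f}

lemma comp_mem_thru {M X Y : C} (a : X ⟶ M) (b : M ⟶ Y) : a ≫ b ∈ thru M X Y :=
  AddSubgroup.subset_closure ⟨a, b, rfl⟩

@[elab_as_elim]
lemma thru_induction {M X Y : C} {p : ∀ f : X ⟶ Y, f ∈ thru M X Y → Prop} (hz : p 0 (zero_mem _))
    (hc : ∀ (a : X ⟶ M) (b : M ⟶ Y), p (a ≫ b) (comp_mem_thru a b))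
    (ha : ∀ f g hf hg, p f hf → p g hg → p (f + g) (add_mem hf hg))
    {f : X ⟶ Y} (hf : f ∈ thru M X Y) : p f hf := by
  induction hf using AddSubgroup.closure_induction'' with
  | mem x hx => obtain ⟨a, b, rfl⟩ := hx; exact hc a b
  | neg_mem x hx =>
    obtain ⟨a, b, rfl⟩ := hx
    have := hc (-a) b
    simpa only [Preadditive.neg_comp] using this
  | zero => exact hz
  | add f g hf hg h₁ h₂ => exact ha f g hf hg h₁ h₂

lemma thru_precomp {M X X' Y : C} (g : X' ⟶ X) {f : X ⟶ Y} (hf : f ∈ thru M X Y) :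
    g ≫ f ∈ thru M X' Y := by
  induction hf using thru_induction with
  | hz => rw [comp_zero]; exact zero_mem _
  | hc a b => rw [← Category.assoc]; exact comp_mem_thru _ _
  | ha f g _ _ h₁ h₂ => rw [Preadditive.comp_add]; exact add_mem h₁ h₂

lemma thru_postcomp {M X Y Y' : C} {f : X ⟶ Y} (hf : f ∈ thru M X Y) (g : Y ⟶ Y') :
    f ≫ g ∈ thru M X Y' := by
  induction hf using thru_induction with
  | hz => rw [zero_comp]; exact zero_mem _
  | hc a b => rw [Category.assoc]; exact comp_mem_thru _ _
  | ha f g _ _ h₁ h₂ => rw [Preadditive.add_comp]; exact add_mem h₁ h₂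

lemma thru_of_src {M X : C} (h : 𝟙 X ∈ thru M X X) {Y : C} (f : X ⟶ Y) : f ∈ thru M X Y := by
  simpa using thru_postcomp h f

lemma thru_of_tgt {M Y : C} (h : 𝟙 Y ∈ thru M Y Y) {X : C} (f : X ⟶ Y) : f ∈ thru M X Y := by
  simpa using thru_precomp f h

lemma thru_trans {M N X Y : C} (h : 𝟙 M ∈ thru N M M) {f : X ⟶ Y} (hf : f ∈ thru M X Y) :
    f ∈ thru N X Y := by
  induction hf using thru_induction with
  | hz => exact zero_mem _
  | hc a b => exact thru_precomp a (thru_of_src h b)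
  | ha f g _ _ h₁ h₂ => exact add_mem h₁ h₂

lemma map_mem_thru {D : Type*} [Category* D] [Preadditive D] (F : C ⥤ D) [F.Additive]
    {M X Y : C} {f : X ⟶ Y} (hf : f ∈ thru M X Y) :
    F.map f ∈ thru (F.obj M) (F.obj X) (F.obj Y) := by
  induction hf using thru_induction with
  | hz => rw [F.map_zero]; exact zero_mem _
  | hc a b => rw [F.map_comp]; exact comp_mem_thru _ _
  | ha f g _ _ h₁ h₂ => rw [F.map_add]; exact add_mem h₁ h₂

lemma mem_thru_of_map {D : Type*} [Category* D] [Preadditive D] (F : C ⥤ D) [F.Additive] [F.Full]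
    [F.Faithful] {M X Y : C} {f : X ⟶ Y} (hf : F.map f ∈ thru (F.obj M) (F.obj X) (F.obj Y)) :
    f ∈ thru M X Y := by
  have key : ∀ g : F.obj X ⟶ F.obj Y, g ∈ thru (F.obj M) (F.obj X) (F.obj Y) →
      F.preimage g ∈ thru M X Y := by
    intro g hg
    induction hg using thru_induction with
    | hz =>
      have : F.preimage (0 : F.obj X ⟶ F.obj Y) = 0 := F.map_injective (by simp)
      rw [this]; exact zero_mem _
    | hc a b => rw [F.preimage_comp]; exact comp_mem_thru _ _
    | ha f g _ _ h₁ h₂ =>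
      have : F.preimage (f + g) = F.preimage f + F.preimage g := F.map_injective (by simp)
      rw [this]; exact add_mem h₁ h₂
  simpa using key _ hf

lemma thru_iso {M M' X Y : C} (e : M ≅ M') {f : X ⟶ Y} (hf : f ∈ thru M X Y) :
    f ∈ thru M' X Y :=
  thru_trans (by simpa using comp_mem_thru e.hom e.inv) hf

lemma exists_sum_of_mem_thru {M X Y : C} {f : X ⟶ Y} (hf : f ∈ thru M X Y) :
    ∃ (n : ℕ) (a : Fin n → (X ⟶ M)) (b : Fin n → (M ⟶ Y)), ∑ k, a k ≫ b k = f := by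
  induction hf using thru_induction with
  | hz => exact ⟨0, fun _ => 0, fun _ => 0, by simp⟩
  | hc a b => exact ⟨1, fun _ => a, fun _ => b, by simp⟩
  | ha f g _ _ h₁ h₂ =>
    obtain ⟨n, a, b, rfl⟩ := h₁
    obtain ⟨m, a', b', rfl⟩ := h₂
    exact ⟨n + m, Fin.append a a', Fin.append b b', by simp [Fin.sum_univ_add]⟩

end Thru

/-! ### Objects with local endomorphism ring -/

section LocalEnd

lemma IsLocalRing.of_equiv {A B : Type*} [Ring A] [Ring B] [IsLocalRing A] (φ : A ≃+* B) :
    IsLocalRing B where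
  exists_pair_ne := φ.injective.nontrivial.exists_pair_ne
  isUnit_or_isUnit_of_add_one {a b} h := by
    have : φ.symm a + φ.symm b = 1 := by rw [← map_add, h, map_one]
    refine (IsLocalRing.isUnit_or_isUnit_of_add_one this).imp (fun h => ?_) (fun h => ?_)
    · simpa using h.map φ
    · simpa using h.map φ

lemma IsLocalRing.exists_isUnit_of_isUnit_sum {A : Type*} [Ring A] [IsLocalRing A] {ι : Type*}
    (s : Finset ι) (f : ι → A) (h : IsUnit (∑ k ∈ s, f k)) : ∃ k ∈ s, IsUnit (f k) := by
  classical
  induction s using Finset.induction_on with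
  | empty => simp at h
  | insert a s ha ih =>
    rw [Finset.sum_insert ha] at h
    obtain ⟨w, hw⟩ := h
    have h1 : (↑w⁻¹ * f a) + (↑w⁻¹ * ∑ k ∈ s, f k) = 1 := by
      rw [← mul_add, ← hw, Units.inv_mul]
    rcases IsLocalRing.isUnit_or_isUnit_of_add_one h1 with h2 | h2
    · exact ⟨a, by simp, by simpa using h2⟩
    · obtain ⟨k, hk, hk'⟩ := ih (by simpa using h2)
      exact ⟨k, by simp [hk], hk'⟩

variable {C : Type*} [Category* C] [Preadditive C]

lemma exists_isIso_of_isIso_sum {X : C} [IsLocalRing (End X)] {ι : Type*} (s : Finset ι)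
    (f : ι → (X ⟶ X)) (h : IsIso (∑ k ∈ s, f k)) : ∃ k ∈ s, IsIso (f k) := by
  obtain ⟨k, hk, hk'⟩ := IsLocalRing.exists_isUnit_of_isUnit_sum (A := End X) s f
    ((isUnit_iff_isIso _).2 h)
  exact ⟨k, hk, (isUnit_iff_isIso _).1 hk'⟩

omit [Preadditive C] in
lemma exists_retract_of_isIso {X Y : C} (a : X ⟶ Y) (b : Y ⟶ X) [IsIso (a ≫ b)] :
    Nonempty (Retract X Y) := ⟨⟨a, b ≫ inv (a ≫ b), by rw [← Category.assoc]; simp⟩⟩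

/-- In a local ring a finite sum of non-units is a non-unit, so one of the summands `a k ≫ b k` of
the identity is already invertible. -/
lemma retract_of_id_mem_thru {X M : C} [IsLocalRing (End X)] (h : 𝟙 X ∈ thru M X X) :
    Nonempty (Retract X M) := by
  obtain ⟨n, a, b, hab⟩ := exists_sum_of_mem_thru h
  obtain ⟨k, -, hk⟩ := exists_isIso_of_isIso_sum Finset.univ (fun k => a k ≫ b k)
    (by rw [hab]; infer_instance)
  exact exists_retract_of_isIso (a k) (b k)

lemma id_mem_thru_of_retract {X M : C} (r : Retract X M) : 𝟙 X ∈ thru M X X := by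
  rw [← r.retract]; exact comp_mem_thru _ _

lemma not_isZero_of_isLocalRing_end {X : C} [h : IsLocalRing (End X)] : ¬ IsZero X := fun hX =>
  zero_ne_one (α := End X) (hX.eq_of_src _ _)

lemma indecomposable_of_isLocalRing_end [HasBinaryBiproducts C] {X : C} [IsLocalRing (End X)] :
    Indecomposable X := by
  refine ⟨not_isZero_of_isLocalRing_end, fun Y Z e => ?_⟩
  let a : End X := e.hom ≫ biprod.fst ≫ biprod.inl ≫ e.inv
  let b : End X := e.hom ≫ biprod.snd ≫ biprod.inr ≫ e.inv
  have hab : a + b = 1 := by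
    change e.hom ≫ biprod.fst ≫ biprod.inl ≫ e.inv + e.hom ≫ biprod.snd ≫ biprod.inr ≫ e.inv = 𝟙 X
    rw [← Preadditive.comp_add, ← Category.assoc biprod.fst, ← Category.assoc biprod.snd,
      ← Preadditive.add_comp, biprod.total]
    simp
  rcases IsLocalRing.isUnit_or_isUnit_of_add_one hab with h | h
  · right
    rw [isUnit_iff_isIso] at h
    rw [IsZero.iff_id_eq_zero]
    have h1 : (biprod.inr ≫ e.inv) ≫ a = 0 := by simp [a]
    have h2 : biprod.inr (X := Y) (Y := Z) ≫ e.inv = 0 := by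
      rw [← cancel_mono a, h1, zero_comp]
    rw [← biprod.inr_snd (X := Y) (Y := Z), ← Category.comp_id (biprod.inr (X := Y) (Y := Z)),
      ← e.inv_hom_id, reassoc_of% h2, zero_comp, zero_comp]
  · left
    rw [isUnit_iff_isIso] at h
    rw [IsZero.iff_id_eq_zero]
    have h1 : (biprod.inl ≫ e.inv) ≫ b = 0 := by simp [b]
    have h2 : biprod.inl (X := Y) (Y := Z) ≫ e.inv = 0 := by
      rw [← cancel_mono b, h1, zero_comp]
    rw [← biprod.inl_fst (X := Y) (Y := Z), ← Category.comp_id (biprod.inl (X := Y) (Y := Z)),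
      ← e.inv_hom_id, reassoc_of% h2, zero_comp, zero_comp]

end LocalEnd

/-! ### Additive closures and basic objects in a triangulated category -/

section TriangulatedGeneric

variable {𝒯 : Type*} [Category* 𝒯] [HasZeroObject 𝒯] [HasShift 𝒯 ℤ] [Preadditive 𝒯]
  [∀ n : ℤ, (shiftFunctor 𝒯 n).Additive] [Pretriangulated 𝒯]

/-- The right-hand side is the working form of membership in `add M`: it mentions no biproducts, so
it passes directly through additive functors and dualities. -/
lemma addClosure_iff {M X : 𝒯} : addClosure M X ↔ 𝟙 X ∈ thru M X X := by
  constructor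
  · rintro ⟨n, ⟨r⟩⟩
    rw [← r.retract, ← Category.id_comp r.r, ← biproduct.total, Preadditive.sum_comp,
      Preadditive.comp_sum]
    refine sum_mem fun k _ => ?_
    rw [Category.assoc, ← Category.assoc]
    exact comp_mem_thru _ _
  · intro h
    obtain ⟨n, a, b, hab⟩ := exists_sum_of_mem_thru h
    exact ⟨n, ⟨⟨biproduct.lift a, biproduct.desc b, by rw [biproduct.lift_desc, hab]⟩⟩⟩

/-- In a triangulated category a split monomorphism has its cone as a complement, with no assumption
on idempotents; indecomposability of `Y` then makes the cone zero. -/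
lemma isIso_of_retract_indecomposable {X Y : 𝒯} (hX : ¬ IsZero X) (hY : Indecomposable Y)
    (r : Retract X Y) : IsIso r.i := by
  obtain ⟨Z, g, h, hT⟩ := distinguished_cocone_triangle r.i
  have h0 : h = 0 := by
    have h1 : h ≫ r.i⟦(1 : ℤ)⟧' = 0 := comp_distTriang_mor_zero₃₁ _ hT
    rw [← Category.comp_id h, ← CategoryTheory.Functor.map_id, ← r.retract, Functor.map_comp, reassoc_of% h1,
      zero_comp]
  obtain ⟨e, -, -⟩ := exists_iso_binaryBiproduct_of_distTriang _ hT h0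
  have hZ : IsZero Z := (hY.2 X Z e).resolve_left hX
  exact (Triangle.isZero₃_iff_isIso₁ _ hT).1 hZ

lemma isIso_left_of_isIso_comp {X Y : 𝒯} (hX : ¬ IsZero X) (hY : Indecomposable Y)
    (a : X ⟶ Y) (b : Y ⟶ X) (h : IsIso (a ≫ b)) : IsIso a :=
  isIso_of_retract_indecomposable hX hY
    ⟨a, b ≫ inv (a ≫ b), by rw [← Category.assoc]; simp⟩

/-- In a basic object, an indecomposable summand with local endomorphism ring occurs once. -/
lemma id_notMem_thru_of_isBasic {P M T : 𝒯} [IsLocalRing (End P)] (hT : IsBasic T)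
    (e : T ≅ P ⊞ M) : 𝟙 P ∉ thru M P P := by
  classical
  intro hP
  obtain ⟨r⟩ := retract_of_id_mem_thru hP
  obtain ⟨n, X, hX, hX', ⟨e'⟩⟩ := hT
  have hP0 : ¬ IsZero P := not_isZero_of_isLocalRing_end
  let E : (⨁ X) ≅ P ⊞ M := e'.symm ≪≫ e
  have tot : ∀ (a : P ⟶ P ⊞ M) (b : P ⊞ M ⟶ P),
      ∑ k, ((a ≫ E.inv ≫ biproduct.π X k) ≫ (biproduct.ι X k ≫ E.hom ≫ b)) = a ≫ b := by
    intro a b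
    have : ∀ k, ((a ≫ E.inv ≫ biproduct.π X k) ≫ (biproduct.ι X k ≫ E.hom ≫ b)) =
      a ≫ E.inv ≫ (biproduct.π X k ≫ biproduct.ι X k) ≫ E.hom ≫ b := by intro k; simp
    simp_rw [this]
    rw [← Preadditive.comp_sum, ← Preadditive.comp_sum, ← Preadditive.sum_comp, biproduct.total]
    simp
  have iso : ∀ (a : P ⟶ P ⊞ M) (b : P ⊞ M ⟶ P) (k : Fin n),
      IsIso ((a ≫ E.inv ≫ biproduct.π X k) ≫ (biproduct.ι X k ≫ E.hom ≫ b)) →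
        IsIso (a ≫ E.inv ≫ biproduct.π X k) ∧ IsIso (biproduct.ι X k ≫ E.hom ≫ b) := by
    intro a b k h
    have h1 := isIso_left_of_isIso_comp hP0 (hX k) _ _ h
    exact ⟨h1, IsIso.of_isIso_comp_left (a ≫ E.inv ≫ biproduct.π X k) _⟩
  obtain ⟨k, -, hk⟩ := exists_isIso_of_isIso_sum Finset.univ _
    (by rw [tot biprod.inl biprod.fst]; simp; infer_instance)
  obtain ⟨l, -, hl⟩ := exists_isIso_of_isIso_sum Finset.univ _
    (by rw [tot (r.i ≫ biprod.inr) (biprod.snd ≫ r.r)]; simp; infer_instance)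
  obtain ⟨hk₁, hk₂⟩ := iso _ _ _ hk
  obtain ⟨hl₁, hl₂⟩ := iso _ _ _ hl
  obtain rfl : k = l := hX' k l ⟨(asIso (biprod.inl ≫ E.inv ≫ biproduct.π X k)).symm ≪≫
    asIso ((r.i ≫ biprod.inr) ≫ E.inv ≫ biproduct.π X l)⟩
  -- `P` sits in `T` as the first summand and again inside `M`, both times isomorphically onto `X
  -- k`. The composite `inl ≫ snd` vanishes, while the `k`-th term of its expansion is invertible;
  -- hence another term `m ≠ k` is invertible as well, and `X m ≅ P ≅ X k` contradicts basicness.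
  have h0 := tot biprod.inl (biprod.snd ≫ r.r)
  rw [← Category.assoc biprod.inl, biprod.inl_snd, zero_comp,
    ← Finset.add_sum_erase _ _ (Finset.mem_univ k)] at h0
  have h1 : IsIso (∑ m ∈ Finset.univ.erase k, (biprod.inl ≫ E.inv ≫ biproduct.π X m) ≫
      (biproduct.ι X m ≫ E.hom ≫ biprod.snd ≫ r.r)) := by
    rw [← neg_eq_of_add_eq_zero_right h0, ← isUnit_iff_isIso (X := P)]
    exact IsUnit.neg (α := End P) ((isUnit_iff_isIso _).2 (IsIso.comp_isIso' hk₁ hl₂))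
  obtain ⟨m, hm, hm'⟩ := exists_isIso_of_isIso_sum _ _ h1
  obtain ⟨hm₁, -⟩ := iso _ _ _ hm'
  refine (Finset.ne_of_mem_erase hm) (hX' m k ⟨(asIso (biprod.inl ≫ E.inv ≫ biproduct.π X m)).symm
    ≪≫ asIso (biprod.inl ≫ E.inv ≫ biproduct.π X k)⟩)

end TriangulatedGeneric

/-! ### Bounded complexes of projectives against stalk complexes of modules -/

section HomotopyLemmas

variable {R : Type u} [Ring R]

variable (R) in
/-- Stalk complexes in degree `p`, in the homotopy category. -/
noncomputable abbrev sgl (p : ℤ) :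
    ModuleCat.{u} R ⥤ HomotopyCategory (ModuleCat.{u} R) (ComplexShape.up ℤ) :=
  HomotopyCategory.singleFunctor (ModuleCat.{u} R) p

/-- The image of a complex in the homotopy category. -/
noncomputable abbrev toK (K : CochainComplex (ModuleCat.{u} R) ℤ) :
    HomotopyCategory (ModuleCat.{u} R) (ComplexShape.up ℤ) :=
  (HomotopyCategory.quotient _ _).obj K

lemma id_mem_thru_of_fgProj {Q : ModuleCat.{u} R} (hQ : fgProj R Q) :
    𝟙 Q ∈ thru (ModuleCat.of R R) Q Q := by
  obtain ⟨h₁, h₂⟩ := hQ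
  obtain ⟨n, f, hf⟩ := Module.Finite.exists_fin' R Q
  obtain ⟨s, hs⟩ := Module.projective_lifting_property f LinearMap.id hf
  have : 𝟙 Q = ∑ k : Fin n, ModuleCat.ofHom (LinearMap.proj k ∘ₗ s) ≫
      ModuleCat.ofHom (f ∘ₗ LinearMap.single R (fun _ => R) k) := by
    ext x
    have h1 : f (∑ k, Pi.single k (s x k)) = x := by
      rw [Finset.univ_sum_single]; exact LinearMap.congr_fun hs x
    rw [map_sum] at h1
    simpa [ModuleCat.hom_sum] using h1.symm
  rw [this]
  exact sum_mem fun k _ => comp_mem_thru _ _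

lemma projective_of_fgProj {Q : ModuleCat.{u} R} (hQ : fgProj R Q) : Projective Q :=
  (IsProjective.iff_projective Q).1 hQ.2

lemma fgProj_self : fgProj R (ModuleCat.of R R) :=
  ⟨inferInstanceAs (Module.Finite R R), inferInstanceAs (Module.Projective R R)⟩

lemma shortExact_of_ker_eq {M N : ModuleCat.{u} R} (L : Submodule R M) (f : M →ₗ[R] N)
    (hf : Function.Surjective f) (h : LinearMap.ker f = L) :
    (ShortComplex.mk (ModuleCat.ofHom L.subtype) (ModuleCat.ofHom f)
      (by ext x; change f x.1 = 0; rw [← LinearMap.mem_ker, h]; exact x.2)).ShortExact where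
  exact := by
    subst h
    rw [ShortComplex.ShortExact.moduleCat_exact_iff_function_exact]
    intro (x : M)
    exact ⟨fun hx => ⟨⟨x, hx⟩, rfl⟩, fun ⟨y, hy⟩ => hy ▸ y.2⟩
  mono_f := (ModuleCat.mono_iff_injective _).2 L.injective_subtype
  epi_g := (ModuleCat.epi_iff_surjective _).2 hf

variable {K : CochainComplex (ModuleCat.{u} R) ℤ}

lemma d_comp_eq_zero_of_pred {p q : ℤ} (hpq : q + 1 = p) {N : ModuleCat.{u} R} {φ : K.X p ⟶ N}
    (h : K.d q p ≫ φ = 0) (i : ℤ) : K.d i p ≫ φ = 0 := by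
  by_cases hi : i = q
  · subst hi; exact h
  · rw [K.shape, zero_comp]
    simp; lia

lemma comp_d_eq_zero_of_succ {p q : ℤ} (hpq : p + 1 = q) {N : ModuleCat.{u} R} {φ : N ⟶ K.X p}
    (h : φ ≫ K.d p q = 0) (i : ℤ) : φ ≫ K.d p i = 0 := by
  by_cases hi : i = q
  · subst hi; exact h
  · rw [K.shape, comp_zero]
    simp; lia

/-- This is exactness of the long exact sequence of `Hom(K, -)` attached to a short exact sequence
of modules. The obstruction lies in maps to `S.X₁` placed one degree lower. -/
lemma exists_lift_sgl (hK : ∀ i, Projective (K.X i)) {S : ShortComplex (ModuleCat.{u} R)}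
    (hS : S.ShortExact) {p q : ℤ} (hpq : q + 1 = p)
    (h0 : ∀ f : toK K ⟶ (sgl R q).obj S.X₁, f = 0) (f : toK K ⟶ (sgl R p).obj S.X₃) :
    ∃ g : toK K ⟶ (sgl R p).obj S.X₂, g ≫ (sgl R p).map S.g = f := by
  have := hS.mono_f
  have := hS.epi_g
  obtain ⟨φ, hφ, rfl⟩ := toSgl_surjective f
  let φ' : K.X p ⟶ S.X₂ := Projective.factorThru φ S.g
  have hφ' : φ' ≫ S.g = φ := Projective.factorThru_comp _ _
  let l : K.X q ⟶ S.X₁ := hS.exact.lift (K.d q p ≫ φ') (by rw [Category.assoc, hφ', hφ])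
  have hl : l ≫ S.f = K.d q p ≫ φ' := hS.exact.lift_f _ _
  have hl' : ∀ i, K.d i q ≫ l = 0 := fun i => by
    rw [← cancel_mono S.f, Category.assoc, hl]; simp
  obtain ⟨ψ, hψ⟩ := (toSgl_eq_zero_iff l hl' p hpq).1 (h0 _)
  have hc : ∀ i, K.d i p ≫ (φ' - ψ ≫ S.f) = 0 := d_comp_eq_zero_of_pred hpq (by
    rw [Preadditive.comp_sub, ← Category.assoc, hψ, hl, sub_self])
  refine ⟨toSgl _ hc, ?_⟩
  rw [toSgl_comp]
  congr 1
  simp [hφ']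

lemma exists_lift_sgl_of_comp_eq_zero (hK : ∀ i, Projective (K.X i))
    {S : ShortComplex (ModuleCat.{u} R)} (hS : S.ShortExact) {p : ℤ}
    (f : toK K ⟶ (sgl R p).obj S.X₂) (hf : f ≫ (sgl R p).map S.g = 0) :
    ∃ g : toK K ⟶ (sgl R p).obj S.X₁, g ≫ (sgl R p).map S.f = f := by
  have := hS.mono_f
  have := hS.epi_g
  obtain ⟨φ, hφ, rfl⟩ := toSgl_surjective f
  rw [toSgl_comp, toSgl_eq_zero_iff _ _ (p + 1) rfl] at hf
  obtain ⟨ψ, hψ⟩ := hf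
  let ψ' : K.X (p + 1) ⟶ S.X₂ := Projective.factorThru ψ S.g
  have hψ' : ψ' ≫ S.g = ψ := Projective.factorThru_comp _ _
  let l : K.X p ⟶ S.X₁ := hS.exact.lift (φ - K.d p (p + 1) ≫ ψ')
    (by rw [Preadditive.sub_comp, Category.assoc, hψ', hψ, sub_self])
  have hl : l ≫ S.f = φ - K.d p (p + 1) ≫ ψ' := hS.exact.lift_f _ _
  have hl' : ∀ i, K.d i p ≫ l = 0 := fun i => by
    rw [← cancel_mono S.f, Category.assoc, hl]; simp [hφ]
  refine ⟨toSgl l hl', ?_⟩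
  have h1 : toSgl (K.d p (p + 1) ≫ ψ') (fun i => by simp) = 0 :=
    (toSgl_eq_zero_iff _ _ (p + 1) rfl).2 ⟨ψ', rfl⟩
  rw [toSgl_comp]
  simp only [hl]
  rw [toSgl_sub φ (K.d p (p + 1) ≫ ψ') hφ (fun i => by simp), h1, sub_zero]

lemma eq_zero_of_id_mem_thru {C : Type*} [Category* C] [Preadditive C] {M Y X : C}
    (hY : 𝟙 Y ∈ thru M Y Y) (h : ∀ f : X ⟶ M, f = 0) (f : X ⟶ Y) : f = 0 := by
  obtain ⟨n, a, b, hab⟩ := exists_sum_of_mem_thru hY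
  rw [← Category.comp_id f, ← hab, Preadditive.comp_sum]
  exact Finset.sum_eq_zero fun k _ => by rw [← Category.assoc, h (f ≫ a k), zero_comp]

lemma eq_zero_of_id_mem_thru' {C : Type*} [Category* C] [Preadditive C] {M Y X : C}
    (hX : 𝟙 X ∈ thru M X X) (h : ∀ f : M ⟶ Y, f = 0) (f : X ⟶ Y) : f = 0 := by
  obtain ⟨n, a, b, hab⟩ := exists_sum_of_mem_thru hX
  rw [← Category.id_comp f, ← hab, Preadditive.sum_comp]
  exact Finset.sum_eq_zero fun k _ => by rw [Category.assoc, h (b k ≫ f), comp_zero]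

lemma hom_sgl_eq_zero_of_regular {X : HomotopyCategory (ModuleCat.{u} R) (.up ℤ)} {p : ℤ}
    (h : ∀ f : X ⟶ (sgl R p).obj (ModuleCat.of R R), f = 0) {Q : ModuleCat.{u} R}
    (hQ : fgProj R Q) (f : X ⟶ (sgl R p).obj Q) : f = 0 :=
  eq_zero_of_id_mem_thru
    (by simpa using map_mem_thru (sgl R p) (id_mem_thru_of_fgProj hQ)) h f

lemma sgl_hom_eq_zero_of_regular {X : HomotopyCategory (ModuleCat.{u} R) (.up ℤ)} {p : ℤ}
    (h : ∀ f : (sgl R p).obj (ModuleCat.of R R) ⟶ X, f = 0) {Q : ModuleCat.{u} R}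
    (hQ : fgProj R Q) (f : (sgl R p).obj Q ⟶ X) : f = 0 :=
  eq_zero_of_id_mem_thru'
    (by simpa using map_mem_thru (sgl R p) (id_mem_thru_of_fgProj hQ)) h f

lemma exists_free_cover [IsNoetherianRing R] (N : ModuleCat.{u} R) [Module.Finite R N] :
    ∃ S : ShortComplex (ModuleCat.{u} R), S.ShortExact ∧ S.X₃ = N ∧ fgProj R S.X₂ ∧
      Module.Finite R S.X₁ := by
  obtain ⟨n, f, hf⟩ := Module.Finite.exists_fin' R N
  refine ⟨_, shortExact_of_ker_eq (M := ModuleCat.of R (Fin n → R)) (LinearMap.ker f) f hf rfl, rfl,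
    ⟨inferInstanceAs (Module.Finite R (Fin n → R)),
      inferInstanceAs (Module.Projective R (Fin n → R))⟩, ?_⟩
  exact inferInstanceAs (Module.Finite R (LinearMap.ker f))

/-- A bounded complex of projectives with no maps to `R` in degrees `≤ b` has no maps to finitely
generated modules in these degrees. -/
lemma hom_sgl_eq_zero_of_le [IsNoetherianRing R] (hK : bddProjComplex R K) {b : ℤ}
    (h : ∀ p ≤ b, ∀ f : toK K ⟶ (sgl R p).obj (ModuleCat.of R R), f = 0)
    (p : ℤ) (hp : p ≤ b) (N : ModuleCat.{u} R) [Module.Finite R N]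
    (f : toK K ⟶ (sgl R p).obj N) : f = 0 := by
  obtain ⟨hK₁, c, d, hK₂⟩ := hK
  -- Dimension shifting: passing from `N` to the kernel of a free cover lowers the degree by one,
  -- and below `c` the complex vanishes.
  obtain ⟨n, hn⟩ : ∃ n : ℕ, p < c + n := ⟨(p - c + 1).toNat, by lia⟩
  induction n generalizing p N with
  | zero =>
    obtain ⟨φ, hφ, rfl⟩ := toSgl_surjective f
    rw [toSgl_eq_zero_iff φ hφ (p + 1) rfl]
    exact ⟨0, (hK₂ p (Or.inl (by simpa using hn))).eq_of_src _ _⟩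
  | succ n ih =>
    obtain ⟨S, hS, rfl, hF, hN'⟩ := exists_free_cover N
    obtain ⟨g, rfl⟩ := exists_lift_sgl (fun i => projective_of_fgProj (hK₁ i)) hS
      (show p - 1 + 1 = p by lia) (ih (p - 1) (by lia) S.X₁ · (by push_cast at hn; lia)) f
    rw [hom_sgl_eq_zero_of_regular (h p hp) hF g, zero_comp]

/-- Condition of vanishing of all maps from stalk complexes of `R` in positive degrees. -/
def NoPos (X : HomotopyCategory (ModuleCat.{u} R) (.up ℤ)) : Prop :=
  ∀ p : ℤ, 0 < p → ∀ f : (sgl R p).obj (ModuleCat.of R R) ⟶ X, f = 0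

/-- By `ht`, `𝟙 - d ≫ t` maps into the cocycles of degree `j`. As `K.X j` is a summand of a free
module, it represents a map from a stalk complex in degree `j > 0`, which is null-homotopic; this is
the asserted factorisation. -/
lemma NoPos.exists_step (hK : bddProjComplex R K) (h : NoPos (toK K)) (i : ℤ) (hi : 0 ≤ i)
    {j k : ℤ} (hij : i + 1 = j) (hjk : j + 1 = k) (t : K.X k ⟶ K.X j)
    (ht : K.d j k ≫ t ≫ K.d j k = K.d j k) :
    ∃ s : K.X j ⟶ K.X i, s ≫ K.d i j = 𝟙 _ - K.d j k ≫ t := by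
  have hφ : ∀ l, (𝟙 _ - K.d j k ≫ t) ≫ K.d j l = 0 := comp_d_eq_zero_of_succ hjk (by
    rw [Preadditive.sub_comp, Category.assoc, ht, Category.id_comp, sub_self])
  exact (fromSgl_eq_zero_iff _ hφ i hij).1
    (sgl_hom_eq_zero_of_regular (h j (by lia)) (hK.1 j) _)

/-- Acyclicity in positive degrees splits the differentials by descending induction from the upper
bound of the complex. -/
lemma NoPos.exists_split (hK : bddProjComplex R K) (h : NoPos (toK K)) (i : ℤ) (hi : 0 ≤ i)
    {j : ℤ} (hij : i + 1 = j) :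
    ∃ s : K.X j ⟶ K.X i, K.d i j ≫ s ≫ K.d i j = K.d i j := by
  have hK' := hK
  obtain ⟨hK₁, c, d, hK₂⟩ := hK'
  obtain ⟨n, hn⟩ : ∃ n : ℕ, d - n < i := ⟨(d - i + 1).toNat, by lia⟩
  induction n generalizing i j with
  | zero => exact ⟨0, (hK₂ i (Or.inr (by simpa using hn))).eq_of_src _ _⟩
  | succ n ih =>
    obtain ⟨t, ht⟩ := ih j (by lia) rfl (by push_cast at hn; lia)
    obtain ⟨s, hs⟩ := h.exists_step hK i hi hij rfl t ht
    exact ⟨s, by rw [hs, Preadditive.comp_sub]; simp⟩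

/-- The complex is split exact in positive degrees: `𝟙 - d ≫ t` factors through the incoming
differential, which the cocycle `φ` kills, so `φ = d ≫ t ≫ φ` is a coboundary. -/
lemma NoPos.hom_sgl_eq_zero (hK : bddProjComplex R K) (h : NoPos (toK K)) {p : ℤ} (hp : 0 < p)
    {N : ModuleCat.{u} R} (f : toK K ⟶ (sgl R p).obj N) : f = 0 := by
  obtain ⟨φ, hφ, rfl⟩ := toSgl_surjective f
  obtain ⟨t, ht⟩ := h.exists_split hK p hp.le rfl
  obtain ⟨s, hs⟩ := h.exists_step hK (p - 1) (by lia) (show p - 1 + 1 = p by lia) rfl t ht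
  rw [toSgl_eq_zero_iff φ hφ (p + 1) rfl]
  refine ⟨t ≫ φ, ?_⟩
  have h1 : (s ≫ K.d (p - 1) p) ≫ φ = 0 := by rw [Category.assoc, hφ, comp_zero]
  rw [hs, Preadditive.sub_comp, Category.id_comp, sub_eq_zero, Category.assoc] at h1
  exact h1.symm

/-- The projection of the degree zero term onto the cocycles. -/
lemma NoPos.exists_proj (hK : bddProjComplex R K) (h : NoPos (toK K)) :
    ∃ e : K.X 0 ⟶ K.X 0, (∀ i, e ≫ K.d 0 i = 0) ∧ ∃ s, e = 𝟙 _ - K.d 0 1 ≫ s := by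
  obtain ⟨s, hs⟩ := h.exists_split hK 0 le_rfl (show (0 : ℤ) + 1 = 1 by simp)
  refine ⟨𝟙 _ - K.d 0 1 ≫ s, comp_d_eq_zero_of_succ (show (0 : ℤ) + 1 = 1 by simp) ?_, s, rfl⟩
  rw [Preadditive.sub_comp, Category.assoc, hs, Category.id_comp, sub_self]

/-- The cocycles split off `K.X 0`, and a class that vanishes on them is null-homotopic. So a
nonzero class is nonzero on cocycles, hence onto the simple `S`, and `π` lifts by projectivity. -/
lemma NoPos.exists_lift_of_ne_zero (hK : bddProjComplex R K) (h : NoPos (toK K))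
    {P S : ModuleCat.{u} R} [Projective P] [Simple S] (π : P ⟶ S)
    (a : toK K ⟶ (sgl R 0).obj S) (ha : a ≠ 0) :
    ∃ q : (sgl R 0).obj P ⟶ toK K, q ≫ a = (sgl R 0).map π := by
  obtain ⟨α, hα, rfl⟩ := toSgl_surjective a
  obtain ⟨e, he, s, hs⟩ := h.exists_proj hK
  have hne : e ≫ α ≠ 0 := by
    intro h0
    apply ha
    rw [toSgl_eq_zero_iff α hα 1 (by simp)]
    refine ⟨s ≫ α, ?_⟩
    rw [hs, Preadditive.sub_comp, Category.id_comp, sub_eq_zero, Category.assoc] at h0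
    exact h0.symm
  have : Epi (e ≫ α) := epi_of_nonzero_to_simple hne
  let l : P ⟶ K.X 0 := Projective.factorThru π (e ≫ α)
  have hl : l ≫ e ≫ α = π := Projective.factorThru_comp _ _
  refine ⟨fromSgl (l ≫ e) (fun i => by rw [Category.assoc, he, comp_zero]), ?_⟩
  rw [fromSgl_comp_toSgl]
  simp [hl]

end HomotopyLemmas

/-! ### Factoring maps through a projective that sees the relevant simples -/

section Traces

variable {R : Type u} [Ring R]

lemma mem_thru_of_src {C : Type*} [Category* C] [Preadditive C] {M N X Y : C}
    (hX : 𝟙 X ∈ thru M X X) (h : ∀ f : M ⟶ Y, f ∈ thru N M Y) (f : X ⟶ Y) : f ∈ thru N X Y := by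
  obtain ⟨n, a, b, hab⟩ := exists_sum_of_mem_thru hX
  rw [← Category.id_comp f, ← hab, Preadditive.sum_comp]
  exact sum_mem fun k _ => by
    rw [Category.assoc]; exact thru_precomp _ (h _)

lemma simple_quotient {N : Type u} [AddCommGroup N] [Module R N] {L : Submodule R N}
    (hL : IsCoatom L) : Simple (ModuleCat.of R (N ⧸ L)) := by
  have : IsSimpleModule R (N ⧸ L) := isSimpleModule_iff_isCoatom.2 hL
  exact simple_of_isSimpleModule

lemma hom_quotient_eq_zero {M₀ : ModuleCat.{u} R} [Module.Projective R M₀] {N : Type u}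
    [AddCommGroup N] [Module R N] {L : Submodule R N}
    (hL : ∀ g : M₀ →ₗ[R] N, LinearMap.range g ≤ L) (g : M₀ ⟶ ModuleCat.of R (N ⧸ L)) : g = 0 := by
  obtain ⟨g', hg'⟩ := Module.projective_lifting_property L.mkQ g.hom L.mkQ_surjective
  ext x
  rw [← hg']
  exact (Submodule.Quotient.mk_eq_zero L).2 (hL g' ⟨x, rfl⟩)

variable {K : CochainComplex (ModuleCat.{u} R) ℤ}

/-- The morphism from `R` given by a cocycle `x`. -/
noncomputable def elemHom {N : ModuleCat.{u} R} (x : N) : ModuleCat.of R R ⟶ N :=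
  ModuleCat.ofHom (LinearMap.toSpanSingleton R N x)

lemma elemHom_comp {N N' : ModuleCat.{u} R} (x : N) (f : N ⟶ N') :
    elemHom x ≫ f = elemHom (f x) := by
  ext
  simp [elemHom]

lemma eq_elemHom {N : ModuleCat.{u} R} (f : ModuleCat.of R R ⟶ N) :
    f = elemHom (f.hom (1 : R)) := by
  ext
  simp [elemHom]

lemma elemHom_comp_d {p : ℤ} {x : K.X p} (hx : ∀ i, K.d p i x = 0) (i : ℤ) :
    elemHom x ≫ K.d p i = 0 := by
  rw [elemHom_comp, hx]; ext; simp [elemHom]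

/-- Maps `R ⟶ K` up to homotopy are cocycles modulo coboundaries; the submodule in `hx` is the
preimage of the trace of `M₀` in the zeroth cohomology. -/
lemma fromSgl_elemHom_mem_thru {M₀ : ModuleCat.{u} R}
    (x : K.X 0) (hx : x ∈ LinearMap.range (K.d (-1) 0).hom ⊔
      ⨆ g : {g : M₀ ⟶ K.X 0 // ∀ i, g ≫ K.d 0 i = 0}, LinearMap.range g.1.hom) :
    ∃ h : ∀ i, K.d 0 i x = 0, fromSgl (elemHom x) (elemHom_comp_d h) ∈
      thru ((sgl R 0).obj M₀) ((sgl R 0).obj (ModuleCat.of R R)) (toK K) := by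
  have hadd : ∀ x y : K.X 0, (∃ h : ∀ i, K.d 0 i x = 0, fromSgl (elemHom x) (elemHom_comp_d h) ∈
      thru ((sgl R 0).obj M₀) ((sgl R 0).obj (ModuleCat.of R R)) (toK K)) →
      (∃ h : ∀ i, K.d 0 i y = 0, fromSgl (elemHom y) (elemHom_comp_d h) ∈
      thru ((sgl R 0).obj M₀) ((sgl R 0).obj (ModuleCat.of R R)) (toK K)) →
      (∃ h : ∀ i, K.d 0 i (x + y) = 0, fromSgl (elemHom (x + y)) (elemHom_comp_d h) ∈
      thru ((sgl R 0).obj M₀) ((sgl R 0).obj (ModuleCat.of R R)) (toK K)) := by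
    rintro x y ⟨hx, hx'⟩ ⟨hy, hy'⟩
    have hxy : ∀ i, K.d 0 i (x + y) = 0 := fun i => by rw [map_add, hx, hy, add_zero]
    refine ⟨hxy, ?_⟩
    have : fromSgl (elemHom (x + y)) (elemHom_comp_d hxy) =
        fromSgl (elemHom x) (elemHom_comp_d hx) + fromSgl (elemHom y) (elemHom_comp_d hy) := by
      rw [← fromSgl_add]
      congr 1
      ext
      simp [elemHom]
    rw [this]
    exact add_mem hx' hy'
  rw [Submodule.mem_sup] at hx
  obtain ⟨y, ⟨y, rfl⟩, z, hz, rfl⟩ := hx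
  refine hadd _ _ ?_ ?_
  · have h : ∀ i, K.d 0 i (K.d (-1) 0 y) = 0 := fun i => by
      rw [← ConcreteCategory.comp_apply, K.d_comp_d]; rfl
    refine ⟨h, ?_⟩
    have : fromSgl (elemHom (K.d (-1) 0 y)) (elemHom_comp_d h) = 0 :=
      (fromSgl_eq_zero_iff _ _ (-1) (by simp)).2 ⟨elemHom y, elemHom_comp _ _⟩
    exact this ▸ zero_mem _
  · induction hz using Submodule.iSup_induction' with
    | mem g x hx =>
      obtain ⟨g, hg⟩ := g
      obtain ⟨m, rfl⟩ := hx
      have h : ∀ i, K.d 0 i (g m) = 0 := fun i => by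
        rw [← ConcreteCategory.comp_apply, hg]; rfl
      refine ⟨h, ?_⟩
      have : fromSgl (elemHom (g m)) (elemHom_comp_d h) =
          (sgl R 0).map (elemHom m) ≫ fromSgl g hg := by
        rw [comp_fromSgl]
        congr 1
        exact (elemHom_comp _ _).symm
      exact this ▸ comp_mem_thru _ _
    | zero =>
      have h : ∀ i, K.d 0 i (0 : K.X 0) = 0 := fun i => map_zero _
      refine ⟨h, ?_⟩
      have : fromSgl (elemHom 0) (elemHom_comp_d h) = 0 :=
        (fromSgl_eq_zero_iff _ _ (-1) (by simp)).2 ⟨0, by ext; simp [elemHom]⟩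
      exact this ▸ zero_mem _
    | add x y _ _ hx hy => exact hadd _ _ hx hy

/-- The trace of `M₀` must exhaust the cocycles `Z`. Otherwise it lies in a maximal submodule `L`,
and the simple `Z ⧸ L` would receive no map from `M₀`, since such a map lifts into `Z` and then
lands in the trace. But it does receive a nonzero map from `K`, because `Z` splits off `K.X 0`. -/
lemma NoPos.mem_thru [IsNoetherianRing R] (hK : bddProjComplex R K) (h : NoPos (toK K))
    {M₀ : ModuleCat.{u} R} (hM₀ : fgProj R M₀)
    (H : ∀ V : ModuleCat.{u} R, Simple V →
      (∀ f : toK K ⟶ (sgl R 0).obj V, f = 0) ∨ ∃ g : M₀ ⟶ V, g ≠ 0)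
    {P : ModuleCat.{u} R} (hP : fgProj R P) (f : (sgl R 0).obj P ⟶ toK K) :
    f ∈ thru ((sgl R 0).obj M₀) _ _ := by
  refine mem_thru_of_src (M := (sgl R 0).obj (ModuleCat.of R R))
    (by simpa using map_mem_thru (sgl R 0) (id_mem_thru_of_fgProj hP)) (fun f => ?_) f
  obtain ⟨φ, hφ, rfl⟩ := fromSgl_surjective f
  obtain ⟨x, rfl⟩ : ∃ x, φ = elemHom x := ⟨_, eq_elemHom φ⟩
  refine (fromSgl_elemHom_mem_thru x ?_).2
  have hx : x ∈ LinearMap.ker (K.d 0 1).hom := by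
    have := ConcreteCategory.congr_hom (hφ 1) (1 : R)
    rw [elemHom_comp] at this
    simpa [elemHom] using this
  refine (?_ : LinearMap.ker (K.d 0 1).hom ≤ _) hx
  set Tr := LinearMap.range (K.d (-1) 0).hom ⊔
      ⨆ g : {g : M₀ ⟶ K.X 0 // ∀ i, g ≫ K.d 0 i = 0}, LinearMap.range g.1.hom with hTr
  set Z := LinearMap.ker (K.d 0 1).hom with hZ
  by_contra hle
  have := (hK.1 0).1
  have : Module.Finite R Z := inferInstance
  obtain ⟨L, hL, hL'⟩ := (eq_top_or_exists_le_coatom (Tr.comap Z.subtype)).resolve_left (by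
    rwa [Submodule.comap_subtype_eq_top])
  obtain ⟨e, he, s, hs⟩ := h.exists_proj hK
  have heZ : ∀ z, e.hom z ∈ Z := fun z => by
    have := ConcreteCategory.congr_hom (he 1) z
    exact this
  have hez : ∀ z ∈ Z, e.hom z = z := fun z hz => by
    have hz' : K.d 0 1 z = 0 := hz
    rw [hs]
    simp [hz']
  -- The projection `e` onto cocycles extends `Z ⟶ Z ⧸ L` to all of `K.X 0`; it is a cocycle because
  -- `L` contains the coboundaries.
  let α : K.X 0 ⟶ ModuleCat.of R (Z ⧸ L) :=
    ModuleCat.ofHom (L.mkQ ∘ₗ e.hom.codRestrict Z heZ)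
  have hα : ∀ i, K.d i 0 ≫ α = 0 := d_comp_eq_zero_of_pred (show (-1 : ℤ) + 1 = 0 by simp) (by
    ext y
    refine (Submodule.Quotient.mk_eq_zero L).2 (hL' ?_)
    have hy : K.d (-1) 0 y ∈ Z := by
      exact ConcreteCategory.congr_hom (K.d_comp_d (-1) 0 1) y
    change e.hom (K.d (-1) 0 y) ∈ Tr
    rw [hez _ hy]
    exact Submodule.mem_sup_left ⟨y, rfl⟩)
  rcases H _ (simple_quotient hL) with H | ⟨g, hg⟩
  · obtain ⟨β, hβ⟩ := (toSgl_eq_zero_iff α hα 1 (by simp)).1 (H _)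
    refine hL.1 (eq_top_iff.2 fun z _ => ?_)
    have h1 : α z.1 = 0 := by
      rw [← hβ]
      have hz : K.d 0 1 z.1 = 0 := z.2
      simp [hz]
    have h2 : α z.1 = L.mkQ z := by
      change L.mkQ (e.hom.codRestrict Z heZ z.1) = L.mkQ z
      congr 1
      exact Subtype.ext (hez _ z.2)
    exact (Submodule.Quotient.mk_eq_zero L).1 (h2.symm.trans h1)
  · have := hM₀.2
    refine hg (hom_quotient_eq_zero (fun g => ?_) g)
    rintro _ ⟨m, rfl⟩
    refine hL' (Submodule.mem_sup_right ?_)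
    refine Submodule.mem_iSup_of_mem ⟨ModuleCat.ofHom (Z.subtype ∘ₗ g),
      comp_d_eq_zero_of_succ (show (0 : ℤ) + 1 = 1 by simp) ?_⟩ ⟨m, rfl⟩
    ext m
    exact (g m).2

lemma exists_cover_of_iSup_range_eq_top {M₀ N : ModuleCat.{u} R} (hM₀ : fgProj R M₀)
    [Module.Finite R N] (h : ⨆ g : M₀ →ₗ[R] N, LinearMap.range g = ⊤) :
    ∃ (F : ModuleCat.{u} R) (f : F →ₗ[R] N), fgProj R F ∧ 𝟙 F ∈ thru M₀ F F ∧
      Function.Surjective f := by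
  classical
  have h₁ := hM₀.1
  have h₂ := hM₀.2
  obtain ⟨s, hs⟩ := CompleteLattice.IsCompactElement.exists_finset_of_le_iSup _
    ((Submodule.fg_iff_compact (⊤ : Submodule R N)).1 Module.Finite.fg_top) _ h.ge
  refine ⟨ModuleCat.of R (s → M₀), ∑ g : s, g.1 ∘ₗ LinearMap.proj g,
    ⟨inferInstanceAs (Module.Finite R (s → M₀)),
      Module.Projective.of_equiv (DFinsupp.linearEquivFunOnFintype (R := R) (M := fun _ : s => M₀))⟩,
    ?_, ?_⟩
  · have : 𝟙 (ModuleCat.of R (s → M₀)) = ∑ g : s, ModuleCat.ofHom (LinearMap.proj g) ≫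
        ModuleCat.ofHom (LinearMap.single R (fun _ : s => M₀) g) := by
      ext x
      simp [ModuleCat.hom_sum]
    rw [this]
    exact sum_mem fun k _ => comp_mem_thru _ _
  · rw [← LinearMap.range_eq_top, eq_top_iff]
    refine hs.trans (iSup₂_le fun g hg => ?_)
    rintro _ ⟨x, rfl⟩
    refine ⟨Pi.single ⟨g, hg⟩ x, ?_⟩
    rw [LinearMap.sum_apply, Finset.sum_eq_single ⟨g, hg⟩]
    · simp
    · intro b _ hb
      simp [Pi.single_eq_of_ne hb]
    · simp

/-- Induction on the length of `N`. If images of `M₀` generate `N`, there is a cover of `N` in `add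
M₀` and `f` lifts to it, the obstruction vanishing by `h0`. If not, `N` has a simple quotient `N ⧸
L` with no map from `M₀`, hence by `H` none from `K`, so `f` factors through the shorter module `L`.
-/
lemma hom_sgl_mem_thru [IsArtinianRing R] (hK : bddProjComplex R K) {p q : ℤ} (hpq : q + 1 = p)
    (h0 : ∀ (N : ModuleCat.{u} R), Module.Finite R N → ∀ f : toK K ⟶ (sgl R q).obj N, f = 0)
    {M₀ : ModuleCat.{u} R} (hM₀ : fgProj R M₀)
    (H : ∀ V : ModuleCat.{u} R, Simple V →
      (∀ f : toK K ⟶ (sgl R p).obj V, f = 0) ∨ ∃ g : M₀ ⟶ V, g ≠ 0)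
    {N : ModuleCat.{u} R} (hN : Module.Finite R N) (f : toK K ⟶ (sgl R p).obj N) :
    f ∈ thru ((sgl R p).obj M₀) _ _ := by
  have hN' : IsFiniteLength R N := isFiniteLength_iff_isNoetherian_isArtinian.2
    ⟨inferInstance, inferInstance⟩
  have hproj : ∀ i, Projective (K.X i) := fun i => projective_of_fgProj (hK.1 i)
  induction hl : Module.length R N using WellFoundedLT.induction generalizing N with
  | ind l ih =>
    subst hl
    by_cases htop : ⨆ g : M₀ →ₗ[R] N, LinearMap.range g = ⊤
    · obtain ⟨F, g, hF, hF', hg⟩ := exists_cover_of_iSup_range_eq_top hM₀ htop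
      have := hF.1
      obtain ⟨f, rfl⟩ := exists_lift_sgl hproj (shortExact_of_ker_eq _ g hg rfl) hpq
        (h0 _ (inferInstanceAs (Module.Finite R (LinearMap.ker g)))) f
      exact thru_postcomp (thru_of_tgt (by simpa using map_mem_thru (sgl R p) hF') f) _
    · obtain ⟨L, hL, hL'⟩ := (eq_top_or_exists_le_coatom _).resolve_left htop
      have := hM₀.2
      have h1 := (H _ (simple_quotient hL)).resolve_right (by
        rintro ⟨g, hg⟩
        exact hg (hom_quotient_eq_zero (fun g => (le_iSup _ g).trans hL') g))
      obtain ⟨f, rfl⟩ := exists_lift_sgl_of_comp_eq_zero hproj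
        (shortExact_of_ker_eq (N := ModuleCat.of R (N ⧸ L)) L L.mkQ L.mkQ_surjective L.ker_mkQ) f (h1 _)
      have : Module.Finite R L := inferInstance
      have hlt : Module.length R L < Module.length R N := by
        have : IsNoetherian R N := inferInstance
        have : IsArtinian R N := inferInstance
        exact Submodule.length_lt hL.1
      exact thru_postcomp (ih _ hlt (N := ModuleCat.of R L) this f
        (isFiniteLength_iff_isNoetherian_isArtinian.2
          ⟨inferInstanceAs (IsNoetherian R L), inferInstanceAs (IsArtinian R L)⟩) rfl) _

end Traces

/-! ### Two-term silting objects and a simple in degrees 0 and -1 -/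

section TwoTerm

variable {R : Type u} [Ring R]

lemma KbProj.bddProjComplex_as (T : KbProj R) : bddProjComplex R T.obj.as :=
  (bddProj_quotient_obj_iff T.obj.as).1 T.property

lemma siltGE_shift_one_iff {𝒯 : Type*} [Category* 𝒯] [HasZeroObject 𝒯] [HasShift 𝒯 ℤ]
    [Preadditive 𝒯] [∀ n : ℤ, (shiftFunctor 𝒯 n).Additive] [Pretriangulated 𝒯] {T U : 𝒯} :
    SiltGE T (U⟦(1 : ℤ)⟧) ↔ ∀ i : ℤ, 1 < i → ∀ f : T ⟶ U⟦i⟧, f = 0 := by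
  constructor
  · intro h i hi f
    have := h (i - 1) (by lia) (f ≫ (shiftFunctorAdd' 𝒯 1 (i - 1) i (by lia)).hom.app U)
    simpa using this
  · intro h i hi f
    have := h (1 + i) (by lia) (f ≫ (shiftFunctorAdd' 𝒯 1 i (1 + i) rfl).inv.app U)
    simpa using this

/-- The shifted stalk complex, seen in the homotopy category. -/
noncomputable def stalkShiftIso (Q : ModuleCat.{u} R) [Module.Finite R Q] [Module.Projective R Q]
    (i : ℤ) : ((stalk Q)⟦i⟧ : KbProj R).obj ≅ (sgl R (-i)).obj Q :=
  (((bddProj R).ι.commShiftIso i).app (stalk Q)) ≪≫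
    (((HomotopyCategory.singleFunctors (ModuleCat.{u} R)).shiftIso i (-i) 0 (by lia)).app Q)

lemma noPos_of_siltGE {T : KbProj R} (h : SiltGE (regularStalk R) T) : NoPos T.obj := by
  intro p hp f
  let e : ((sgl R p).obj (ModuleCat.of R R))⟦p⟧ ≅ (sgl R 0).obj (ModuleCat.of R R) :=
    ((HomotopyCategory.singleFunctors (ModuleCat.{u} R)).shiftIso p 0 p (by lia)).app _
  let g : (regularStalk R).obj ⟶ (T⟦p⟧).obj :=
    e.inv ≫ f⟦p⟧' ≫ (((bddProj R).ι.commShiftIso p).app T).inv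
  have hg : g = 0 := congrArg InducedCategory.Hom.hom (h p hp (ObjectProperty.homMk g))
  have hf : f⟦p⟧' = 0 := by
    rw [← cancel_epi e.inv, ← cancel_mono (((bddProj R).ι.commShiftIso p).app T).inv]
    rw [Category.assoc, comp_zero, zero_comp]
    exact hg
  exact (shiftFunctor _ p).map_injective (by rw [hf, Functor.map_zero])

lemma hom_sgl_regular_eq_zero {T : KbProj R} (h : SiltGE T ((regularStalk R)⟦(1 : ℤ)⟧))
    (p : ℤ) (hp : p ≤ -2) (f : T.obj ⟶ (sgl R p).obj (ModuleCat.of R R)) : f = 0 := by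
  obtain ⟨i, rfl⟩ : ∃ i, p = -i := ⟨-p, by simp⟩
  have := congrArg InducedCategory.Hom.hom (siltGE_shift_one_iff.1 h i (by lia)
    (ObjectProperty.homMk (f ≫ (stalkShiftIso (ModuleCat.of R R) i).inv)))
  have h0 : f ≫ (stalkShiftIso (ModuleCat.of R R) i).inv = 0 := this
  rw [← cancel_mono (stalkShiftIso (ModuleCat.of R R) i).inv, h0, zero_comp]

lemma hom_sgl_eq_zero_of_siltGE [IsNoetherianRing R] {T : KbProj R}
    (h : SiltGE T ((regularStalk R)⟦(1 : ℤ)⟧)) (p : ℤ) (hp : p ≤ -2) (N : ModuleCat.{u} R)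
    (hN : Module.Finite R N) (f : T.obj ⟶ (sgl R p).obj N) : f = 0 :=
  hom_sgl_eq_zero_of_le (K := T.obj.as) T.bddProjComplex_as (hom_sgl_regular_eq_zero h) p hp N f

/-- No nonzero maps to the stalk complex of `S` in degree `p`. -/
def HomZero (p : ℤ) (S : ModuleCat.{u} R) (T : KbProj R) : Prop :=
  ∀ f : T.obj ⟶ (sgl R p).obj S, f = 0


lemma epi_simple_ker_finite [IsNoetherianRing R] {P S : ModuleCat.{u} R} (hP : fgProj R P)
    [Simple S] {π : P ⟶ S} (hπ : π ≠ 0) :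
    ∃ L : Submodule R P, L = LinearMap.ker π.hom ∧ Module.Finite R L ∧
      Function.Surjective π.hom := by
  have := hP.1
  have := epi_of_nonzero_to_simple hπ
  exact ⟨_, rfl, inferInstance, (ModuleCat.epi_iff_surjective π).1 this⟩

lemma exists_lift_to_cover [IsNoetherianRing R] {T : KbProj R}
    (h : SiltGE T ((regularStalk R)⟦(1 : ℤ)⟧)) {P S : ModuleCat.{u} R} (hP : fgProj R P)
    [Simple S] {π : P ⟶ S} (hπ : π ≠ 0) (b : T.obj ⟶ (sgl R (-1)).obj S) :
    ∃ c : T.obj ⟶ (sgl R (-1)).obj P, c ≫ (sgl R (-1)).map π = b := by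
  obtain ⟨L, hL, hL', hs⟩ := epi_simple_ker_finite hP hπ
  exact exists_lift_sgl (K := T.obj.as) (fun i => projective_of_fgProj (T.bddProjComplex_as.1 i))
    (shortExact_of_ker_eq L π.hom hs hL.symm) (q := -2) (by simp)
    (hom_sgl_eq_zero_of_siltGE h (-2) le_rfl (ModuleCat.of R L) hL') b

/-- A simple module detects the presence of a projective: `S` is not in the top of `M₀`,
and every other simple module is. -/
structure IsComplement (S M₀ : ModuleCat.{u} R) : Prop where
  fgProj : fgProj R M₀
  hom_eq_zero : ∀ g : M₀ ⟶ S, g = 0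
  exists_hom : ∀ V : ModuleCat.{u} R, Simple V → (∃ g : M₀ ⟶ V, g ≠ 0) ∨ Nonempty (S ≅ V)

variable {P S M₀ : ModuleCat.{u} R} [Module.Finite R P] [Module.Projective R P]

lemma HomZero.of_iso {p : ℤ} {S' : ModuleCat.{u} R} {T : KbProj R} (h : HomZero p S T)
    (e : S ≅ S') : HomZero p S' T := fun f => by
  rw [← cancel_mono ((sgl R p).mapIso e).inv, h (f ≫ _), zero_comp]

lemma HomZero.mem_thru_stalk [IsNoetherianRing R] {T : KbProj R}
    (h₁ : SiltGE (regularStalk R) T) (hT : HomZero 0 S T) (hM : IsComplement S M₀)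
    [Module.Finite R M₀] [Module.Projective R M₀] (f : stalk P ⟶ T) :
    f ∈ thru (stalk M₀) (stalk P) T := by
  refine mem_thru_of_map (bddProj R).ι ?_
  refine NoPos.mem_thru (K := T.obj.as) T.bddProjComplex_as (noPos_of_siltGE h₁) hM.fgProj
    (fun V hV => ?_) ⟨inferInstance, inferInstance⟩ f.hom
  rcases hM.exists_hom V hV with h | ⟨⟨e⟩⟩
  · exact Or.inr h
  · exact Or.inl (hT.of_iso e)

lemma HomZero.mem_thru_stalk_shift [IsArtinianRing R] {T : KbProj R}
    (h₂ : SiltGE T ((regularStalk R)⟦(1 : ℤ)⟧)) (hT : HomZero (-1) S T) (hM : IsComplement S M₀)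
    [Module.Finite R M₀] [Module.Projective R M₀] (f : T ⟶ (stalk P)⟦(1 : ℤ)⟧) :
    f ∈ thru ((stalk M₀)⟦(1 : ℤ)⟧) T ((stalk P)⟦(1 : ℤ)⟧) := by
  refine mem_thru_of_map (bddProj R).ι ?_
  have h : f.hom ≫ (stalkShiftIso P 1).hom ∈ thru ((sgl R (-1)).obj M₀) T.obj
      ((sgl R (-1)).obj P) :=
    hom_sgl_mem_thru (K := T.obj.as) T.bddProjComplex_as (show (-2 : ℤ) + 1 = -1 by simp)
      (hom_sgl_eq_zero_of_siltGE h₂ (-2) le_rfl) hM.fgProj (fun V hV => ?_) (N := P) inferInstance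
      (f.hom ≫ (stalkShiftIso P 1).hom)
  · have h' := thru_iso (stalkShiftIso M₀ 1).symm (thru_postcomp h (stalkShiftIso P 1).inv)
    rw [Category.assoc, Iso.hom_inv_id, Category.comp_id] at h'
    exact h'
  · rcases hM.exists_hom V hV with h | ⟨⟨e⟩⟩
    · exact Or.inr h
    · exact Or.inl (hT.of_iso e)

lemma thru_comp_eq_zero {C : Type*} [Category* C] [Preadditive C] {M X Y Z : C} {f : X ⟶ Y}
    (hf : f ∈ thru M X Y) {g : Y ⟶ Z} (hg : ∀ b : M ⟶ Y, b ≫ g = 0) : f ≫ g = 0 := by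
  induction hf using thru_induction with
  | hz => exact zero_comp
  | hc a b => rw [Category.assoc, hg, comp_zero]
  | ha f g _ _ h₁ h₂ => rw [Preadditive.add_comp, h₁, h₂, add_zero]

omit [Module.Finite R P] [Module.Projective R P] in
lemma sgl_map_ne_zero {π : P ⟶ S} (hπ : π ≠ 0) (p : ℤ) : (sgl R p).map π ≠ 0 := by
  intro h
  exact hπ ((sgl R p).map_injective (by rw [h, Functor.map_zero]))

omit [Module.Finite R P] in
lemma exists_lift_of_siltGE {T : KbProj R} (h₁ : SiltGE (regularStalk R) T) [Simple S] (π : P ⟶ S)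
    {a : T.obj ⟶ (sgl R 0).obj S} (ha : a ≠ 0) :
    ∃ q : (sgl R 0).obj P ⟶ T.obj, q ≫ a = (sgl R 0).map π :=
  have : Projective P := (IsProjective.iff_projective P).1 inferInstance
  (noPos_of_siltGE h₁).exists_lift_of_ne_zero (K := T.obj.as) T.bddProjComplex_as π a ha

/-- A nonzero `a : T ⟶ S` is reached from `P` by some `q` with `q ≫ a = π`; if `q` passes through
`N`, which has no map to `S`, then `π = 0`. With `HomZero.mem_thru_stalk` this gives the equivalence
used to recognise mutations. -/
lemma homZero_of_mem_thru {T N : KbProj R} (h₁ : SiltGE (regularStalk R) T)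
    [Simple S] {π : P ⟶ S} (hπ : π ≠ 0) (hN : HomZero 0 S N)
    (h : ∀ f : stalk P ⟶ T, f ∈ thru N (stalk P) T) : HomZero 0 S T := by
  intro a
  by_contra ha
  obtain ⟨q, hq⟩ := exists_lift_of_siltGE h₁ π ha
  have h1 := map_mem_thru (bddProj R).ι (h (ObjectProperty.homMk q))
  exact sgl_map_ne_zero hπ 0 (hq.symm.trans (thru_comp_eq_zero h1 (fun b => hN _)))

/-- Because `T ≥ R[1]`, every map to `S` in degree `-1` lifts to `P[1]`, where the factorisation
through `N` applies. -/
lemma homZero_of_mem_thru_shift [IsNoetherianRing R] {T N : KbProj R}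
    (h₂ : SiltGE T ((regularStalk R)⟦(1 : ℤ)⟧)) [Simple S] {π : P ⟶ S} (hπ : π ≠ 0)
    (hN : HomZero (-1) S N)
    (h : ∀ f : T ⟶ (stalk P)⟦(1 : ℤ)⟧, f ∈ thru N T ((stalk P)⟦(1 : ℤ)⟧)) :
    HomZero (-1) S T := by
  intro b
  obtain ⟨c, rfl⟩ := exists_lift_to_cover h₂ ⟨inferInstance, inferInstance⟩ hπ b
  have h1 := map_mem_thru (bddProj R).ι (h (ObjectProperty.homMk (c ≫ (stalkShiftIso P 1).inv)))
  have h2 := thru_comp_eq_zero h1 (g := (stalkShiftIso P 1).hom ≫ (sgl R (-1)).map π)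
    (fun b => by rw [← Category.assoc]; exact hN _)
  have h3 : (c ≫ (stalkShiftIso P 1).inv) ≫ (stalkShiftIso P 1).hom ≫ (sgl R (-1)).map π = 0 := h2
  simpa using h3

/-- Sign coherence: `S` cannot occur both in degree `0` and in degree `-1` of a presilting
two-term object. -/
lemma homZero_or_homZero [IsNoetherianRing R] {T : KbProj R}
    (h₁ : SiltGE (regularStalk R) T) (h₂ : SiltGE T ((regularStalk R)⟦(1 : ℤ)⟧))
    (h₃ : SiltGE T T) [Simple S] {π : P ⟶ S} (hπ : π ≠ 0) :
    HomZero 0 S T ∨ HomZero (-1) S T := by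
  by_contra! hcon
  obtain ⟨ha, hb⟩ := hcon
  unfold HomZero at ha hb
  push Not at ha hb
  obtain ⟨a, ha⟩ := ha
  obtain ⟨b, hb⟩ := hb
  obtain ⟨q, hq⟩ := exists_lift_of_siltGE h₁ π ha
  obtain ⟨c, hc⟩ := exists_lift_to_cover h₂ ⟨inferInstance, inferInstance⟩ hπ b
  let e := (HomotopyCategory.singleFunctors (ModuleCat.{u} R)).shiftIso 1 (-1) 0 (by lia)
  -- The composite `T ⟶ P[1] ⟶ T[1]` is zero since `T` is presilting, while composing it further
  -- with `a[1]` recovers `b`.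
  let g : T.obj ⟶ (T⟦(1 : ℤ)⟧).obj :=
    c ≫ e.inv.app P ≫ q⟦(1 : ℤ)⟧' ≫ (((bddProj R).ι.commShiftIso (1 : ℤ)).app T).inv
  have hg : g = 0 := congrArg InducedCategory.Hom.hom
    (h₃ 1 one_pos (ObjectProperty.homMk g))
  have hg' : c ≫ e.inv.app P ≫ q⟦(1 : ℤ)⟧' = 0 := by
    rw [← cancel_mono (((bddProj R).ι.commShiftIso (1 : ℤ)).app T).inv, zero_comp]
    simpa only [Category.assoc] using hg
  apply hb
  have h4 : c ≫ e.inv.app P ≫ (q ≫ a)⟦(1 : ℤ)⟧' ≫ e.hom.app S = b := by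
    rw [hq, ← hc]
    have := e.hom.naturality π
    dsimp only [Functor.comp_map] at this
    rw [this, Iso.inv_hom_id_app_assoc]
  rw [← h4, Functor.map_comp]
  simp only [Category.assoc]
  have := congrArg (fun t => t ≫ a⟦(1 : ℤ)⟧' ≫ e.hom.app S) hg'
  simpa only [Category.assoc, zero_comp] using this

/-- The objects with no nonzero map to any shift of `S` form a thick subcategory, which does not
contain `P`; so it cannot contain a generator. -/
lemma exists_ne_zero_of_thick_eq_top {T : KbProj R} (hT : thick T = ⊤) [Simple S] {π : P ⟶ S}
    (hπ : π ≠ 0) : ∃ (p : ℤ) (f : T.obj ⟶ (sgl R p).obj S), f ≠ 0 := by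
  by_contra! hcon
  let Q : ObjectProperty (KbProj R) := fun X => ∀ (p : ℤ) (f : X.obj ⟶ (sgl R p).obj S), f = 0
  have hQz : Q.ContainsZero := ⟨0, isZero_zero _, fun p f =>
    ((bddProj R).ι.map_isZero (isZero_zero _)).eq_of_src _ _⟩
  have hQs : Q.IsStableUnderShift ℤ :=
    ⟨fun n =>
      { le_shift := fun X hX => by
          change Q (X⟦n⟧)
          intro p f
          let e := ((HomotopyCategory.singleFunctors (ModuleCat.{u} R)).shiftIso n p (n + p) rfl).app S
          obtain ⟨g, hg⟩ := (shiftFunctor _ n).map_surjective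
            ((((bddProj R).ι.commShiftIso n).app X).inv ≫ f ≫ e.inv)
          have hg0 : g = 0 := hX _ g
          rw [hg0, Functor.map_zero] at hg
          rw [← cancel_mono e.inv, ← cancel_epi (((bddProj R).ι.commShiftIso n).app X).inv, ← hg,
            zero_comp, comp_zero] }⟩
  have hQr : Q.IsStableUnderRetracts := ⟨fun {X Y} r hY p f => by
    have := hY p (r.r.hom ≫ f)
    have h2 : r.i.hom ≫ r.r.hom = 𝟙 _ := congrArg InducedCategory.Hom.hom r.retract
    rw [← Category.id_comp f, ← h2, Category.assoc, this, comp_zero]⟩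
  have hQi : Q.IsClosedUnderIsomorphisms := inferInstance
  have hQ2 : Q.IsTriangulatedClosed₂ := .mk' fun D hD h₁ h₃ p f => by
    obtain ⟨g, hg⟩ := Triangle.yoneda_exact₂ _ ((bddProj R).ι.map_distinguished D hD) f (h₁ p _)
    rw [hg, show g = 0 from h₃ p g]
    exact comp_zero
  have hQ : Q.IsTriangulated := { }
  have h := (hT.symm ▸ trivial : thick T (stalk P)) Q hQ hQr hcon
  exact sgl_map_ne_zero hπ 0 (h 0 _)

lemma not_homZero_and_homZero [IsNoetherianRing R] {T : KbProj R}
    (h₁ : SiltGE (regularStalk R) T) (h₂ : SiltGE T ((regularStalk R)⟦(1 : ℤ)⟧))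
    (hT : thick T = ⊤) [Simple S] {π : P ⟶ S} (hπ : π ≠ 0) :
    ¬ (HomZero 0 S T ∧ HomZero (-1) S T) := by
  rintro ⟨h₀, hn⟩
  obtain ⟨p, f, hf⟩ := exists_ne_zero_of_thick_eq_top hT hπ
  apply hf
  rcases lt_trichotomy p 0 with hp | rfl | hp
  · rcases (show p ≤ -2 ∨ p = -1 by lia) with hp | rfl
    · obtain ⟨L, -, -, hs⟩ := epi_simple_ker_finite (R := R) (P := P)
        ⟨inferInstance, inferInstance⟩ hπ
      exact hom_sgl_eq_zero_of_siltGE h₂ p hp S (Module.Finite.of_surjective _ hs) f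
    · exact hn f
  · exact h₀ f
  · exact (noPos_of_siltGE h₁).hom_sgl_eq_zero (K := T.obj.as) T.bddProjComplex_as hp f

end TwoTerm

/-! ### Krull-Schmidt decompositions and local projectives -/

section KrullSchmidt

lemma nonempty_iso_biproduct {C : Type*} [Category* C] [Preadditive C] [HasFiniteBiproducts C]
    {J : Type} [Finite J] {F : J → C} {X : C} [Fintype J] (ι : ∀ j, F j ⟶ X) (π : ∀ j, X ⟶ F j)
    (h₁ : ∀ j, ι j ≫ π j = 𝟙 _) (h₂ : ∀ j k, j ≠ k → ι j ≫ π k = 0)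
    (h₃ : ∑ j, π j ≫ ι j = 𝟙 X) : Nonempty (X ≅ ⨁ F) := by
  classical
  exact ⟨biproduct.uniqueUpToIso F (isBilimitOfTotal
    { pt := X
      π := π
      ι := ι
      ι_π := fun j k => by
        split_ifs with h
        · subst h; simpa using h₁ j
        · exact h₂ j k h } h₃)⟩

lemma isLocalRing_end_obj_iff {C D : Type*} [Category* C] [Preadditive C] [Category* D]
    [Preadditive D] (F : C ⥤ D) [F.Additive] [F.Full] [F.Faithful] (X : C) :
    IsLocalRing (End (F.obj X)) ↔ IsLocalRing (End X) := by
  let φ : End X ≃+* End (F.obj X) :=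
    { (Functor.FullyFaithful.ofFullyFaithful F).homEquiv (X := X) (Y := X) with
      map_mul' := fun a b => F.map_comp _ _
      map_add' := fun a b => F.map_add }
  exact ⟨fun _ => IsLocalRing.of_equiv φ.symm, fun _ => IsLocalRing.of_equiv φ⟩

variable {R : Type u} [Ring R]

/-- Fitting's lemma: `M` is the direct sum of kernel and range of a high power of `a`. Either the
kernel is zero and `a` is bijective, or the range is zero, `a` is nilpotent and `1 - a` is a unit.
-/
lemma isLocalRing_end_of_isCompl {M : ModuleCat.{u} R} [Nontrivial M] (hM : IsFiniteLength R M)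
    (h : ∀ A B : Submodule R M, IsCompl A B → A = ⊥ ∨ B = ⊥) : IsLocalRing (End M) := by
  obtain ⟨_, _⟩ := isFiniteLength_iff_isNoetherian_isArtinian.1 hM
  suffices IsLocalRing (Module.End R M) from
    IsLocalRing.of_equiv (A := Module.End R M) (ModuleCat.endRingEquiv M).symm
  refine { isUnit_or_isUnit_of_add_one := fun {a b} hab => ?_ }
  obtain ⟨n, hn⟩ := a.eventually_isCompl_ker_pow_range_pow.exists_forall_of_atTop
  have hn := hn (n + 1) (by simp)
  rcases h _ _ hn with h | h
  · left
    have : Function.Injective a := by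
      rw [← LinearMap.ker_eq_bot, eq_bot_iff, ← h, pow_succ]
      intro x hx
      have hx : a x = 0 := hx
      simp [hx]
    exact (Module.End.isUnit_iff a).2 (IsArtinian.bijective_of_injective_endomorphism a this)
  · right
    obtain rfl : b = 1 - a := eq_sub_of_add_eq' hab
    exact IsNilpotent.isUnit_one_sub ⟨n + 1, LinearMap.range_eq_bot.1 h⟩

lemma isLocalRing_end_of_indecomposable {M : ModuleCat.{u} R} (hM : IsFiniteLength R M)
    (h : Indecomposable M) : IsLocalRing (End M) := by
  have : Nontrivial M := by
    by_contra hn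
    rw [not_nontrivial_iff_subsingleton] at hn
    exact h.1 (ModuleCat.isZero_of_subsingleton M)
  refine isLocalRing_end_of_isCompl hM fun A B hAB => ?_
  refine (h.2 (ModuleCat.of R A) (ModuleCat.of R B)
    ((Submodule.prodEquivOfIsCompl A B hAB).symm.toModuleIso ≪≫
      (ModuleCat.biprodIsoProd (ModuleCat.of R A) (ModuleCat.of R B)).symm)).imp ?_ ?_
  · exact fun h => Submodule.subsingleton_iff_eq_bot.1 (ModuleCat.subsingleton_of_isZero h)
  · exact fun h => Submodule.subsingleton_iff_eq_bot.1 (ModuleCat.subsingleton_of_isZero h)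

/-- Every module of finite length is a finite direct sum of modules with local endomorphism
rings. -/
lemma exists_decomposition {M : ModuleCat.{u} R} (hM : IsFiniteLength R M) :
    ∃ (ι : Type) (_ : Fintype ι) (X : ι → ModuleCat.{u} R) (a : ∀ k, M ⟶ X k) (b : ∀ k, X k ⟶ M),
      (∀ k, IsLocalRing (End (X k))) ∧ (∀ k, b k ≫ a k = 𝟙 _) ∧ ∑ k, a k ≫ b k = 𝟙 M := by
  induction hl : Module.length R M using WellFoundedLT.induction generalizing M with
  | ind l ih =>
    subst hl
    rcases subsingleton_or_nontrivial M with hs | hn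
    · exact ⟨Empty, inferInstance, Empty.elim, fun k => k.elim, fun k => k.elim, fun k => k.elim,
        fun k => k.elim, (ModuleCat.isZero_of_subsingleton M).eq_of_src _ _⟩
    by_cases h : ∀ A B : Submodule R M, IsCompl A B → A = ⊥ ∨ B = ⊥
    · exact ⟨Unit, inferInstance, fun _ => M, fun _ => 𝟙 M, fun _ => 𝟙 M,
        fun _ => isLocalRing_end_of_isCompl hM h, fun _ => by simp, by simp⟩
    · push Not at h
      obtain ⟨A, B, hAB, hA, hB⟩ := h
      obtain ⟨_, _⟩ := isFiniteLength_iff_isNoetherian_isArtinian.1 hM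
      have key : ∀ A B : Submodule R M, IsCompl A B → B ≠ ⊥ →
          Module.length R A < Module.length R M := fun A B hAB hB =>
        Submodule.length_lt (fun h => hB (by simpa [h] using hAB.inf_eq_bot))
      obtain ⟨ι, _, X, a, b, hX, hba, hab⟩ := ih _ (key A B hAB hB) (M := ModuleCat.of R A)
        (isFiniteLength_iff_isNoetherian_isArtinian.2
          ⟨inferInstanceAs (IsNoetherian R A), inferInstanceAs (IsArtinian R A)⟩) rfl
      obtain ⟨κ, _, Y, c, d, hY, hdc, hcd⟩ := ih _ (key B A hAB.symm hA) (M := ModuleCat.of R B)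
        (isFiniteLength_iff_isNoetherian_isArtinian.2
          ⟨inferInstanceAs (IsNoetherian R B), inferInstanceAs (IsArtinian R B)⟩) rfl
      let pA : M ⟶ ModuleCat.of R A := ModuleCat.ofHom (Submodule.projectionOnto A B hAB)
      let pB : M ⟶ ModuleCat.of R B := ModuleCat.ofHom (Submodule.projectionOnto B A hAB.symm)
      let iA : ModuleCat.of R A ⟶ M := ModuleCat.ofHom A.subtype
      let iB : ModuleCat.of R B ⟶ M := ModuleCat.ofHom B.subtype
      have hA1 : iA ≫ pA = 𝟙 _ := by
        ext x; simp [iA, pA]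
      have hB1 : iB ≫ pB = 𝟙 _ := by
        ext x; simp [iB, pB]
      have hAB1 : pA ≫ iA + pB ≫ iB = 𝟙 M := by
        ext x
        exact Submodule.projection_add_projection_eq_self hAB x
      refine ⟨ι ⊕ κ, inferInstance, Sum.elim X Y,
        Sum.rec (fun k => pA ≫ a k) (fun k => pB ≫ c k),
        Sum.rec (fun k => b k ≫ iA) (fun k => d k ≫ iB), ?_, ?_, ?_⟩
      · rintro (k | k)
        · exact hX k
        · exact hY k
      · rintro (k | k)
        · simp [reassoc_of% hA1, hba]
        · simp [reassoc_of% hB1, hdc]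
      · have h₁ : ∑ k, (pA ≫ a k) ≫ (b k ≫ iA) = pA ≫ iA := by
          simp only [Category.assoc]
          rw [← Preadditive.comp_sum]
          simp only [← Category.assoc (a _)]
          rw [← Preadditive.sum_comp, hab, Category.id_comp]
        have h₂ : ∑ k, (pB ≫ c k) ≫ (d k ≫ iB) = pB ≫ iB := by
          simp only [Category.assoc]
          rw [← Preadditive.comp_sum]
          simp only [← Category.assoc (c _)]
          rw [← Preadditive.sum_comp, hcd, Category.id_comp]
        rw [Fintype.sum_sum_type, ← hAB1]
        exact congrArg₂ _ h₁ h₂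

lemma fgProj_of_retract {M N : ModuleCat.{u} R} (r : Retract M N) (hN : fgProj R N) :
    fgProj R M := by
  obtain ⟨_, _⟩ := hN
  have h : ∀ x, r.r.hom (r.i.hom x) = x := fun x => by
    exact ConcreteCategory.congr_hom r.retract x
  exact ⟨Module.Finite.of_surjective r.r.hom (fun x => ⟨_, h x⟩),
    Module.Projective.of_split r.i.hom r.r.hom (LinearMap.ext h)⟩

/-- The stalk complex of a morphism. -/
noncomputable def stalkMap {P Q : ModuleCat.{u} R} [Module.Finite R P] [Module.Projective R P]
    [Module.Finite R Q] [Module.Projective R Q] (f : P ⟶ Q) : stalk P ⟶ stalk Q :=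
  ObjectProperty.homMk ((sgl R 0).map f)

section StalkMap

variable {P Q Q' : ModuleCat.{u} R} [Module.Finite R P] [Module.Projective R P]
  [Module.Finite R Q] [Module.Projective R Q] [Module.Finite R Q'] [Module.Projective R Q']

variable (P) in
lemma stalkMap_id : stalkMap (𝟙 P) = 𝟙 (stalk P) :=
  (bddProj R).ι.map_injective ((sgl R 0).map_id P)

lemma stalkMap_comp (f : P ⟶ Q) (g : Q ⟶ Q') : stalkMap (f ≫ g) = stalkMap f ≫ stalkMap g :=
  (bddProj R).ι.map_injective ((sgl R 0).map_comp f g)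

lemma stalkMap_add (f g : P ⟶ Q) : stalkMap (f + g) = stalkMap f + stalkMap g :=
  (bddProj R).ι.map_injective ((sgl R 0).map_add)

variable (P Q) in
lemma stalkMap_zero : stalkMap (0 : P ⟶ Q) = 0 :=
  (bddProj R).ι.map_injective ((sgl R 0).map_zero P Q)

lemma stalkMap_sum {ι : Type*} (s : Finset ι) (f : ι → (P ⟶ Q)) :
    stalkMap (∑ k ∈ s, f k) = ∑ k ∈ s, stalkMap (f k) :=
  map_sum (⟨⟨stalkMap, stalkMap_zero P Q⟩, stalkMap_add⟩ : (P ⟶ Q) →+ (stalk P ⟶ stalk Q)) _ _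

lemma stalkMap_surjective (f : stalk P ⟶ stalk Q) : ∃ g : P ⟶ Q, f = stalkMap g := by
  obtain ⟨g, hg⟩ := (sgl R 0).map_surjective f.hom
  exact ⟨g, (bddProj R).ι.map_injective hg.symm⟩

lemma stalkMap_injective {f g : P ⟶ Q} (h : stalkMap f = stalkMap g) : f = g :=
  (sgl R 0).map_injective (congrArg (fun t => t.hom) h)

lemma nonempty_iso_of_stalk_iso (e : stalk P ≅ stalk Q) : Nonempty (P ≅ Q) :=
  ⟨(sgl R 0).preimageIso ((bddProj R).ι.mapIso e)⟩

/-- Isomorphic modules have isomorphic stalk complexes. -/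
noncomputable def stalkIso (e : P ≅ Q) : stalk P ≅ stalk Q :=
  (bddProj R).ι.preimageIso ((sgl R 0).mapIso e)

variable (P) in
lemma isLocalRing_end_stalk_iff : IsLocalRing (End (stalk P)) ↔ IsLocalRing (End P) :=
  (isLocalRing_end_obj_iff (bddProj R).ι (stalk P)).symm.trans (isLocalRing_end_obj_iff (sgl R 0) P)

lemma stalkMap_mem_thru {f : P ⟶ Q'} (hf : f ∈ thru Q P Q') :
    stalkMap f ∈ thru (stalk Q) (stalk P) (stalk Q') := by
  induction hf using thru_induction with
  | hz => rw [stalkMap_zero]; exact zero_mem _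
  | hc a b => rw [stalkMap_comp]; exact comp_mem_thru _ _
  | ha f g _ _ h₁ h₂ => rw [stalkMap_add]; exact add_mem h₁ h₂

variable (P) in
lemma id_stalk_mem_thru_regular : 𝟙 (stalk P) ∈ thru (regularStalk R) (stalk P) (stalk P) := by
  rw [← stalkMap_id]
  exact stalkMap_mem_thru (id_mem_thru_of_fgProj ⟨inferInstance, inferInstance⟩)

end StalkMap

/-- One of `u` and `𝟙 - u` is invertible, and `𝟙 - u` cannot be, since it is killed by `π ≠ 0`. This
makes `P` behave as the projective cover of `S`. -/
lemma isIso_of_comp_eq {P S : ModuleCat.{u} R} [IsLocalRing (End P)] {π : P ⟶ S} (hπ : π ≠ 0)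
    {u : P ⟶ P} (hu : u ≫ π = π) : IsIso u := by
  rcases IsLocalRing.isUnit_or_isUnit_of_add_one (show (show End P from u) + (1 - (show End P from u)) = 1 by simp)
    with h | h
  · exact (isUnit_iff_isIso _).1 h
  · exfalso
    have h := (isUnit_iff_isIso _).1 h
    have h0 : (𝟙 P - u) ≫ π = 0 := by rw [Preadditive.sub_comp, hu, Category.id_comp, sub_self]
    change IsIso (𝟙 P - u) at h
    apply hπ
    rw [← cancel_epi (𝟙 P - u), h0, comp_zero]

lemma retract_of_hom_ne_zero {P M₀ S : ModuleCat.{u} R} [IsLocalRing (End P)] [Projective P]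
    [Projective M₀] [Simple S] {π : P ⟶ S} (hπ : π ≠ 0) {g : M₀ ⟶ S} (hg : g ≠ 0) :
    Nonempty (Retract P M₀) := by
  have := epi_of_nonzero_to_simple hg
  have := epi_of_nonzero_to_simple hπ
  have h : (Projective.factorThru π g ≫ Projective.factorThru g π) ≫ π = π := by simp
  have := isIso_of_comp_eq hπ h
  exact exists_retract_of_isIso (Projective.factorThru π g) (Projective.factorThru g π)

/-- If `ρ` does not vanish on the kernel of `π`, it maps that kernel onto `V`, and lifting `ρ` gives
an endomorphism `w` through the kernel with `w ≫ ρ = ρ`. Then `w` is invertible although `w ≫ π =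
0`. So `ρ` descends to a nonzero map between simples. -/
lemma nonempty_iso_of_local_projective {P S V : ModuleCat.{u} R} [IsLocalRing (End P)]
    [Projective P] [Simple S] [Simple V] {π : P ⟶ S} (hπ : π ≠ 0) {ρ : P ⟶ V} (hρ : ρ ≠ 0) :
    Nonempty (S ≅ V) := by
  have := epi_of_nonzero_to_simple hπ
  have := epi_of_nonzero_to_simple hρ
  by_cases h : kernel.ι π ≫ ρ = 0
  · let q : S ⟶ V := (Abelian.epiIsCokernelOfKernel _ (kernelIsKernel π)).desc
      (CokernelCofork.ofπ ρ h)
    have hq : π ≫ q = ρ := (Abelian.epiIsCokernelOfKernel _ (kernelIsKernel π)).fac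
      (CokernelCofork.ofπ ρ h) WalkingParallelPair.one
    have : q ≠ 0 := fun h0 => hρ (by rw [← hq, h0, comp_zero])
    have := isIso_of_hom_simple this
    exact ⟨asIso q⟩
  · have := epi_of_nonzero_to_simple h
    let w : P ⟶ P := Projective.factorThru ρ (kernel.ι π ≫ ρ) ≫ kernel.ι π
    have h₁ : w ≫ ρ = ρ := by simp [w]
    have h₂ : w ≫ π = 0 := by simp [w]
    have := isIso_of_comp_eq hρ h₁
    exact absurd (by rw [← cancel_epi w, h₂, comp_zero]) hπ

end KrullSchmidt

/-! ### The basic version of the regular module -/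

section BasicVersion

/-- A finite direct sum of pairwise non-isomorphic objects with local endomorphism rings. -/
def IsLocalBasic {C : Type*} [Category* C] [Preadditive C] [HasFiniteBiproducts C] (T : C) : Prop :=
  ∃ (n : ℕ) (X : Fin n → C), (∀ k, IsLocalRing (End (X k))) ∧
    (∀ k l, Nonempty (X k ≅ X l) → k = l) ∧ Nonempty (T ≅ ⨁ X)

lemma IsLocalBasic.map {C D : Type*} [Category* C] [Preadditive C] [HasFiniteBiproducts C]
    [Category* D] [Preadditive D] [HasFiniteBiproducts D] (F : C ⥤ D) [F.Additive] [F.Full]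
    [F.Faithful] {T : C} (h : IsLocalBasic T) : IsLocalBasic (F.obj T) := by
  obtain ⟨n, X, h₁, h₂, ⟨e⟩⟩ := h
  exact ⟨n, fun k => F.obj (X k), fun k => (isLocalRing_end_obj_iff F (X k)).2 (h₁ k),
    fun k l ⟨e'⟩ => h₂ k l ⟨F.preimageIso e'⟩, ⟨F.mapIso e ≪≫ F.mapBiproduct X⟩⟩

lemma IsLocalBasic.isBasic {𝒯 : Type*} [Category* 𝒯] [HasZeroObject 𝒯] [HasShift 𝒯 ℤ]
    [Preadditive 𝒯] [∀ n : ℤ, (shiftFunctor 𝒯 n).Additive] [Pretriangulated 𝒯] {T : 𝒯}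
    (h : IsLocalBasic T) : IsBasic T := by
  obtain ⟨n, X, h₁, h₂, h₃⟩ := h
  exact ⟨n, X, fun k => have := h₁ k; indecomposable_of_isLocalRing_end, h₂, h₃⟩

lemma addClosure_eq {𝒯 : Type*} [Category* 𝒯] [HasZeroObject 𝒯] [HasShift 𝒯 ℤ]
    [Preadditive 𝒯] [∀ n : ℤ, (shiftFunctor 𝒯 n).Additive] [Pretriangulated 𝒯] {B T : 𝒯}
    (h₁ : 𝟙 B ∈ thru T B B) (h₂ : 𝟙 T ∈ thru B T T) : addClosure B = addClosure T := by
  ext X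
  rw [addClosure_iff, addClosure_iff]
  exact ⟨fun h => thru_trans h₁ h, fun h => thru_trans h₂ h⟩

variable {R : Type u} [Ring R]

lemma id_biprod_mem_thru {C : Type*} [Category* C] [Preadditive C] [HasBinaryBiproducts C]
    {X Y T : C} (hX : 𝟙 X ∈ thru T X X) (hY : 𝟙 Y ∈ thru T Y Y) :
    𝟙 (X ⊞ Y) ∈ thru T (X ⊞ Y) (X ⊞ Y) := by
  rw [← biprod.total]
  exact add_mem (thru_precomp _ (thru_of_src hX _)) (thru_precomp _ (thru_of_src hY _))

/-- `M₀` is the sum of one representative of each isomorphism class of indecomposable summands of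
`R` other than that of `P`. A nonzero map from such a representative to `S` would make `P` a retract
of it; conversely each simple is hit by some summand of `R`, and it is `S` if that summand is `P`.
-/
lemma exists_complement [IsArtinianRing R] (P : ModuleCat.{u} R) [Module.Finite R P]
    [Module.Projective R P] [IsLocalRing (End P)] {S : ModuleCat.{u} R} [Simple S] {π : P ⟶ S}
    (hπ : π ≠ 0) :
    ∃ (M₀ : ModuleCat.{u} R) (_ : Module.Finite R M₀) (_ : Module.Projective R M₀),
      IsComplement S M₀ ∧ IsLocalBasic (stalk P ⊞ stalk M₀) ∧
        𝟙 (regularStalk R) ∈ thru (stalk P ⊞ stalk M₀) (regularStalk R) (regularStalk R) := by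
  classical
  obtain ⟨ι, _, X, a, b, hX, hba, hab⟩ := exists_decomposition (M := ModuleCat.of R R)
    (isFiniteLength_iff_isNoetherian_isArtinian.2
      ⟨inferInstanceAs (IsNoetherian R R), inferInstanceAs (IsArtinian R R)⟩)
  have hXp : ∀ k, fgProj R (X k) := fun k => fgProj_of_retract ⟨b k, a k, hba k⟩ fgProj_self
  let st : Setoid {k // ¬ Nonempty (X k ≅ P)} :=
    { r := fun k l => Nonempty (X k ≅ X l)
      iseqv := ⟨fun k => ⟨Iso.refl _⟩, fun ⟨e⟩ => ⟨e.symm⟩, fun ⟨e⟩ ⟨e'⟩ => ⟨e ≪≫ e'⟩⟩ }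
  let m := Fintype.card (Quotient st)
  let e : Fin m ≃ Quotient st := (Fintype.equivFin _).symm
  let Y : Fin m → ModuleCat.{u} R := fun j => X (e j).out
  have hY : ∀ j, IsLocalRing (End (Y j)) := fun j => hX _
  have hY₁ : ∀ j, Module.Finite R (Y j) := fun j => (hXp _).1
  have hY₂ : ∀ j, Module.Projective R (Y j) := fun j => (hXp _).2
  have hYP : ∀ j, ¬ Nonempty (Y j ≅ P) := fun j => (e j).out.2
  have hYY : ∀ j k, Nonempty (Y j ≅ Y k) → j = k := fun j k h => by
    apply e.injective
    rw [← Quotient.out_eq (e j), ← Quotient.out_eq (e k)]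
    exact Quotient.sound h
  have hXY : ∀ k, Nonempty (X k ≅ P) ∨ ∃ j, Nonempty (X k ≅ Y j) := fun k => by
    by_cases h : Nonempty (X k ≅ P)
    · exact Or.inl h
    · refine Or.inr ⟨e.symm (Quotient.mk st ⟨k, h⟩), ?_⟩
      have : st (e (e.symm (Quotient.mk st ⟨k, h⟩))).out ⟨k, h⟩ := by
        apply Quotient.exact
        rw [Quotient.out_eq, Equiv.apply_symm_apply]
      exact st.symm this
  let M₀ := ModuleCat.of R (∀ j, Y j)
  have hM₁ : Module.Finite R M₀ := inferInstanceAs (Module.Finite R (∀ j, Y j))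
  have hM₂ : Module.Projective R M₀ :=
    Module.Projective.of_equiv (DFinsupp.linearEquivFunOnFintype (R := R) (M := fun j => Y j))
  let p : ∀ j, M₀ ⟶ Y j := fun j => ModuleCat.ofHom (LinearMap.proj j)
  let i : ∀ j, Y j ⟶ M₀ := fun j => ModuleCat.ofHom (LinearMap.single R (fun j => Y j) j)
  have hip : ∀ j, i j ≫ p j = 𝟙 _ := fun j => by
    ext x
    exact Pi.single_eq_same (M := fun j => Y j) j x
  have hip' : ∀ j k, j ≠ k → i j ≫ p k = 0 := fun j k h => by
    ext x
    exact Pi.single_eq_of_ne (M := fun j => Y j) h.symm x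
  have hpi : ∑ j, p j ≫ i j = 𝟙 M₀ := by ext x; simp [i, p, ModuleCat.hom_sum, M₀]
  have hPp : Projective P := (IsProjective.iff_projective P).1 inferInstance
  have hM₀p : Projective M₀ := (IsProjective.iff_projective M₀).1 hM₂
  have hPl : IsLocalRing (End (stalk P)) := (isLocalRing_end_stalk_iff P).2 inferInstance
  have hYl : ∀ j, IsLocalRing (End (stalk (Y j))) := fun j =>
    (isLocalRing_end_stalk_iff (Y j)).2 (hY j)
  refine ⟨M₀, hM₁, hM₂, ⟨⟨hM₁, hM₂⟩, ?_, ?_⟩, ?_, ?_⟩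
  · intro g
    by_contra hg
    obtain ⟨j, hj⟩ : ∃ j, i j ≫ g ≠ 0 := by
      by_contra! h
      apply hg
      rw [← Category.id_comp g, ← hpi, Preadditive.sum_comp]
      exact Finset.sum_eq_zero fun j _ => by rw [Category.assoc, h, comp_zero]
    have : Projective (Y j) := (IsProjective.iff_projective (Y j)).1 (hY₂ j)
    obtain ⟨r⟩ := retract_of_hom_ne_zero hπ hj
    have h := isIso_of_retract_indecomposable (X := stalk P) (Y := stalk (Y j))
      not_isZero_of_isLocalRing_end indecomposable_of_isLocalRing_end
      ⟨stalkMap r.i, stalkMap r.r, by rw [← stalkMap_comp, r.retract, stalkMap_id]⟩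
    exact hYP j (nonempty_iso_of_stalk_iso (asIso (stalkMap r.i)).symm)
  · intro V hV
    obtain ⟨k, hk⟩ : ∃ k, ∃ g : X k ⟶ V, g ≠ 0 := by
      by_contra! h
      have hz : ∀ g : ModuleCat.of R R ⟶ V, g = 0 := fun g => by
        rw [← Category.id_comp g, ← hab, Preadditive.sum_comp]
        exact Finset.sum_eq_zero fun j _ => by rw [Category.assoc, h j (b j ≫ g), comp_zero]
      apply Simple.not_isZero V
      rw [IsZero.iff_id_eq_zero]
      ext x
      have := ConcreteCategory.congr_hom (hz (elemHom x)) (1 : R)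
      simpa [elemHom] using this
    obtain ⟨g, hg⟩ := hk
    rcases hXY k with ⟨⟨f⟩⟩ | ⟨j, ⟨f⟩⟩
    · right
      exact nonempty_iso_of_local_projective hπ (ρ := f.inv ≫ g) (fun h => hg (by
        rw [← cancel_epi f.inv, h, comp_zero]))
    · left
      refine ⟨p j ≫ f.inv ≫ g, fun h => hg ?_⟩
      have h1 := congrArg (fun t => i j ≫ t) h
      simp only [comp_zero] at h1
      rw [← Category.assoc, hip, Category.id_comp] at h1
      rw [← cancel_epi f.inv, h1, comp_zero]
  · let Z : Fin (m + 1) → KbProj R := Fin.cons (stalk P) (fun j => stalk (Y j))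
    let I : ∀ k, Z k ⟶ stalk P ⊞ stalk M₀ :=
      Fin.cases biprod.inl (fun j => stalkMap (i j) ≫ biprod.inr)
    let Q : ∀ k, stalk P ⊞ stalk M₀ ⟶ Z k :=
      Fin.cases biprod.fst (fun j => biprod.snd ≫ stalkMap (p j))
    refine ⟨m + 1, Z, ?_, ?_, nonempty_iso_biproduct I Q ?_ ?_ ?_⟩
    · exact Fin.cases hPl hYl
    · refine Fin.cases (Fin.cases (fun _ => rfl) (fun k ⟨f⟩ => ?_))
        (fun j => Fin.cases (fun ⟨f⟩ => ?_) (fun k ⟨f⟩ => ?_))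
      · exact absurd (nonempty_iso_of_stalk_iso (P := Y k) (Q := P) (Iso.symm f)) (hYP k)
      · exact absurd (nonempty_iso_of_stalk_iso (P := Y j) (Q := P) f) (hYP j)
      · rw [hYY j k (nonempty_iso_of_stalk_iso (P := Y j) (Q := Y k) f)]
    · refine Fin.cases biprod.inl_fst (fun j => ?_)
      change (stalkMap (i j) ≫ biprod.inr) ≫ (biprod.snd ≫ stalkMap (p j)) = 𝟙 (stalk (Y j))
      simp [← stalkMap_comp, hip, stalkMap_id]
    · refine Fin.cases (Fin.cases (fun h => absurd rfl h) (fun k _ => ?_))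
        (fun j => Fin.cases (fun _ => ?_) (fun k h => ?_))
      · change biprod.inl ≫ (biprod.snd ≫ stalkMap (p k)) = 0
        simp
      · change (stalkMap (i j) ≫ biprod.inr) ≫ biprod.fst = 0
        simp
      · change (stalkMap (i j) ≫ biprod.inr) ≫ (biprod.snd ≫ stalkMap (p k)) = 0
        simp [← stalkMap_comp, hip' j k (fun h' => h (by rw [h'])), stalkMap_zero]
    · rw [Fin.sum_univ_succ, ← biprod.total]
      congr 1
      change ∑ j, (biprod.snd ≫ stalkMap (p j)) ≫ (stalkMap (i j) ≫ biprod.inr) = _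
      have : ∀ j, (biprod.snd ≫ stalkMap (p j)) ≫ (stalkMap (i j) ≫ biprod.inr) =
          biprod.snd (X := stalk P) (Y := stalk M₀) ≫ stalkMap (p j ≫ i j) ≫
            biprod.inr (X := stalk P) (Y := stalk M₀) :=
        fun j => by simp [stalkMap_comp]
      simp_rw [this]
      rw [← Preadditive.comp_sum, ← Preadditive.sum_comp, ← stalkMap_sum, hpi, stalkMap_id,
        Category.id_comp]
  · have hP' : 𝟙 (stalk P) ∈ thru (stalk P ⊞ stalk M₀) (stalk P) (stalk P) :=
      id_mem_thru_of_retract ⟨biprod.inl, biprod.fst, biprod.inl_fst⟩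
    have hM' : 𝟙 (stalk M₀) ∈ thru (stalk P ⊞ stalk M₀) (stalk M₀) (stalk M₀) :=
      id_mem_thru_of_retract ⟨biprod.inr, biprod.snd, biprod.inr_snd⟩
    have : 𝟙 (regularStalk R) = ∑ k, stalkMap (Q := ModuleCat.of R R) (a k ≫ b k) := by
      rw [← stalkMap_sum, hab, stalkMap_id]; rfl
    rw [this]
    refine sum_mem fun k _ => ?_
    have := (hXp k).1
    have := (hXp k).2
    rw [stalkMap_comp]
    refine thru_precomp _ (thru_of_src ?_ _)
    rcases hXY k with ⟨⟨f⟩⟩ | ⟨j, ⟨f⟩⟩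
    · exact thru_trans hP' (id_mem_thru_of_retract
        ⟨stalkMap f.hom, stalkMap f.inv, by rw [← stalkMap_comp, f.hom_inv_id, stalkMap_id]⟩)
    · refine thru_trans hM' (id_mem_thru_of_retract
        ⟨stalkMap (f.hom ≫ i j), stalkMap (p j ≫ f.inv), ?_⟩)
      rw [← stalkMap_comp, Category.assoc, reassoc_of% (hip j), f.hom_inv_id, stalkMap_id]

end BasicVersion

/-! ### Minimal approximations by projectives -/

section Approximation

variable {R : Type u} [Ring R]

/-- A nonzero map from `N` to `S` would produce maps `P ⟶ N` and `N ⟶ P`, both compatible with `π`,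
since `N` is a summand of copies of `R` and can be treated as projective. Their composite fixes `π`,
hence is invertible, which puts `P` in `add N`. -/
lemma homZero_of_id_notMem {p : ℤ} {P S : ModuleCat.{u} R} [Projective P] [IsLocalRing (End P)]
    [Simple S] {π : P ⟶ S} (hπ : π ≠ 0) {N : KbProj R}
    (hN : 𝟙 N.obj ∈ thru ((sgl R p).obj (ModuleCat.of R R)) N.obj N.obj)
    (hP : 𝟙 ((sgl R p).obj P) ∉ thru N.obj ((sgl R p).obj P) ((sgl R p).obj P)) :
    HomZero p S N := by
  intro c
  by_contra hc
  have := epi_of_nonzero_to_simple hπ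
  have hR : Projective (ModuleCat.of R R) := projective_of_fgProj fgProj_self
  obtain ⟨n, a, b, hab⟩ := exists_sum_of_mem_thru hN
  choose g hg using fun k => (sgl R p).map_surjective (b k ≫ c)
  have hc' : c = ∑ k, a k ≫ (sgl R p).map (g k) := by
    simp_rw [hg, ← Category.assoc]
    rw [← Preadditive.sum_comp, hab, Category.id_comp]
  obtain ⟨k, hk⟩ : ∃ k, g k ≠ 0 := by
    by_contra! h
    apply hc
    rw [hc']
    exact Finset.sum_eq_zero fun k _ => by rw [h k, Functor.map_zero, comp_zero]
  have := epi_of_nonzero_to_simple hk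
  let q : (sgl R p).obj P ⟶ N.obj := (sgl R p).map (Projective.factorThru π (g k)) ≫ b k
  let c' : N.obj ⟶ (sgl R p).obj P := ∑ k, a k ≫ (sgl R p).map (Projective.factorThru (g k) π)
  have hq : q ≫ c = (sgl R p).map π := by
    simp only [q, Category.assoc]
    rw [← hg, ← Functor.map_comp, Projective.factorThru_comp]
  have hcc : c' ≫ (sgl R p).map π = c := by
    rw [hc', Preadditive.sum_comp]
    refine Finset.sum_congr rfl fun k _ => ?_
    rw [Category.assoc, ← Functor.map_comp, Projective.factorThru_comp]
  obtain ⟨w, hw⟩ := (sgl R p).map_surjective (q ≫ c')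
  have := isIso_of_comp_eq hπ (u := w) ((sgl R p).map_injective (by
    rw [Functor.map_comp, hw, Category.assoc, hcc, hq]))
  apply hP
  have h1 : (sgl R p).map w ∈ thru N.obj ((sgl R p).obj P) ((sgl R p).obj P) := by
    rw [hw]; exact comp_mem_thru _ _
  have h2 := thru_postcomp h1 (inv ((sgl R p).map w))
  rwa [IsIso.hom_inv_id] at h2

lemma exists_simple_quotient {P : ModuleCat.{u} R} [Module.Finite R P] [Nontrivial P] :
    ∃ (S : ModuleCat.{u} R) (_ : Simple S) (π : P ⟶ S), π ≠ 0 := by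
  obtain ⟨L, hL, -⟩ := (eq_top_or_exists_le_coatom (⊥ : Submodule R P)).resolve_left bot_ne_top
  refine ⟨_, simple_quotient hL, ModuleCat.ofHom L.mkQ, fun h => hL.1 ?_⟩
  rw [← L.ker_mkQ, LinearMap.ker_eq_top]
  exact congrArg ModuleCat.Hom.hom h

/-- `Hom(P, Q)` is finite-dimensional over `K`, and scalars act as endomorphisms of either module;
so a `K`-basis or spanning set gives approximations on both sides. -/
lemma exists_generators_hom (K : Type*) [Field K] [Algebra K R] [FiniteDimensional K R]
    (P Q : ModuleCat.{u} R) [Module.Finite R P] [Module.Finite R Q] :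
    ∃ (n : ℕ) (g : Fin n → (P ⟶ Q)), ∀ h : P ⟶ Q,
      (∃ c : Fin n → (Q ⟶ Q), ∑ k, g k ≫ c k = h) ∧
        ∃ c : Fin n → (P ⟶ P), ∑ k, c k ≫ g k = h := by
  let _ : Module K P := Module.compHom P (algebraMap K R)
  let _ : Module K Q := Module.compHom Q (algebraMap K R)
  have : IsScalarTower K R P := ⟨fun a b x => by
    rw [Algebra.smul_def, mul_smul]; rfl⟩
  have : IsScalarTower K R Q := ⟨fun a b x => by
    rw [Algebra.smul_def, mul_smul]; rfl⟩
  have : SMulCommClass R K P := ⟨fun a b x => by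
    change a • (algebraMap K R b • x) = algebraMap K R b • a • x
    rw [← mul_smul, ← mul_smul, Algebra.commutes]⟩
  have : SMulCommClass R K Q := ⟨fun a b x => by
    change a • (algebraMap K R b • x) = algebraMap K R b • a • x
    rw [← mul_smul, ← mul_smul, Algebra.commutes]⟩
  have : Module.Finite K P := Module.Finite.trans R P
  have : Module.Finite K Q := Module.Finite.trans R Q
  have hfin : Module.Finite K (P →ₗ[R] Q) :=
    Module.Finite.of_injective (LinearMap.restrictScalarsₗ K R P Q K)
      (LinearMap.restrictScalars_injective K)
  obtain ⟨n, s, hs⟩ := Module.Finite.exists_fin (R := K) (M := P →ₗ[R] Q)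
  refine ⟨n, fun k => ModuleCat.ofHom (s k), fun h => ?_⟩
  have : h.hom ∈ Submodule.span K (Set.range s) := hs ▸ Submodule.mem_top
  obtain ⟨c, hc⟩ := (Submodule.mem_span_range_iff_exists_fun K).1 this
  refine ⟨⟨fun k => ModuleCat.ofHom (c k • LinearMap.id), ?_⟩,
    ⟨fun k => ModuleCat.ofHom (c k • LinearMap.id), ?_⟩⟩
  · ext x
    rw [← hc]
    simp [ModuleCat.hom_sum]
  · ext x
    rw [← hc]
    simp [ModuleCat.hom_sum]

/-- `N'` is the range of a high power of `h`, a summand by Fitting. Any map fixed by `h` survives on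
`N'`, so a non-invertible `h` would shorten an approximation. -/
lemma exists_fitting_retract {N : ModuleCat.{u} R} (hN : IsFiniteLength R N) (h : N ⟶ N) :
    ∃ (N' : ModuleCat.{u} R) (r : Retract N' N) (w : N ⟶ N'),
      (∀ (P : ModuleCat.{u} R) (f : P ⟶ N), f ≫ h = f → f ≫ w ≫ r.i = f) ∧
      (∀ (P : ModuleCat.{u} R) (f : N ⟶ P), h ≫ f = f → w ≫ r.i ≫ f = f) ∧
      (Module.length R N ≤ Module.length R N' → IsIso h) := by
  obtain ⟨_, _⟩ := isFiniteLength_iff_isNoetherian_isArtinian.1 hN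
  obtain ⟨n, hn⟩ := h.hom.eventually_isCompl_ker_pow_range_pow.exists_forall_of_atTop
  have hn := hn (n + 1) (by simp)
  have hr : ∀ x : LinearMap.range (h.hom ^ (n + 1)),
      Submodule.projectionOnto _ _ hn.symm (x : N) = x := fun x => by simp
  refine ⟨ModuleCat.of R (LinearMap.range (h.hom ^ (n + 1))),
    ⟨ModuleCat.ofHom (Submodule.subtype _), ModuleCat.ofHom (Submodule.projectionOnto _ _ hn.symm),
      by ext x; exact congrArg Subtype.val (hr x)⟩,
    ModuleCat.ofHom (h.hom ^ (n + 1)).rangeRestrict, fun P f hf => ?_, fun P f hf => ?_,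
    fun hle => ?_⟩
  · ext x
    change (h.hom ^ (n + 1)) (f.hom x) = f.hom x
    generalize n + 1 = m
    induction m with
    | zero => rfl
    | succ m ih =>
      rw [pow_succ]
      change (h.hom ^ m) (h.hom (f.hom x)) = _
      rw [show h.hom (f.hom x) = f.hom x from ConcreteCategory.congr_hom hf x, ih]
  · ext x
    change f.hom ((h.hom ^ (n + 1)) x) = f.hom x
    generalize n + 1 = m
    induction m with
    | zero => rfl
    | succ m ih =>
      rw [pow_succ']
      change f.hom (h.hom ((h.hom ^ m) x)) = _
      rw [show f.hom (h.hom ((h.hom ^ m) x)) = f.hom ((h.hom ^ m) x) from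
        ConcreteCategory.congr_hom hf _, ih]
  · have htop : LinearMap.range (h.hom ^ (n + 1)) = ⊤ := by
      by_contra hne
      exact absurd hle (not_le.2 (Submodule.length_lt hne))
    have hs : Function.Surjective h.hom := by
      rw [pow_succ'] at htop
      intro x
      obtain ⟨y, hy⟩ := LinearMap.range_eq_top.1 htop x
      exact ⟨_, hy⟩
    have hb : Function.Bijective h.hom :=
      ⟨IsNoetherian.injective_of_surjective_endomorphism _ hs, hs⟩
    exact (ConcreteCategory.isIso_iff_bijective h).2 hb

variable (K : Type*) [Field K] [Algebra K R] [FiniteDimensional K R]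

include K in
lemma isFiniteLength_of_finite (M : ModuleCat.{u} R) [Module.Finite R M] : IsFiniteLength R M := by
  have : IsArtinianRing R := IsArtinianRing.of_finite K R
  exact isFiniteLength_iff_isNoetherian_isArtinian.2 ⟨inferInstance, inferInstance⟩

lemma id_pi_mem_thru (Q : ModuleCat.{u} R) (n : ℕ) :
    𝟙 (ModuleCat.of R (Fin n → Q)) ∈ thru Q (ModuleCat.of R (Fin n → Q))
      (ModuleCat.of R (Fin n → Q)) := by
  classical
  have : 𝟙 (ModuleCat.of R (Fin n → Q)) = ∑ k, (ModuleCat.ofHom (LinearMap.proj k) : _ ⟶ Q) ≫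
      ModuleCat.ofHom (LinearMap.single R (fun _ => (Q : Type u)) k) := by
    ext x
    simp [ModuleCat.hom_sum]
  rw [this]
  exact sum_mem fun k _ => comp_mem_thru _ _

include K in
-- Finitely many generators of `Hom(P, Q)` give some approximation. One of smallest length is
-- minimal: an endomorphism fixing it and not invertible would, by `exists_fitting_retract`, cut it
-- down to a shorter one.
lemma exists_left_approx (P Q : ModuleCat.{u} R) [Module.Finite R P] (hQ : fgProj R Q) :
    ∃ (N : ModuleCat.{u} R) (f : P ⟶ N), fgProj R N ∧ 𝟙 N ∈ thru Q N N ∧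
      (∀ h : P ⟶ Q, ∃ k, f ≫ k = h) ∧ ∀ h : N ⟶ N, f ≫ h = f → IsIso h := by
  let A : Set ℕ∞ := {l | ∃ (N : ModuleCat.{u} R) (f : P ⟶ N), fgProj R N ∧ 𝟙 N ∈ thru Q N N ∧
    (∀ h : P ⟶ Q, ∃ k, f ≫ k = h) ∧ l = Module.length R N}
  have hA : A.Nonempty := by
    have := hQ.1
    have := hQ.2
    obtain ⟨n, g, hg⟩ := exists_generators_hom K P Q
    refine ⟨_, ModuleCat.of R (Fin n → Q), ModuleCat.ofHom (LinearMap.pi fun k => (g k).hom),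
      ⟨inferInstanceAs (Module.Finite R (Fin n → Q)),
        Module.Projective.of_equiv (DFinsupp.linearEquivFunOnFintype (R := R)
          (M := fun _ : Fin n => Q))⟩, id_pi_mem_thru Q n, fun h => ?_, rfl⟩
    obtain ⟨⟨c, rfl⟩, -⟩ := hg h
    refine ⟨∑ k, ModuleCat.ofHom (LinearMap.proj k) ≫ c k, ?_⟩
    ext x
    simp [ModuleCat.hom_sum]
  obtain ⟨l, ⟨N, f, h₁, h₂, h₃, rfl⟩, hmin⟩ := WellFounded.has_min wellFounded_lt A hA
  refine ⟨N, f, h₁, h₂, h₃, fun h hf => ?_⟩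
  have := h₁.1
  obtain ⟨N', r, w, hw, -, hi⟩ := exists_fitting_retract (isFiniteLength_of_finite K N) h
  refine hi (not_lt.1 (hmin _ ⟨N', f ≫ w, fgProj_of_retract r h₁,
    thru_trans h₂ (id_mem_thru_of_retract r), fun k => ?_, rfl⟩))
  obtain ⟨k', rfl⟩ := h₃ k
  exact ⟨r.i ≫ k', by rw [← Category.assoc, Category.assoc f, hw _ f hf]⟩

include K in
lemma exists_right_approx (P Q : ModuleCat.{u} R) [Module.Finite R P] (hQ : fgProj R Q) :
    ∃ (N : ModuleCat.{u} R) (f : N ⟶ P), fgProj R N ∧ 𝟙 N ∈ thru Q N N ∧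
      (∀ h : Q ⟶ P, ∃ k, k ≫ f = h) ∧ ∀ h : N ⟶ N, h ≫ f = f → IsIso h := by
  classical
  let A : Set ℕ∞ := {l | ∃ (N : ModuleCat.{u} R) (f : N ⟶ P), fgProj R N ∧ 𝟙 N ∈ thru Q N N ∧
    (∀ h : Q ⟶ P, ∃ k, k ≫ f = h) ∧ l = Module.length R N}
  have hA : A.Nonempty := by
    have := hQ.1
    have := hQ.2
    obtain ⟨n, g, hg⟩ := exists_generators_hom K Q P
    refine ⟨_, ModuleCat.of R (Fin n → Q),
      ∑ k, ModuleCat.ofHom (LinearMap.proj k) ≫ g k,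
      ⟨inferInstanceAs (Module.Finite R (Fin n → Q)),
        Module.Projective.of_equiv (DFinsupp.linearEquivFunOnFintype (R := R)
          (M := fun _ : Fin n => Q))⟩, id_pi_mem_thru Q n, fun h => ?_, rfl⟩
    obtain ⟨-, ⟨c, rfl⟩⟩ := hg h
    refine ⟨ModuleCat.ofHom (LinearMap.pi fun k => (c k).hom), ?_⟩
    ext x
    simp [ModuleCat.hom_sum]
  obtain ⟨l, ⟨N, f, h₁, h₂, h₃, rfl⟩, hmin⟩ := WellFounded.has_min wellFounded_lt A hA
  refine ⟨N, f, h₁, h₂, h₃, fun h hf => ?_⟩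
  have := h₁.1
  obtain ⟨N', r, w, -, hw, hi⟩ := exists_fitting_retract (isFiniteLength_of_finite K N) h
  refine hi (not_lt.1 (hmin _ ⟨N', r.i ≫ f, fgProj_of_retract r h₁,
    thru_trans h₂ (id_mem_thru_of_retract r), fun k => ?_, rfl⟩))
  obtain ⟨k', rfl⟩ := h₃ k
  exact ⟨k' ≫ w, by rw [Category.assoc, hw _ f hf]⟩

lemma exists_factor_left_of_mem_thru {C : Type*} [Category* C] [Preadditive C] {M M' X Y : C}
    {f : X ⟶ M'} (h : ∀ a : X ⟶ M, ∃ k, f ≫ k = a) {g : X ⟶ Y} (hg : g ∈ thru M X Y) :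
    ∃ k, f ≫ k = g := by
  induction hg using thru_induction with
  | hz => exact ⟨0, comp_zero⟩
  | hc a b => obtain ⟨k, rfl⟩ := h a; exact ⟨k ≫ b, by simp⟩
  | ha f g _ _ h₁ h₂ =>
    obtain ⟨k, rfl⟩ := h₁
    obtain ⟨l, rfl⟩ := h₂
    exact ⟨k + l, by simp⟩

lemma exists_factor_right_of_mem_thru {C : Type*} [Category* C] [Preadditive C] {M M' X Y : C}
    {f : M' ⟶ X} (h : ∀ a : M ⟶ X, ∃ k, k ≫ f = a) {g : Y ⟶ X} (hg : g ∈ thru M Y X) :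
    ∃ k, k ≫ f = g := by
  induction hg using thru_induction with
  | hz => exact ⟨0, zero_comp⟩
  | hc a b => obtain ⟨k, rfl⟩ := h b; exact ⟨a ≫ k, by simp⟩
  | ha f g _ _ h₁ h₂ =>
    obtain ⟨k, rfl⟩ := h₁
    obtain ⟨l, rfl⟩ := h₂
    exact ⟨k + l, by simp⟩

variable (P M₀ : ModuleCat.{u} R) [Module.Finite R P] [Module.Projective R P] [Module.Finite R M₀]
  [Module.Projective R M₀]

omit [Module.Finite R P] [Module.Projective R P] [Module.Finite R M₀] [Module.Projective R M₀] in
lemma isIso_stalkMap {P Q : ModuleCat.{u} R} [Module.Finite R P] [Module.Projective R P]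
    [Module.Finite R Q] [Module.Projective R Q] (f : P ⟶ Q) [IsIso f] : IsIso (stalkMap f) :=
  ⟨stalkMap (inv f), by rw [← stalkMap_comp, IsIso.hom_inv_id, stalkMap_id],
    by rw [← stalkMap_comp, IsIso.inv_hom_id, stalkMap_id]⟩

include K in
lemma exists_isMinLeftApprox_stalk :
    ∃ (M' : KbProj R) (f : stalk P ⟶ M'), IsMinLeftApprox (stalk M₀) f := by
  obtain ⟨N, f, ⟨h₁, h₁'⟩, h₂, h₃, h₄⟩ :=
    exists_left_approx K P M₀ ⟨inferInstance, inferInstance⟩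
  refine ⟨stalk N, stalkMap f, ?_, fun N' hN' g => ?_, fun h hf => ?_⟩
  · rw [addClosure_iff, ← stalkMap_id]
    exact stalkMap_mem_thru h₂
  · refine exists_factor_left_of_mem_thru (fun a => ?_) (thru_of_tgt (addClosure_iff.1 hN') g)
    obtain ⟨a, rfl⟩ := stalkMap_surjective a
    obtain ⟨k, rfl⟩ := h₃ a
    exact ⟨stalkMap k, (stalkMap_comp f k).symm⟩
  · obtain ⟨h, rfl⟩ := stalkMap_surjective h
    have := h₄ h (stalkMap_injective (by rw [stalkMap_comp, hf]))
    exact isIso_stalkMap h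

include K in
lemma exists_isMinRightApprox_stalk :
    ∃ (M' : KbProj R) (f : M' ⟶ stalk P), IsMinRightApprox (stalk M₀) f := by
  obtain ⟨N, f, ⟨h₁, h₁'⟩, h₂, h₃, h₄⟩ :=
    exists_right_approx K P M₀ ⟨inferInstance, inferInstance⟩
  refine ⟨stalk N, stalkMap f, ?_, fun N' hN' g => ?_, fun h hf => ?_⟩
  · rw [addClosure_iff, ← stalkMap_id]
    exact stalkMap_mem_thru h₂
  · refine exists_factor_right_of_mem_thru (fun a => ?_) (thru_of_src (addClosure_iff.1 hN') g)
    obtain ⟨a, rfl⟩ := stalkMap_surjective a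
    obtain ⟨k, rfl⟩ := h₃ a
    exact ⟨stalkMap k, (stalkMap_comp k f).symm⟩
  · obtain ⟨h, rfl⟩ := stalkMap_surjective h
    have := h₄ h (stalkMap_injective (by rw [stalkMap_comp, hf]))
    exact isIso_stalkMap h

end Approximation

/-! ### The silting order under summands, sums and shifts -/

section Triangulated

variable {𝒯 : Type*} [Category* 𝒯] [HasZeroObject 𝒯] [HasShift 𝒯 ℤ] [Preadditive 𝒯]
  [∀ n : ℤ, (shiftFunctor 𝒯 n).Additive] [Pretriangulated 𝒯]

lemma id_map_mem_thru {C D : Type*} [Category* C] [Preadditive C] [Category* D] [Preadditive D]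
    (F : C ⥤ D) [F.Additive] {M X : C} (h : 𝟙 X ∈ thru M X X) :
    𝟙 (F.obj X) ∈ thru (F.obj M) (F.obj X) (F.obj X) := by
  rw [← F.map_id]; exact map_mem_thru F h

lemma IsMinRightApprox.shift {M X M' : 𝒯} {f : M' ⟶ X} (hf : IsMinRightApprox M f) (n : ℤ) :
    IsMinRightApprox (M⟦n⟧) (f⟦n⟧') := by
  obtain ⟨h₁, h₂, h₃⟩ := hf
  refine ⟨addClosure_iff.2 (id_map_mem_thru _ (addClosure_iff.1 h₁)), fun N hN g => ?_,
    fun h hf => ?_⟩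
  · refine exists_factor_right_of_mem_thru (fun a => ?_) (thru_of_src (addClosure_iff.1 hN) g)
    obtain ⟨a, rfl⟩ := (shiftFunctor 𝒯 n).map_surjective a
    obtain ⟨k, rfl⟩ := h₂ M (addClosure_iff.2 (thru_of_src
      (by simpa using comp_mem_thru (𝟙 M) (𝟙 M)) _)) a
    exact ⟨k⟦n⟧', by rw [← Functor.map_comp]⟩
  · obtain ⟨h, rfl⟩ := (shiftFunctor 𝒯 n).map_surjective h
    have := h₃ h ((shiftFunctor 𝒯 n).map_injective (by rw [Functor.map_comp, hf]))
    infer_instance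

omit [HasZeroObject 𝒯] [∀ n : ℤ, (shiftFunctor 𝒯 n).Additive] [Pretriangulated 𝒯] in
lemma SiltGE.of_id_mem_thru_left {T N U : 𝒯} (h : SiltGE T U) (hN : 𝟙 N ∈ thru T N N) :
    SiltGE N U := fun i hi f => eq_zero_of_id_mem_thru' hN (h i hi) f

omit [HasZeroObject 𝒯] [Pretriangulated 𝒯] in
lemma SiltGE.of_id_mem_thru_right {T N U : 𝒯} (h : SiltGE T U) (hN : 𝟙 N ∈ thru U N N) :
    SiltGE T N := fun i hi f =>
  eq_zero_of_id_mem_thru (id_map_mem_thru (shiftFunctor 𝒯 i) hN) (h i hi) f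

lemma SiltGE.of_biprod_left {X Y U : 𝒯} (hX : SiltGE X U) (hY : SiltGE Y U) : SiltGE (X ⊞ Y) U :=
  fun i hi f => by ext; exacts [(hX i hi _).trans comp_zero.symm, (hY i hi _).trans comp_zero.symm]

lemma SiltGE.of_biprod_right {X Y T : 𝒯} (hX : SiltGE T X) (hY : SiltGE T Y) : SiltGE T (X ⊞ Y) :=
  fun i hi f => by
    rw [← Category.comp_id f, ← CategoryTheory.Functor.map_id, ← biprod.total, Functor.map_add,
      Preadditive.comp_add, Functor.map_comp, Functor.map_comp, ← Category.assoc, ← Category.assoc,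
      hX i hi (f ≫ _), hY i hi (f ≫ _), zero_comp, zero_comp, add_zero]

omit [HasZeroObject 𝒯] [Pretriangulated 𝒯] in
lemma SiltGE.shift_left_eq_zero {X T : 𝒯} (h : SiltGE X T) {k i : ℤ} (hi : k < i)
    (f : X⟦k⟧ ⟶ T⟦i⟧) : f = 0 := by
  obtain ⟨g, hg⟩ := (shiftFunctor 𝒯 k).map_surjective
    (f ≫ (shiftFunctorAdd' 𝒯 (i - k) k i (by lia)).hom.app T)
  rw [h (i - k) (by lia) g, Functor.map_zero] at hg
  rw [← cancel_mono ((shiftFunctorAdd' 𝒯 (i - k) k i (by lia)).hom.app T), ← hg, zero_comp]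

end Triangulated

/-! ### Mutations of the regular module in terms of the simple top -/

section Mutation

section

variable {𝒯 : Type*} [Category* 𝒯] [HasZeroObject 𝒯] [HasShift 𝒯 ℤ] [Preadditive 𝒯]
  [∀ n : ℤ, (shiftFunctor 𝒯 n).Additive] [Pretriangulated 𝒯]

lemma id_biprod_inr_mem_thru {X Y B T : 𝒯} (e : B ≅ X ⊞ Y) (hB : addClosure B = addClosure T) :
    𝟙 Y ∈ thru T Y Y := by
  rw [← addClosure_iff, ← hB, addClosure_iff]
  exact id_mem_thru_of_retract ⟨biprod.inr ≫ e.inv, e.hom ≫ biprod.snd, by simp⟩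

lemma mem_thru_of_siltGE_cone {X M M' Y T : 𝒯} {f : X ⟶ M'} {g : M' ⟶ Y} {h : Y ⟶ X⟦(1 : ℤ)⟧}
    (hD : Triangle.mk f g h ∈ distTriang 𝒯) (hM : 𝟙 M' ∈ thru M M' M') (hY : SiltGE Y T)
    (ψ : X ⟶ T) : ψ ∈ thru M X T := by
  obtain ⟨k, hk⟩ : ∃ k : M'⟦(1 : ℤ)⟧ ⟶ T⟦(1 : ℤ)⟧, ψ⟦(1 : ℤ)⟧' = (-f⟦(1 : ℤ)⟧') ≫ k :=
    -- The map `Y ⟶ X[1] ⟶ T[1]` is zero because `Y ≥ T`, so `ψ[1]` extends over `M'[1]`. Rotating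
    -- twice puts a sign on `f[1]`, absorbed below into `-k`.
    Triangle.yoneda_exact₂ _ (rot_of_distTriang _ (rot_of_distTriang _ hD)) (ψ⟦(1 : ℤ)⟧')
      (hY 1 one_pos _)
  obtain ⟨k, rfl⟩ := (shiftFunctor 𝒯 (1 : ℤ)).map_surjective k
  have hk' : ψ⟦(1 : ℤ)⟧' = (f ≫ (-k))⟦(1 : ℤ)⟧' := by
    rw [hk, Functor.map_comp, Functor.map_neg, Preadditive.neg_comp, Preadditive.comp_neg]
  rw [(shiftFunctor 𝒯 (1 : ℤ)).map_injective hk']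
  exact thru_postcomp (thru_of_tgt hM f) _

/-- A map `Y ⟶ T[i]` vanishes on `M'`, so it comes from `X[1] ⟶ T[i]`. For `i > 1` this is zero as
`X ≥ T`; for `i = 1` it extends along the approximation `f[1]`, which the connecting map kills. -/
lemma siltGE_cone {X M M' Y T : 𝒯} {f : X ⟶ M'} {g : M' ⟶ Y} {h : Y ⟶ X⟦(1 : ℤ)⟧}
    (hD : Triangle.mk f g h ∈ distTriang 𝒯) (hf : IsMinLeftApprox M f) (hM : SiltGE M T)
    (hX : SiltGE X T) (hψ : ∀ ψ : X ⟶ T, ψ ∈ thru M X T) : SiltGE Y T := by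
  intro i hi φ
  obtain ⟨ψ, hψ'⟩ : ∃ ψ : X⟦(1 : ℤ)⟧ ⟶ T⟦i⟧, φ = h ≫ ψ :=
    Triangle.yoneda_exact₃ _ hD φ (hM.of_id_mem_thru_left (addClosure_iff.1 hf.1) i hi _)
  subst hψ'
  rcases (show i = 1 ∨ 1 < i by lia) with rfl | hi'
  · obtain ⟨ψ, rfl⟩ := (shiftFunctor 𝒯 (1 : ℤ)).map_surjective ψ
    obtain ⟨k, rfl⟩ := exists_factor_left_of_mem_thru (fun a => hf.2.1 M
      (addClosure_iff.2 (by simpa using comp_mem_thru (𝟙 M) (𝟙 M))) a) (hψ ψ)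
    have h0 : h ≫ f⟦(1 : ℤ)⟧' = 0 := comp_distTriang_mor_zero₃₁ _ hD
    rw [Functor.map_comp, reassoc_of% h0, zero_comp]
  · rw [hX.shift_left_eq_zero hi' ψ, comp_zero]

lemma mem_thru_of_siltGE_cocone {X M M' Y T : 𝒯} {g : Y ⟶ M'} {f : M' ⟶ X} {h : X ⟶ Y⟦(1 : ℤ)⟧}
    (hD : Triangle.mk g f h ∈ distTriang 𝒯) (hM : 𝟙 M' ∈ thru M M' M') (hY : SiltGE T Y)
    (ψ : T ⟶ X) : ψ ∈ thru M T X := by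
  obtain ⟨k, hk⟩ : ∃ k : T ⟶ M', ψ = k ≫ f :=
    Triangle.coyoneda_exact₃ _ hD ψ (hY 1 one_pos _)
  rw [hk]
  exact thru_precomp _ (thru_of_src hM f)

lemma siltGE_cocone {X M M' Y T : 𝒯} {g : Y ⟶ M'} {f : M' ⟶ X} {h : X ⟶ Y⟦(1 : ℤ)⟧}
    (hD : Triangle.mk g f h ∈ distTriang 𝒯) (hf : IsMinRightApprox M f) (hM : SiltGE T M)
    (hX : SiltGE T X) (hψ : ∀ ψ : T ⟶ X, ψ ∈ thru M T X) : SiltGE T Y := by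
  have hM' : SiltGE T M' := hM.of_id_mem_thru_right (addClosure_iff.1 hf.1)
  intro i hi φ
  rcases (show i = 1 ∨ 1 < i by lia) with rfl | hi'
  · obtain ⟨ψ, rfl⟩ : ∃ ψ : T ⟶ X, φ = ψ ≫ h :=
      Triangle.coyoneda_exact₁ _ hD φ (hM' 1 one_pos _)
    obtain ⟨k, rfl⟩ := exists_factor_right_of_mem_thru (fun a => hf.2.1 M
      (addClosure_iff.2 (by simpa using comp_mem_thru (𝟙 M) (𝟙 M))) a) (hψ ψ)
    have h0 : f ≫ h = 0 := comp_distTriang_mor_zero₂₃ _ hD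
    rw [Category.assoc, h0, comp_zero]
  -- The triangle `X ⟶ Y[1] ⟶ M'[1]` shifted by `j` is exact at `Y[1][j]`: since `φ` dies in `M'[1 +
  -- j]`, it comes from a map `T ⟶ X[j]`, and `j > 0`.
  · obtain ⟨j, rfl⟩ : ∃ j, i = 1 + j := ⟨i - 1, by lia⟩
    let e := (shiftFunctorAdd' 𝒯 1 j (1 + j) rfl).hom
    have hs := (Triangle.shift_distinguished _ (rot_of_distTriang _ (rot_of_distTriang _ hD)) j)
    have hφ : (φ ≫ e.app Y) ≫ (g⟦(1 : ℤ)⟧')⟦j⟧' = 0 := by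
      have := e.naturality g
      dsimp only [Functor.comp_map] at this
      rw [Category.assoc, ← this, ← Category.assoc, hM' (1 + j) hi (φ ≫ g⟦1 + j⟧'), zero_comp]
    obtain ⟨ψ, hψ'⟩ := Triangle.coyoneda_exact₂ _ hs (φ ≫ e.app Y) (by
      change (φ ≫ e.app Y) ≫ (j.negOnePow • (-g⟦(1 : ℤ)⟧')⟦j⟧') = 0
      rw [Functor.map_neg, Linear.comp_units_smul, Preadditive.comp_neg, hφ, neg_zero, smul_zero])
    have hψ0 : ψ = 0 := hX j (by lia) ψ
    rw [← cancel_mono (e.app Y)]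
    exact hψ'.trans (by rw [hψ0, zero_comp, zero_comp]; rfl)

end

variable {R : Type u} [Ring R] {P S : ModuleCat.{u} R} [Module.Finite R P]
  [Module.Projective R P] [IsLocalRing (End P)] [Simple S] {π : P ⟶ S}

lemma HomZero.of_obj_iso {p : ℤ} {S : ModuleCat.{u} R} {T T' : KbProj R} (h : HomZero p S T)
    (e : T ≅ T') : HomZero p S T' := fun f => by
  rw [← cancel_epi ((bddProj R).ι.mapIso e).hom, h (((bddProj R).ι.mapIso e).hom ≫ f), comp_zero]

lemma homZero_of_id_stalk_notMem (hπ : π ≠ 0) {N : KbProj R}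
    (hN : 𝟙 N ∈ thru (regularStalk R) N N) (hP : 𝟙 (stalk P) ∉ thru N (stalk P) (stalk P)) :
    HomZero 0 S N := by
  have : Projective P := (IsProjective.iff_projective P).1 inferInstance
  have h₁ := map_mem_thru (bddProj R).ι hN
  refine homZero_of_id_notMem hπ h₁ (fun h => hP ?_)
  refine mem_thru_of_map (bddProj R).ι ?_
  exact h

lemma homZero_of_id_stalk_shift_notMem (hπ : π ≠ 0) {N : KbProj R}
    (hN : 𝟙 N ∈ thru ((regularStalk R)⟦(1 : ℤ)⟧) N N)
    (hP : 𝟙 ((stalk P)⟦(1 : ℤ)⟧) ∉ thru N ((stalk P)⟦(1 : ℤ)⟧) ((stalk P)⟦(1 : ℤ)⟧)) :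
    HomZero (-1) S N := by
  have : Projective P := (IsProjective.iff_projective P).1 inferInstance
  refine homZero_of_id_notMem hπ
    (thru_iso (stalkShiftIso (ModuleCat.of R R) 1) (map_mem_thru (bddProj R).ι hN))
    (fun h => hP (mem_thru_of_map (bddProj R).ι ?_))
  have h' := thru_postcomp (thru_precomp (stalkShiftIso P 1).hom h) (stalkShiftIso P 1).inv
  rw [Category.comp_id, Iso.hom_inv_id] at h'
  exact h'

/-- As `B` is basic, `P` is not in `add M`, so `M` has no map to `S`; and `Y ≥ T` forces all maps `P
⟶ T` through `M`. -/
lemma homZero_of_isLeftMutation (hπ : π ≠ 0) {T B U : KbProj R} (h₁ : SiltGE (regularStalk R) T)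
    (hB : IsBasicVersion B (regularStalk R)) (hU : IsLeftMutation (stalk P) B U)
    (hUT : SiltGE U T) : HomZero 0 S T := by
  obtain ⟨M, M', Y, f, g, h, ⟨e⟩, hf, hD, ⟨e'⟩⟩ := hU
  have hl : IsLocalRing (End (stalk P)) := (isLocalRing_end_stalk_iff P).2 inferInstance
  have hY : SiltGE Y T := hUT.of_id_mem_thru_left
    (id_mem_thru_of_retract ⟨biprod.inl ≫ e'.inv, e'.hom ≫ biprod.fst, by simp⟩)
  refine homZero_of_mem_thru h₁ hπ (homZero_of_id_stalk_notMem hπ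
    (id_biprod_inr_mem_thru e hB.2) (id_notMem_thru_of_isBasic hB.1 e))
    (mem_thru_of_siltGE_cone hD (addClosure_iff.1 hf.1) hY)

lemma homZero_of_isRightMutation [IsNoetherianRing R] (hπ : π ≠ 0) {T B U : KbProj R}
    (h₂ : SiltGE T ((regularStalk R)⟦(1 : ℤ)⟧))
    (hB : IsBasicVersion B ((regularStalk R)⟦(1 : ℤ)⟧))
    (hU : IsRightMutation ((stalk P)⟦(1 : ℤ)⟧) B U) (hTU : SiltGE T U) : HomZero (-1) S T := by
  obtain ⟨M, M', Y, g, f, h, ⟨e⟩, hf, hD, ⟨e'⟩⟩ := hU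
  have hl : IsLocalRing (End ((stalk P)⟦(1 : ℤ)⟧)) :=
    (isLocalRing_end_obj_iff _ (stalk P)).2 ((isLocalRing_end_stalk_iff P).2 inferInstance)
  have hY : SiltGE T Y := hTU.of_id_mem_thru_right
    (id_mem_thru_of_retract ⟨biprod.inl ≫ e'.inv, e'.hom ≫ biprod.fst, by simp⟩)
  exact homZero_of_mem_thru_shift h₂ hπ (homZero_of_id_stalk_shift_notMem hπ
    (id_biprod_inr_mem_thru e hB.2) (id_notMem_thru_of_isBasic hB.1 e))
    (mem_thru_of_siltGE_cocone hD (addClosure_iff.1 hf.1) hY)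

variable (K : Type*) [Field K] [Algebra K R] [FiniteDimensional K R]

include K in
lemma exists_isLeftMutation (hπ : π ≠ 0) {T : KbProj R} (h₁ : SiltGE (regularStalk R) T)
    (hT : HomZero 0 S T) : ∃ B U : KbProj R, IsBasicVersion B (regularStalk R) ∧
      IsLeftMutation (stalk P) B U ∧ SiltGE U T := by
  have : IsArtinianRing R := IsArtinianRing.of_finite K R
  obtain ⟨M₀, _, _, hM, hb, hR⟩ := exists_complement P hπ
  obtain ⟨M', f, hf⟩ := exists_isMinLeftApprox_stalk K P M₀
  obtain ⟨Y, g, h, hD⟩ := distinguished_cocone_triangle f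
  have hP' : SiltGE (stalk P) T := h₁.of_id_mem_thru_left (id_stalk_mem_thru_regular P)
  have hM' : SiltGE (stalk M₀) T := h₁.of_id_mem_thru_left (id_stalk_mem_thru_regular M₀)
  exact ⟨stalk P ⊞ stalk M₀, Y ⊞ stalk M₀, ⟨hb.isBasic, addClosure_eq
    (id_biprod_mem_thru (id_stalk_mem_thru_regular P) (id_stalk_mem_thru_regular M₀)) hR⟩,
    ⟨stalk M₀, M', Y, f, g, h, ⟨Iso.refl _⟩, hf, hD, ⟨Iso.refl _⟩⟩,
    (siltGE_cone hD hf hM' hP' (hT.mem_thru_stalk h₁ hM)).of_biprod_left hM'⟩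

include K in
lemma exists_isRightMutation (hπ : π ≠ 0) {T : KbProj R}
    (h₂ : SiltGE T ((regularStalk R)⟦(1 : ℤ)⟧)) (hT : HomZero (-1) S T) :
    ∃ B U : KbProj R, IsBasicVersion B ((regularStalk R)⟦(1 : ℤ)⟧) ∧
      IsRightMutation ((stalk P)⟦(1 : ℤ)⟧) B U ∧ SiltGE T U := by
  have : IsArtinianRing R := IsArtinianRing.of_finite K R
  obtain ⟨M₀, _, _, hM, hb, hR⟩ := exists_complement P hπ
  obtain ⟨M', f, hf⟩ := exists_isMinRightApprox_stalk K P M₀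
  have hf := hf.shift 1
  obtain ⟨Y, g, h, hD⟩ := distinguished_cocone_triangle₁ (f⟦(1 : ℤ)⟧')
  have hPR := id_map_mem_thru (shiftFunctor (KbProj R) (1 : ℤ)) (id_stalk_mem_thru_regular P)
  have hMR := id_map_mem_thru (shiftFunctor (KbProj R) (1 : ℤ)) (id_stalk_mem_thru_regular M₀)
  have hP' := h₂.of_id_mem_thru_right hPR
  have hM' := h₂.of_id_mem_thru_right hMR
  have := preservesBinaryBiproducts_of_preservesBiproducts (shiftFunctor (KbProj R) (1 : ℤ))
  let e := (shiftFunctor (KbProj R) (1 : ℤ)).mapBiprod (stalk P) (stalk M₀)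
  exact ⟨(stalk P ⊞ stalk M₀)⟦(1 : ℤ)⟧, Y ⊞ (stalk M₀)⟦(1 : ℤ)⟧, ⟨(hb.map _).isBasic, addClosure_eq
    (id_map_mem_thru (shiftFunctor (KbProj R) (1 : ℤ))
      (id_biprod_mem_thru (id_stalk_mem_thru_regular P) (id_stalk_mem_thru_regular M₀)))
    (id_map_mem_thru (shiftFunctor (KbProj R) (1 : ℤ)) hR)⟩,
    ⟨(stalk M₀)⟦(1 : ℤ)⟧, M'⟦(1 : ℤ)⟧, Y, g, f⟦(1 : ℤ)⟧', h, ⟨e⟩, hf, hD, ⟨Iso.refl _⟩⟩,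
    (siltGE_cocone hD hf hM' hP' (hT.mem_thru_stalk_shift h₂ hM)).of_biprod_right hM'⟩

include K in
-- The criterion does not involve the chosen basic version, complement or approximation, so the
-- existential choices in `twoSiltMinus` are harmless.
lemma isoClass_mem_twoSiltMinus_iff (hπ : π ≠ 0) {T : KbProj R} (hT : IsTwoSilt T) :
    isoClass T ∈ twoSiltMinus P ↔ HomZero 0 S T := by
  constructor
  · rintro ⟨T', h, ⟨-, -, h₁, h₂⟩, B, U, hB, hU, hUT, -⟩
    obtain ⟨e⟩ : Nonempty (T' ≅ T) := Quotient.exact h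
    exact (homZero_of_isLeftMutation hπ h₁ hB hU hUT).of_obj_iso e
  · intro h
    obtain ⟨B, U, hB, hU, hUT⟩ := exists_isLeftMutation K hπ hT.2.2.1 h
    exact ⟨T, rfl, hT, B, U, hB, hU, hUT, hT.2.2.2⟩

include K in
lemma isoClass_mem_twoSiltPlus_iff (hπ : π ≠ 0) {T : KbProj R} (hT : IsTwoSilt T) :
    isoClass T ∈ twoSiltPlus P ↔ HomZero (-1) S T := by
  have : IsArtinianRing R := IsArtinianRing.of_finite K R
  constructor
  · rintro ⟨T', h, ⟨-, -, h₁, h₂⟩, B, U, hB, hU, -, hUT⟩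
    obtain ⟨e⟩ : Nonempty (T' ≅ T) := Quotient.exact h
    exact (homZero_of_isRightMutation hπ h₂ hB hU hUT).of_obj_iso e
  · intro h
    obtain ⟨B, U, hB, hU, hUT⟩ := exists_isRightMutation K hπ hT.2.2.2 h
    exact ⟨T, rfl, hT, B, U, hB, hU, hT.2.2.1, hUT⟩

include K in
/-- The two sets partition the two-term silting objects. -/
lemma isoClass_mem_twoSiltPlus_iff_notMem (hπ : π ≠ 0) {T : KbProj R} (hT : IsTwoSilt T) :
    isoClass T ∈ twoSiltPlus P ↔ isoClass T ∉ twoSiltMinus P := by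
  have : IsArtinianRing R := IsArtinianRing.of_finite K R
  rw [isoClass_mem_twoSiltPlus_iff K hπ hT, isoClass_mem_twoSiltMinus_iff K hπ hT]
  have h₁ := homZero_or_homZero hT.2.2.1 hT.2.2.2 hT.2.1.1 hπ
  have h₂ := not_homZero_and_homZero hT.2.2.1 hT.2.2.2 hT.2.1.2 hπ
  tauto

end Mutation

/-! ### Duality of modules over a ring with involution -/

section StarDual

variable {R : Type u} [Ring R] [StarRing R]

/-- The dual of a left module over a ring with involution, made a left module by means of the
involution. -/
def StarDual (M : Type u) [AddCommGroup M] [Module R M] : Type u := M →ₗ[R] R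

variable (M : Type u) [AddCommGroup M] [Module R M]

instance : AddCommGroup (StarDual (R := R) M) := inferInstanceAs (AddCommGroup (M →ₗ[R] R))

instance : FunLike (StarDual (R := R) M) M R := inferInstanceAs (FunLike (M →ₗ[R] R) M R)

instance : AddMonoidHomClass (StarDual (R := R) M) M R :=
  inferInstanceAs (AddMonoidHomClass (M →ₗ[R] R) M R)

variable {M}

omit [StarRing R] in
@[ext] lemma StarDual.ext {φ ψ : StarDual (R := R) M} (h : ∀ x, φ x = ψ x) : φ = ψ :=
  LinearMap.ext h

omit [StarRing R] in
lemma StarDual.add_apply (φ ψ : StarDual (R := R) M) (x : M) : (φ + ψ) x = φ x + ψ x := rfl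

omit [StarRing R] in
lemma StarDual.map_smul (φ : StarDual (R := R) M) (r : R) (x : M) : φ (r • x) = r * φ x :=
  LinearMap.map_smul φ r x

instance : SMul R (StarDual (R := R) M) where
  smul r φ :=
    { toFun := fun x => φ x * star r
      map_add' := fun x y => by rw [map_add, add_mul]
      map_smul' := fun s x => by
        rw [StarDual.map_smul, mul_assoc]; rfl }

lemma StarDual.smul_apply (r : R) (φ : StarDual (R := R) M) (x : M) :
    (r • φ) x = φ x * star r := rfl

instance : Module R (StarDual (R := R) M) where
  one_smul φ := by ext x; simp [StarDual.smul_apply]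
  mul_smul r s φ := by ext x; simp [StarDual.smul_apply, mul_assoc]
  smul_zero r := by ext x; exact zero_mul _
  smul_add r φ ψ := by ext x; simp [StarDual.smul_apply, StarDual.add_apply, add_mul]
  add_smul r s φ := by ext x; simp [StarDual.smul_apply, StarDual.add_apply, mul_add]
  zero_smul φ := by ext x; rw [StarDual.smul_apply, star_zero, mul_zero]; rfl

omit [StarRing R] in
lemma StarDual.sum_apply {ι : Type*} (s : Finset ι) (φ : ι → StarDual (R := R) M) (x : M) :
    (∑ k ∈ s, φ k) x = ∑ k ∈ s, φ k x := LinearMap.sum_apply s φ x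

/-- The transpose of a linear map. -/
def StarDual.map {N : Type u} [AddCommGroup N] [Module R N] (f : M →ₗ[R] N) :
    StarDual (R := R) N →ₗ[R] StarDual (R := R) M where
  toFun φ := LinearMap.comp (φ : N →ₗ[R] R) f
  map_add' _ _ := rfl
  map_smul' _ _ := rfl

variable (R) in
/-- The duality on modules over a ring with involution. -/
def starDual : (ModuleCat.{u} R)ᵒᵖ ⥤ ModuleCat.{u} R where
  obj M := ModuleCat.of R (StarDual (R := R) M.unop)
  map f := ModuleCat.ofHom (StarDual.map f.unop.hom)

instance : (starDual R).Additive where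
  map_add {M N f g} := by
    ext φ
    refine StarDual.ext fun x => ?_
    exact map_add (show StarDual (R := R) M.unop from φ) (f.unop.hom x) (g.unop.hom x)

/-- Evaluation of linear forms. -/
def StarDual.eval : M →ₗ[R] StarDual (R := R) (StarDual (R := R) M) where
  toFun x :=
    { toFun := fun φ => star (φ x)
      map_add' := fun φ ψ => star_add (φ x) (ψ x)
      map_smul' := fun r φ => by rw [StarDual.smul_apply, star_mul, star_star]; rfl }
  map_add' x y := by
    ext φ
    change star (φ (x + y)) = star (φ x) + star (φ y)
    rw [map_add, star_add]
  map_smul' r x := by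
    ext φ
    change star (φ (r • x)) = star (φ x) * star r
    rw [StarDual.map_smul, star_mul]

lemma StarDual.eval_apply (x : M) (φ : StarDual (R := R) M) : StarDual.eval x φ = star (φ x) := rfl

variable (R) in
/-- Evaluation of linear forms, as a natural transformation. -/
def starDualEval : 𝟭 (ModuleCat.{u} R) ⟶ (starDual R).rightOp ⋙ starDual R where
  app _ := ModuleCat.ofHom StarDual.eval
  naturality _ _ _ := rfl

variable (R M) in
omit [StarRing R] in
lemma exists_dual_basis [Module.Finite R M] [Module.Projective R M] :
    ∃ (n : ℕ) (b : Fin n → M) (φ : Fin n → StarDual (R := R) M), ∀ x, ∑ k, φ k x • b k = x := by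
  obtain ⟨n, p, hp⟩ := Module.Finite.exists_fin' R M
  obtain ⟨s, hs⟩ := Module.projective_lifting_property p LinearMap.id hp
  refine ⟨n, fun k => p (Pi.single k 1), fun k => LinearMap.comp (LinearMap.proj k) s, fun x => ?_⟩
  have h : p (s x) = x := LinearMap.congr_fun hs x
  conv_rhs => rw [← h, LinearMap.pi_apply_eq_sum_univ p (s x)]
  refine Finset.sum_congr rfl fun k _ => ?_
  have : (Pi.single k 1 : Fin n → R) = fun j => if k = j then 1 else 0 := by
    ext j; simp [Pi.single_apply, eq_comm]
  rw [← this]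
  rfl

section DualBasis

variable {n : ℕ} {b : Fin n → M} {φ : Fin n → StarDual (R := R) M} (h : ∀ x, ∑ k, φ k x • b k = x)

include h

lemma sum_star_smul_dual_basis (ψ : StarDual (R := R) M) : ∑ k, star (ψ (b k)) • φ k = ψ := by
  ext x
  conv_rhs => rw [← h x, map_sum]
  rw [StarDual.sum_apply]
  refine Finset.sum_congr rfl fun k _ => ?_
  rw [StarDual.smul_apply, star_star, StarDual.map_smul]

lemma StarDual.eval_bijective_of_dual_basis : Function.Bijective (StarDual.eval (R := R) (M := M)) := by
  constructor
  · rw [← LinearMap.ker_eq_bot, eq_bot_iff]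
    intro x hx
    have hx : StarDual.eval x = 0 := hx
    rw [← h x]
    refine Submodule.sum_mem _ fun k _ => ?_
    have : star (φ k x) = 0 := congrArg (fun t : StarDual (StarDual (R := R) M) => t (φ k)) hx
    rw [star_eq_zero.1 this, zero_smul]
    exact zero_mem _
  · intro Ξ
    refine ⟨∑ k, star (Ξ (φ k)) • b k, ?_⟩
    ext ψ
    rw [StarDual.eval_apply, map_sum, star_sum]
    conv_rhs => rw [← sum_star_smul_dual_basis h ψ, map_sum]
    refine Finset.sum_congr rfl fun k _ => ?_
    rw [StarDual.map_smul, StarDual.map_smul, star_mul, star_star]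

end DualBasis

lemma fgProj_starDual {M : ModuleCat.{u} R} (hM : fgProj R M) :
    fgProj R ((starDual R).obj (Opposite.op M)) := by
  obtain ⟨h₁, h₂⟩ := hM
  obtain ⟨n, b, φ, h⟩ := exists_dual_basis R M
  let i : StarDual (R := R) M →ₗ[R] (Fin n → R) := LinearMap.pi fun k => StarDual.eval (b k)
  let r : (Fin n → R) →ₗ[R] StarDual (R := R) M := Fintype.linearCombination R φ
  have hri : r ∘ₗ i = LinearMap.id := LinearMap.ext fun ψ => by
    change Fintype.linearCombination R φ (fun k => star (ψ (b k))) = ψ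
    rw [Fintype.linearCombination_apply, sum_star_smul_dual_basis h]
  exact ⟨Module.Finite.of_surjective r (fun ψ => ⟨i ψ, LinearMap.congr_fun hri ψ⟩),
    Module.Projective.of_split i r hri⟩

lemma isIso_starDualEval_app {M : ModuleCat.{u} R} (hM : fgProj R M) :
    IsIso ((starDualEval R).app M) := by
  obtain ⟨h₁, h₂⟩ := hM
  obtain ⟨n, b, φ, h⟩ := exists_dual_basis R M
  exact (ConcreteCategory.isIso_iff_bijective _).2 (StarDual.eval_bijective_of_dual_basis h)

end StarDual

/-! ### Dualising complexes -/

section DualComplex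

variable {A B : Type*} [Category* A] [Category* B] [Preadditive A] [Preadditive B]
  (F : Aᵒᵖ ⥤ B) [F.Additive]

/-- The complex obtained from `X` by applying a contravariant functor, reindexed by
`i ↦ -1 - i`. -/
@[simps]
def dualComplex (X : CochainComplex A ℤ) : CochainComplex B ℤ where
  -- The reflection `i ↦ -1 - i` merges the dual with a shift: it exchanges degrees `0` and `-1`,
  -- and so `R` with `R[1]`. No sign is put on the differential.
  X i := F.obj (Opposite.op (X.X (-1 - i)))
  d i j := F.map (X.d (-1 - j) (-1 - i)).op
  shape i j h := by
    rw [X.shape _ _ (fun h' => h (by simp at h' ⊢; lia)), op_zero, F.map_zero]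
  d_comp_d' i j k _ _ := by rw [← F.map_comp, ← op_comp, X.d_comp_d, op_zero, F.map_zero]

/-- The action of `dualComplex` on morphisms. -/
@[simps]
def dualComplexMap {X Y : CochainComplex A ℤ} (f : X ⟶ Y) : dualComplex F Y ⟶ dualComplex F X where
  f i := F.map (f.f (-1 - i)).op
  comm' i j _ := by
    change F.map _ ≫ F.map _ = F.map _ ≫ F.map _
    rw [← F.map_comp, ← F.map_comp, ← op_comp, ← op_comp, f.comm]

/-- The functor `dualComplex`. -/
@[simps]
def dualComplexFunctor : CochainComplex A ℤ ⥤ (CochainComplex B ℤ)ᵒᵖ where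
  obj X := Opposite.op (dualComplex F X)
  map f := (dualComplexMap F f).op
  map_id X := by
    apply Quiver.Hom.unop_inj; ext i; exact F.map_id _
  map_comp f g := by
    apply Quiver.Hom.unop_inj; ext i; exact F.map_comp _ _

/-- Homotopies are preserved by `dualComplex`. -/
def dualComplexHomotopy {X Y : CochainComplex A ℤ} {f g : X ⟶ Y} (h : Homotopy f g) :
    Homotopy (dualComplexMap F f) (dualComplexMap F g) where
  hom i j := F.map (h.hom (-1 - j) (-1 - i)).op
  zero i j hij := by
    rw [h.zero _ _ (fun h' => hij (by simp at h' ⊢; lia)), op_zero]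
    exact F.map_zero _ _
  comm i := by
    have h₁ : (ComplexShape.up ℤ).Rel (-1 - i) (-1 - (i - 1)) := by simp; lia
    have h₂ : (ComplexShape.up ℤ).Rel (-1 - (i + 1)) (-1 - i) := by simp; lia
    let h' : ∀ i j, (dualComplex F Y).X i ⟶ (dualComplex F X).X j := fun i j =>
      F.map (h.hom (-1 - j) (-1 - i)).op
    change F.map (f.f (-1 - i)).op = dNext i h' + prevD i h' + (dualComplexMap F g).f i
    have := h.comm (-1 - i)
    rw [dNext_eq _ h₁, prevD_eq _ h₂] at this
    have e := congrArg (fun t => F.map (Quiver.Hom.op t)) this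
    simp only [op_add, F.map_add, op_comp, F.map_comp] at e
    rw [dNext_eq _ (show (ComplexShape.up ℤ).Rel i (i + 1) by simp),
      prevD_eq _ (show (ComplexShape.up ℤ).Rel (i - 1) i by simp)]
    exact e.trans (congrArg (· + F.map (g.f (-1 - i)).op) (add_comm _ _))

/-- The functor `dualComplexFunctor` on homotopy categories. -/
def dualHomotopyCategory :
    HomotopyCategory A (ComplexShape.up ℤ) ⥤ (HomotopyCategory B (ComplexShape.up ℤ))ᵒᵖ :=
  CategoryTheory.Quotient.lift _ (dualComplexFunctor F ⋙ (HomotopyCategory.quotient _ _).op)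
    (fun _ _ f g ⟨h⟩ => by
      apply Quiver.Hom.unop_inj
      exact HomotopyCategory.eq_of_homotopy _ _ (dualComplexHomotopy F h))

/-- Compatibility of `dualComplex` with shifts. -/
def dualComplexShiftIso (X : CochainComplex A ℤ) (n : ℤ) :
    dualComplex F (X⟦n⟧) ≅ (dualComplex F X)⟦-n⟧ :=
  HomologicalComplex.Hom.isoOfComponents
    (fun i => F.mapIso (X.XIsoOfEq (show -1 - (i + -n) = -1 - i + n by lia)).op)
    (fun i j _ => by
      have h₁ := X.XIsoOfEq_hom_comp_d (show -1 - (j + -n) = -1 - j + n by lia) (-1 - i + n)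
      have h₂ := X.d_comp_XIsoOfEq_hom (show -1 - (i + -n) = -1 - i + n by lia) (-1 - (j + -n))
      change F.map (X.XIsoOfEq _).hom.op ≫ ((-n).negOnePow • F.map (X.d _ _).op) =
        F.map (n.negOnePow • X.d (-1 - j + n) (-1 - i + n)).op ≫ F.map (X.XIsoOfEq _).hom.op
      have h₃ : F.map (n.negOnePow • X.d (-1 - j + n) (-1 - i + n)).op =
          n.negOnePow • F.map (X.d (-1 - j + n) (-1 - i + n)).op := by
        rcases Int.units_eq_one_or n.negOnePow with h | h <;> rw [h] <;> simp [op_neg]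
      rw [h₃, Int.negOnePow_neg, Linear.comp_units_smul, Linear.units_smul_comp,
        ← F.map_comp, ← F.map_comp, ← op_comp, ← op_comp, h₁, h₂])

end DualComplex

/-! ### Biduality of complexes -/

section DualEval

variable {A : Type*} [Category* A] [Preadditive A] (F : Aᵒᵖ ⥤ A) [F.Additive]
  (η : 𝟭 A ⟶ F.rightOp ⋙ F)

/-- The morphism to the double dual complex induced by a natural transformation. -/
def dualComplexEval (X : CochainComplex A ℤ) : X ⟶ dualComplex F (dualComplex F X) where
  f i := (X.XIsoOfEq (show i = -1 - (-1 - i) by lia)).hom ≫ η.app (X.X (-1 - (-1 - i)))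
  comm' i j _ := by
    have h₁ := X.XIsoOfEq_hom_comp_d (show i = -1 - (-1 - i) by lia) (-1 - (-1 - j))
    have h₂ := X.d_comp_XIsoOfEq_hom (show j = -1 - (-1 - j) by lia) i
    have h₃ : X.d (-1 - (-1 - i)) (-1 - (-1 - j)) ≫ η.app _ =
      η.app _ ≫ (F.rightOp ⋙ F).map (X.d (-1 - (-1 - i)) (-1 - (-1 - j))) := η.naturality _
    refine (Category.assoc _ _ _).trans ((congrArg ((X.XIsoOfEq _).hom ≫ ·) h₃.symm).trans ?_)
    refine (Category.assoc _ _ _).symm.trans ((congrArg (· ≫ η.app _) (h₁.trans h₂.symm)).trans ?_)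
    exact Category.assoc _ _ _

lemma dualComplexEval_naturality {X Y : CochainComplex A ℤ} (f : X ⟶ Y) :
    f ≫ dualComplexEval F η Y =
      dualComplexEval F η X ≫ dualComplexMap F (dualComplexMap F f) := by
  ext i
  have h₁ := HomologicalComplex.XIsoOfEq_hom_naturality f (show i = -1 - (-1 - i) by lia)
  have h₂ : f.f (-1 - (-1 - i)) ≫ η.app _ =
    η.app _ ≫ (F.rightOp ⋙ F).map (f.f (-1 - (-1 - i))) := η.naturality _
  refine (Category.assoc _ _ _).symm.trans ((congrArg (· ≫ η.app _) h₁).trans ?_)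
  refine (Category.assoc _ _ _).trans ((congrArg ((X.XIsoOfEq _).hom ≫ ·) h₂).trans ?_)
  exact (Category.assoc _ _ _).symm

lemma isIso_dualComplexEval {X : CochainComplex A ℤ} (h : ∀ i, IsIso (η.app (X.X i))) :
    IsIso (dualComplexEval F η X) := by
  have : ∀ i, IsIso ((dualComplexEval F η X).f i) := fun i => by
    exact IsIso.comp_isIso' inferInstance (h (-1 - (-1 - i)))
  exact HomologicalComplex.Hom.isIso_of_components _

end DualEval

/-! ### Duals of stalk complexes -/

section DualSingle

variable {A B : Type*} [Category* A] [Category* B] [Preadditive A] [Preadditive B]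
  (F : Aᵒᵖ ⥤ B) [F.Additive] [HasZeroObject A] [HasZeroObject B]

lemma nonempty_dualComplex_single_iso {p q : ℤ} (hpq : p + q = -1) (Q : A) :
    Nonempty (dualComplex F ((CochainComplex.singleFunctor A p).obj Q) ≅
      (CochainComplex.singleFunctor B q).obj (F.obj (Opposite.op Q))) := by
  let X : CochainComplex A ℤ := (HomologicalComplex.single A (ComplexShape.up ℤ) p).obj Q
  have hz : ∀ i, i ≠ q → IsZero ((dualComplex F X).X i) := fun i hi =>
    F.map_isZero (HomologicalComplex.isZero_single_obj_X (ComplexShape.up ℤ) p Q _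
      (by lia)).op
  let e : (dualComplex F X).X q ≅ F.obj (Opposite.op Q) :=
    F.mapIso ((HomologicalComplex.singleObjXIsoOfEq (ComplexShape.up ℤ) p Q (-1 - q)
      (by lia)).symm.op)
  let φ : dualComplex F X ⟶ (HomologicalComplex.single B (ComplexShape.up ℤ) q).obj
      (F.obj (Opposite.op Q)) :=
    HomologicalComplex.mkHomToSingle e.hom (fun i hi => (hz i (by simp at hi; lia)).eq_of_src _ _)
  have : ∀ i, IsIso (φ.f i) := fun i => by
    by_cases hi : i = q
    · subst hi
      rw [HomologicalComplex.mkHomToSingle_f]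
      infer_instance
    · exact ⟨0, (hz i hi).eq_of_src _ _,
        (HomologicalComplex.isZero_single_obj_X (ComplexShape.up ℤ) q _ i hi).eq_of_src _ _⟩
  have h := HomologicalComplex.Hom.isIso_of_components φ
  exact ⟨@asIso _ _ _ _ φ h⟩

end DualSingle

/-! ### The duality on `K^b(proj R)` -/

section Dual

variable {R : Type u} [Ring R] [StarRing R]

lemma bddProjComplex_dualComplex {X : CochainComplex (ModuleCat.{u} R) ℤ}
    (hX : bddProjComplex R X) : bddProjComplex R (dualComplex (starDual R) X) := by
  obtain ⟨h, a, b, hab⟩ := hX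
  exact ⟨fun i => fgProj_starDual (h _), -1 - b, -1 - a, fun i hi =>
    (starDual R).map_isZero (hab _ (by lia)).op⟩

variable (R) in
/-- The duality on `KbProj R` induced by an involution of `R`, composed with the shift. -/
def dual : KbProj R ⥤ (KbProj R)ᵒᵖ where
  obj T := Opposite.op ⟨((dualHomotopyCategory (starDual R)).obj T.obj).unop,
    (bddProj_quotient_obj_iff _).2 (bddProjComplex_dualComplex T.bddProjComplex_as)⟩
  map f := Quiver.Hom.op (ObjectProperty.homMk ((dualHomotopyCategory (starDual R)).map f.hom).unop)
  map_id T := by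
    apply Quiver.Hom.unop_inj
    apply (bddProj R).ι.map_injective
    exact congrArg Quiver.Hom.unop ((dualHomotopyCategory (starDual R)).map_id T.obj)
  map_comp f g := by
    apply Quiver.Hom.unop_inj
    apply (bddProj R).ι.map_injective
    exact congrArg Quiver.Hom.unop ((dualHomotopyCategory (starDual R)).map_comp f.hom g.hom)

/-- The dual object. -/
abbrev dualObj (T : KbProj R) : KbProj R := ((dual R).obj T).unop

/-- The dual morphism. -/
abbrev dualMap {T U : KbProj R} (f : T ⟶ U) : dualObj U ⟶ dualObj T := ((dual R).map f).unop

instance : (dualHomotopyCategory (starDual R)).Additive where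
  map_add {X Y f g} := by
    obtain ⟨X : CochainComplex _ _, rfl⟩ := X.quotient_obj_surjective
    obtain ⟨Y : CochainComplex _ _, rfl⟩ := Y.quotient_obj_surjective
    obtain ⟨f, rfl⟩ := (HomotopyCategory.quotient _ _).map_surjective f
    obtain ⟨g, rfl⟩ := (HomotopyCategory.quotient _ _).map_surjective g
    rw [← Functor.map_add]
    apply Quiver.Hom.unop_inj
    have : dualComplexMap (starDual R) (f + g) =
        dualComplexMap (starDual R) f + dualComplexMap (starDual R) g := by
      ext i : 1
      exact (congrArg (starDual R).map (op_add _ _ _)).trans (starDual R).map_add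
    change (HomotopyCategory.quotient _ _).map (dualComplexMap (starDual R) (f + g)) = _
    rw [this, Functor.map_add]
    rfl

instance : (dual R).Additive where
  map_add {X Y f g} := by
    apply Quiver.Hom.unop_inj
    apply (bddProj R).ι.map_injective
    exact congrArg Quiver.Hom.unop
      ((dualHomotopyCategory (starDual R)).map_add (f := f.hom) (g := g.hom))

lemma isIso_quotient_map_dualComplexEval (T : KbProj R) : IsIso ((HomotopyCategory.quotient _ _).map
    (dualComplexEval (starDual R) (starDualEval R) T.obj.as)) :=
  have := isIso_dualComplexEval (starDual R) (starDualEval R) (X := T.obj.as)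
    (fun i => isIso_starDualEval_app (T.bddProjComplex_as.1 i))
  Functor.map_isIso (HomotopyCategory.quotient _ _) _

/-- An object is isomorphic to its double dual. -/
noncomputable def dualEval (T : KbProj R) : T ≅ dualObj (dualObj T) :=
  ObjectProperty.isoMk _ (@asIso _ _ _ _ _ (isIso_quotient_map_dualComplexEval T))

lemma dualEval_naturality {T U : KbProj R} (f : T ⟶ U) :
    f ≫ (dualEval U).hom = (dualEval T).hom ≫ dualMap (dualMap f) := by
  apply (bddProj R).ι.map_injective
  obtain ⟨g, hg⟩ := (HomotopyCategory.quotient _ _).map_surjective (X := T.obj.as)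
    (Y := U.obj.as) f.hom
  have := congrArg (HomotopyCategory.quotient _ _).map
    (dualComplexEval_naturality (starDual R) (starDualEval R) g)
  rw [Functor.map_comp, Functor.map_comp, hg] at this
  refine this.trans ?_
  change _ = _ ≫ ((dualHomotopyCategory (starDual R)).map
    ((dualHomotopyCategory (starDual R)).map f.hom).unop).unop
  rw [← hg]
  rfl

lemma nonempty_dualObj_shift_iso (T : KbProj R) (n : ℤ) :
    Nonempty (dualObj (T⟦n⟧) ≅ (dualObj T)⟦-n⟧) :=
  have e₁ := (((dualHomotopyCategory (starDual R)).mapIso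
    (((bddProj R).ι.commShiftIso n).app T ≪≫
      (((HomotopyCategory.quotient _ _).commShiftIso n).app T.obj.as).symm))).unop.symm
  have e₂ := (HomotopyCategory.quotient _ _).mapIso (dualComplexShiftIso (starDual R) T.obj.as n)
  have e₃ := ((HomotopyCategory.quotient _ _).commShiftIso (-n)).app
    (dualComplex (starDual R) T.obj.as)
  have e₄ := (((bddProj R).ι.commShiftIso (-n)).app (dualObj T)).symm
  ⟨(bddProj R).ι.preimageIso (e₁ ≪≫ e₂ ≪≫ e₃ ≪≫ e₄)⟩

end Dual

/-! ### Duality, the silting order and basic objects -/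

section DualProperties

variable {R : Type u} [Ring R] [StarRing R]

/-- The dual of an isomorphism. -/
def dualIso {T U : KbProj R} (e : T ≅ U) : dualObj T ≅ dualObj U := ((dual R).mapIso e).unop.symm

lemma dualMap_comp {T U V : KbProj R} (f : T ⟶ U) (g : U ⟶ V) :
    dualMap (f ≫ g) = dualMap g ≫ dualMap f :=
  congrArg Quiver.Hom.unop ((dual R).map_comp f g)

lemma dualMap_id (T : KbProj R) : dualMap (𝟙 T) = 𝟙 (dualObj T) :=
  congrArg Quiver.Hom.unop ((dual R).map_id T)

lemma dualMap_add {T U : KbProj R} (f g : T ⟶ U) : dualMap (f + g) = dualMap f + dualMap g :=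
  congrArg Quiver.Hom.unop ((dual R).map_add (f := f) (g := g))

lemma dualMap_zero (T U : KbProj R) : dualMap (0 : T ⟶ U) = 0 :=
  congrArg Quiver.Hom.unop ((dual R).map_zero T U)

lemma dualMap_sum {T U : KbProj R} {ι : Type*} (s : Finset ι) (f : ι → (T ⟶ U)) :
    dualMap (∑ k ∈ s, f k) = ∑ k ∈ s, dualMap (f k) :=
  map_sum (⟨⟨dualMap, dualMap_zero T U⟩, dualMap_add⟩ : (T ⟶ U) →+ (dualObj U ⟶ dualObj T)) _ _

lemma dualEval_conj {T U : KbProj R} (f : T ⟶ U) :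
    (dualEval T).hom ≫ dualMap (dualMap f) ≫ (dualEval U).inv = f := by
  rw [← Category.assoc, Iso.comp_inv_eq, dualEval_naturality]

lemma dualMap_injective {T U : KbProj R} {f g : T ⟶ U} (h : dualMap f = dualMap g) : f = g := by
  rw [← dualEval_conj f, ← dualEval_conj g, h]

lemma dualMap_mem_thru {M X Y : KbProj R} {f : X ⟶ Y} (hf : f ∈ thru M X Y) :
    dualMap f ∈ thru (dualObj M) (dualObj Y) (dualObj X) := by
  induction hf using thru_induction with
  | hz => rw [dualMap_zero]; exact zero_mem _
  | hc a b => rw [dualMap_comp]; exact comp_mem_thru _ _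
  | ha f g _ _ h₁ h₂ => rw [dualMap_add]; exact add_mem h₁ h₂

lemma mem_thru_of_dualMap {M X Y : KbProj R} {f : X ⟶ Y}
    (hf : dualMap f ∈ thru (dualObj M) (dualObj Y) (dualObj X)) : f ∈ thru M X Y := by
  rw [← dualEval_conj f]
  exact thru_iso (dualEval M).symm (thru_precomp _ (thru_postcomp (dualMap_mem_thru hf) _))

lemma mem_thru_dualObj {M X Y : KbProj R} (h : ∀ f : X ⟶ Y, f ∈ thru M X Y)
    (g : dualObj Y ⟶ dualObj X) : g ∈ thru (dualObj M) (dualObj Y) (dualObj X) := by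
  apply mem_thru_of_dualMap
  have := thru_precomp (dualEval X).inv (thru_postcomp
    (h ((dualEval X).hom ≫ dualMap g ≫ (dualEval Y).inv)) (dualEval Y).hom)
  simp only [Category.assoc, Iso.inv_hom_id, Category.comp_id, Iso.inv_hom_id_assoc] at this
  exact thru_iso (dualEval M) this

/-- Dualising a map `dualObj Y ⟶ (dualObj X)⟦i⟧` and using biduality gives a map `X⟦-i⟧ ⟶ Y`, which
is zero because `X ≥ Y` and `i > 0`. -/
lemma SiltGE.dual {X Y : KbProj R} (h : SiltGE X Y) : SiltGE (dualObj Y) (dualObj X) := by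
  intro i hi f
  obtain ⟨j, rfl⟩ : ∃ j, i = -j := ⟨-i, by simp⟩
  obtain ⟨e⟩ := nonempty_dualObj_shift_iso X j
  have h0 : (dualEval _).hom ≫ dualMap (f ≫ e.inv) ≫ (dualEval Y).inv = 0 := by
    rw [← cancel_mono ((shiftFunctorZero (KbProj R) ℤ).inv.app Y), zero_comp]
    exact h.shift_left_eq_zero (show j < 0 by lia) _
  have h1 : dualMap (f ≫ e.inv) = 0 := by
    rw [← cancel_epi (dualEval _).hom, ← cancel_mono (dualEval Y).inv, Category.assoc, h0,
      comp_zero, zero_comp]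
  rw [← cancel_mono e.inv, zero_comp]
  exact dualMap_injective (h1.trans (dualMap_zero _ _).symm)

lemma isZero_dualObj {X : KbProj R} (h : IsZero X) : IsZero (dualObj X) := by
  rw [IsZero.iff_id_eq_zero, ← dualMap_id, h.eq_of_src (𝟙 X) 0, dualMap_zero]

lemma isZero_of_isZero_dualObj {X : KbProj R} (h : IsZero (dualObj X)) : IsZero X :=
  (isZero_dualObj h).of_iso (dualEval X)

lemma nonempty_dualObj_biprod_iso (X Y : KbProj R) :
    Nonempty (dualObj (X ⊞ Y) ≅ dualObj X ⊞ dualObj Y) := by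
  let b : BinaryBicone (dualObj X) (dualObj Y) :=
    { pt := dualObj (X ⊞ Y)
      fst := dualMap biprod.inl
      snd := dualMap biprod.inr
      inl := dualMap biprod.fst
      inr := dualMap biprod.snd
      inl_fst := by rw [← dualMap_comp, biprod.inl_fst, dualMap_id]
      inl_snd := by rw [← dualMap_comp, biprod.inr_fst, dualMap_zero]
      inr_fst := by rw [← dualMap_comp, biprod.inl_snd, dualMap_zero]
      inr_snd := by rw [← dualMap_comp, biprod.inr_snd, dualMap_id] }
  exact ⟨biprod.uniqueUpToIso _ _ (isBinaryBilimitOfTotal b (by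
    change dualMap _ ≫ dualMap _ + dualMap _ ≫ dualMap _ = 𝟙 (dualObj (X ⊞ Y))
    rw [← dualMap_comp, ← dualMap_comp, ← dualMap_add, biprod.total, dualMap_id]))⟩

lemma indecomposable_dualObj {X : KbProj R} (h : Indecomposable X) :
    Indecomposable (dualObj X) := by
  refine ⟨fun hX => h.1 (isZero_of_isZero_dualObj hX), fun Y Z e => ?_⟩
  obtain ⟨e'⟩ := nonempty_dualObj_biprod_iso Y Z
  exact (h.2 _ _ (dualEval X ≪≫ dualIso e ≪≫ e')).imp isZero_of_isZero_dualObj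
    isZero_of_isZero_dualObj

lemma isBasic_dualObj {T : KbProj R} (h : IsBasic T) : IsBasic (dualObj T) := by
  classical
  obtain ⟨n, X, h₁, h₂, ⟨e⟩⟩ := h
  refine ⟨n, fun k => dualObj (X k), fun k => indecomposable_dualObj (h₁ k),
    fun k l ⟨f⟩ => h₂ k l ⟨dualEval _ ≪≫ dualIso f ≪≫ (dualEval _).symm⟩, ?_⟩
  refine nonempty_iso_biproduct (fun k => dualMap (e.hom ≫ biproduct.π X k))
    (fun k => dualMap (biproduct.ι X k ≫ e.inv)) (fun k => ?_) (fun k l hkl => ?_) ?_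
  · rw [← dualMap_comp]
    simp [dualMap_id]
  · rw [← dualMap_comp]
    simp only [Category.assoc, Iso.inv_hom_id_assoc]
    rw [biproduct.ι_π_ne _ hkl.symm, dualMap_zero]
  · simp_rw [← dualMap_comp]
    rw [← dualMap_sum]
    have : ∑ k, (e.hom ≫ biproduct.π X k) ≫ (biproduct.ι X k ≫ e.inv) = 𝟙 T := by
      simp_rw [Category.assoc]
      rw [← Preadditive.comp_sum]
      simp_rw [← Category.assoc _ _ e.inv]
      rw [← Preadditive.sum_comp, biproduct.total, Category.id_comp, Iso.hom_inv_id]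
    rw [this, dualMap_id]

variable (Q : ModuleCat.{u} R) [Module.Finite R Q] [Module.Projective R Q]

instance : Module.Finite R ((starDual R).obj (Opposite.op Q)) :=
  (fgProj_starDual ⟨inferInstance, inferInstance⟩).1

instance : Module.Projective R ((starDual R).obj (Opposite.op Q)) :=
  (fgProj_starDual ⟨inferInstance, inferInstance⟩).2

lemma nonempty_dualObj_stalk_iso :
    Nonempty (dualObj (stalk Q) ≅ (stalk ((starDual R).obj (Opposite.op Q)))⟦(1 : ℤ)⟧) := by
  obtain ⟨e⟩ := nonempty_dualComplex_single_iso (starDual R) (p := 0) (q := -1) (by simp) Q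
  have e₁ := (HomotopyCategory.quotient _ _).mapIso e
  have e₂ := stalkShiftIso ((starDual R).obj (Opposite.op Q)) 1
  exact ⟨(bddProj R).ι.preimageIso (e₁ ≪≫ e₂.symm)⟩

lemma nonempty_dualObj_stalk_shift_iso :
    Nonempty (dualObj ((stalk Q)⟦(1 : ℤ)⟧) ≅ stalk ((starDual R).obj (Opposite.op Q))) := by
  obtain ⟨e⟩ := nonempty_dualObj_stalk_iso Q
  obtain ⟨e'⟩ := nonempty_dualObj_shift_iso (stalk Q) 1
  exact ⟨e' ≪≫ (shiftFunctor _ (-1 : ℤ)).mapIso e ≪≫ (shiftShiftNeg _ (1 : ℤ))⟩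

variable (R) in
/-- Evaluation at `1`, on the dual of the regular module. -/
def starDualSelf : StarDual (R := R) R →ₗ[R] R where
  toFun φ := star (φ 1)
  map_add' φ ψ := star_add (φ 1) (ψ 1)
  map_smul' r φ := by rw [StarDual.smul_apply, star_mul, star_star]; rfl

variable (R) in
lemma starDualSelf_bijective : Function.Bijective (starDualSelf R) := by
  refine ⟨fun φ ψ h => ?_, fun r => ?_⟩
  · ext x
    have h : φ 1 = ψ 1 := star_injective h
    rw [← mul_one x, ← smul_eq_mul, StarDual.map_smul, StarDual.map_smul, h]
  · refine ⟨(LinearMap.toSpanSingleton R R (star r) : R →ₗ[R] R), ?_⟩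
    change star ((1 : R) • star r) = r
    rw [one_smul, star_star]

variable (R) in
/-- The regular module is self-dual. -/
noncomputable def starDualSelfIso :
    (starDual R).obj (Opposite.op (ModuleCat.of R R)) ≅ ModuleCat.of R R :=
  (LinearEquiv.ofBijective (starDualSelf R) (starDualSelf_bijective R)).toModuleIso

end DualProperties

/-! ### The duality preserves generation -/

section DualThick

lemma prop_of_mappingCone {R : Type u} [Ring R] (Q : ObjectProperty (KbProj R)) [Q.IsTriangulated]
    [Q.IsClosedUnderIsomorphisms] {X Y Z : KbProj R} {A B : CochainComplex (ModuleCat.{u} R) ℤ}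
    (f : A ⟶ B) (eX : X.obj ≅ (HomotopyCategory.quotient _ _).obj A)
    (eY : Y.obj ≅ (HomotopyCategory.quotient _ _).obj B)
    (eZ : Z.obj ≅ (HomotopyCategory.quotient _ _).obj (CochainComplex.mappingCone f))
    (hX : Q X) (hY : Q Y) : Q Z := by
  let g : X ⟶ Y := ObjectProperty.homMk (eX.hom ≫ (HomotopyCategory.quotient _ _).map f ≫ eY.inv)
  obtain ⟨Z', h, k, hD⟩ := distinguished_cocone_triangle g
  have e : Z'.obj ≅ (HomotopyCategory.quotient _ _).obj (CochainComplex.mappingCone f) :=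
    Triangle.π₃.mapIso (isoTriangleOfIso₁₂ _ _ ((bddProj R).ι.map_distinguished _ hD)
      (HomotopyCategory.mappingCone_triangleh_distinguished f) eX eY (by
        change (eX.hom ≫ (HomotopyCategory.quotient _ _).map f ≫ eY.inv) ≫ eY.hom =
          eX.hom ≫ (HomotopyCategory.quotient _ _).map f
        simp))
  exact Q.prop_of_iso ((bddProj R).ι.preimageIso (e ≪≫ eZ.symm)) (Q.ext_of_isTriangulatedClosed₃ _ hD hX hY)

section

variable {A B : Type*} [Category* A] [Category* B] [Preadditive A] [Preadditive B]
  (F : Aᵒᵖ ⥤ B) [F.Additive] (S : ShortComplex (CochainComplex A ℤ))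

/-- The dual of a short complex of cochain complexes. -/
@[simps]
def dualShortComplex : ShortComplex (CochainComplex B ℤ) where
  X₁ := dualComplex F S.X₃
  X₂ := dualComplex F S.X₂
  X₃ := dualComplex F S.X₁
  f := dualComplexMap F S.g
  g := dualComplexMap F S.f
  zero := by
    ext i
    refine (F.map_comp _ _).symm.trans ((congrArg (fun t => F.map (Quiver.Hom.op t))
      (HomologicalComplex.congr_hom S.zero (-1 - i))).trans ?_)
    exact F.map_zero _ _

variable {S} in
/-- The dual of a degreewise split short complex is degreewise split. -/
def dualSplitting (σ : ∀ n, (S.map (HomologicalComplex.eval A _ n)).Splitting) (n : ℤ) :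
    ((dualShortComplex F S).map (HomologicalComplex.eval B _ n)).Splitting where
  r := F.map (σ (-1 - n)).s.op
  s := F.map (σ (-1 - n)).r.op
  f_r := (F.map_comp _ _).symm.trans ((congrArg (fun t => F.map (Quiver.Hom.op t))
    (σ (-1 - n)).s_g).trans (F.map_id _))
  s_g := (F.map_comp _ _).symm.trans ((congrArg (fun t => F.map (Quiver.Hom.op t))
    (σ (-1 - n)).f_r).trans (F.map_id _))
  id := by
    have h := congrArg (fun t => F.map (Quiver.Hom.op t)) (σ (-1 - n)).id
    simp only [op_add, op_comp, F.map_add, F.map_comp] at h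
    exact (add_comm _ _).trans (h.trans (F.map_id _))

end

variable {R : Type u} [Ring R] [StarRing R]

/-- The sequence `L ⟶ cone f ⟶ K[1]` is degreewise split, and so is its dual; the connecting map of
a degreewise split sequence has as cone the shifted middle term. This bypasses showing that the
duality is a triangulated functor. -/
lemma exists_mappingCone_dualComplex {K L : CochainComplex (ModuleCat.{u} R) ℤ} (f : K ⟶ L) :
    ∃ g : dualComplex (starDual R) L ⟶ (dualComplex (starDual R) (K⟦(1 : ℤ)⟧))⟦(1 : ℤ)⟧,
      Nonempty (CochainComplex.mappingCone g ≅
        (dualComplex (starDual R) (CochainComplex.mappingCone f))⟦(1 : ℤ)⟧) :=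
  ⟨_, ⟨CochainComplex.mappingConeHomOfDegreewiseSplitIso
    (dualShortComplex (starDual R) (CochainComplex.mappingCone.triangleRotateShortComplex f))
    (dualSplitting (starDual R)
      (CochainComplex.mappingCone.triangleRotateShortComplexSplitting f))⟩⟩

/-- The preimage under the duality of a thick subcategory containing `dualObj T` is thick and
contains `T`, hence is everything; biduality concludes. -/
lemma thick_dualObj {T : KbProj R} (h : thick T = ⊤) : thick (dualObj T) = ⊤ := by
  rw [eq_top_iff]
  intro X _ Q hQ hQr hT
  have hQi : Q.IsClosedUnderIsomorphisms := inferInstance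
  let Q' : ObjectProperty (KbProj R) := fun X => Q (dualObj X)
  have hQz : Q'.ContainsZero := by
    obtain ⟨Z, hZ, hZ'⟩ := ObjectProperty.ContainsZero.exists_zero (P := Q)
    exact ⟨Z, hZ, Q.prop_of_iso (hZ.iso (isZero_dualObj hZ)) hZ'⟩
  have hQs : Q'.IsStableUnderShift ℤ := ⟨fun n =>
    { le_shift := fun X hX => by
        obtain ⟨e⟩ := nonempty_dualObj_shift_iso X n
        exact Q.prop_of_iso e.symm (Q.le_shift (-n) _ hX) }⟩
  have hQr' : Q'.IsStableUnderRetracts := ⟨fun {X Y} r hY =>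
    Q.prop_of_retract ⟨dualMap r.r, dualMap r.i, by
      rw [← dualMap_comp, r.retract, dualMap_id]⟩ hY⟩
  have hQi' : Q'.IsClosedUnderIsomorphisms := inferInstance
  -- The dual of the third vertex, shifted by one, is the cone of a map between the duals of the
  -- second and the first vertex.
  have hQ3 : Q'.IsTriangulatedClosed₃ := .mk' fun D hD h₁ h₂ => by
    obtain ⟨f : D.obj₁.obj.as ⟶ D.obj₂.obj.as, hf⟩ :=
      (HomotopyCategory.quotient _ _).map_surjective D.mor₁.hom
    have e : D.obj₃.obj ≅ (HomotopyCategory.quotient _ _).obj (CochainComplex.mappingCone f) :=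
      Triangle.π₃.mapIso (isoTriangleOfIso₁₂ _ _ ((bddProj R).ι.map_distinguished _ hD)
        (HomotopyCategory.mappingCone_triangleh_distinguished f) (Iso.refl _) (Iso.refl _)
        ((Category.comp_id _).trans (hf.symm.trans (Category.id_comp _).symm)))
    obtain ⟨g, ⟨e'⟩⟩ := exists_mappingCone_dualComplex f
    have e₁ : dualComplex (starDual R) D.obj₁.obj.as ≅
        (dualComplex (starDual R) (D.obj₁.obj.as⟦(1 : ℤ)⟧))⟦(1 : ℤ)⟧ :=
      (shiftNegShift _ (1 : ℤ)).symm ≪≫ (shiftFunctor _ (1 : ℤ)).mapIso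
        (dualComplexShiftIso (starDual R) D.obj₁.obj.as 1).symm
    have e₂ := ((dualHomotopyCategory (starDual R)).mapIso e).unop.symm
    have e₃ : ((dualObj D.obj₃)⟦(1 : ℤ)⟧).obj ≅
        (HomotopyCategory.quotient _ _).obj (CochainComplex.mappingCone g) :=
      ((bddProj R).ι.commShiftIso (1 : ℤ)).app (dualObj D.obj₃) ≪≫
        (shiftFunctor _ (1 : ℤ)).mapIso e₂ ≪≫
        (((HomotopyCategory.quotient _ _).commShiftIso (1 : ℤ)).app
          (dualComplex (starDual R) (CochainComplex.mappingCone f))).symm ≪≫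
        (HomotopyCategory.quotient _ _).mapIso e'.symm
    have := prop_of_mappingCone Q g (X := dualObj D.obj₂) (Y := dualObj D.obj₁) (Iso.refl _)
      ((HomotopyCategory.quotient _ _).mapIso e₁) e₃ h₂ h₁
    exact Q.prop_of_iso (shiftShiftNeg _ (1 : ℤ)) (Q.le_shift (-1 : ℤ) _ this)
  have hQ2 : Q'.IsTriangulatedClosed₂ := .of_isTriangulatedClosed₃
  have hQ' : Q'.IsTriangulated := { }
  exact Q.prop_of_iso (dualEval X).symm
    ((h.symm ▸ trivial : thick T (dualObj X)) Q' hQ' hQr' hT)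

lemma isTwoSilt_dualObj {T : KbProj R} (hT : IsTwoSilt T) : IsTwoSilt (dualObj T) := by
  obtain ⟨h₁, ⟨h₂, h₃⟩, h₄, h₅⟩ := hT
  have e := starDualSelfIso R
  obtain ⟨e₁⟩ := nonempty_dualObj_stalk_iso (ModuleCat.of R R)
  obtain ⟨e₂⟩ := nonempty_dualObj_stalk_shift_iso (ModuleCat.of R R)
  have e₁ := e₁ ≪≫ (shiftFunctor _ (1 : ℤ)).mapIso (stalkIso e)
  have e₂ := e₂ ≪≫ stalkIso e
  refine ⟨isBasic_dualObj h₁, ⟨h₂.dual, thick_dualObj h₃⟩, h₅.dual.of_id_mem_thru_left ?_,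
    h₄.dual.of_id_mem_thru_right ?_⟩
  · exact id_mem_thru_of_retract e₂.symm.retract
  · exact id_mem_thru_of_retract e₁.symm.retract

end DualThick

/-! ### The bijection for a self-dual projective -/

section Bijection

variable {R : Type u} [Ring R] [StarRing R] {P S : ModuleCat.{u} R} [Module.Finite R P]
  [Module.Projective R P] [IsLocalRing (End P)] [Simple S] {π : P ⟶ S}

/-- By hypothesis all maps `P ⟶ T` factor through `add M₀`. Dually, all maps `dualObj T ⟶ dualObj
(stalk P)` factor through the dual of `M₀`. Since `P* ≅ P`, the target is `P[1]`, and it is not a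
summand of copies of the dual of `M₀` because `P` is none of copies of `M₀`. -/
lemma homZero_dualObj [IsArtinianRing R] (hπ : π ≠ 0)
    (e : (starDual R).obj (Opposite.op P) ≅ P) {T : KbProj R} (hT : IsTwoSilt T)
    (h : HomZero 0 S T) : HomZero (-1) S (dualObj T) := by
  obtain ⟨M₀, _, _, hM, hb, -⟩ := exists_complement P hπ
  have hl : IsLocalRing (End (stalk P)) := (isLocalRing_end_stalk_iff P).2 inferInstance
  obtain ⟨eP⟩ := nonempty_dualObj_stalk_iso P
  have eP := eP ≪≫ (shiftFunctor _ (1 : ℤ)).mapIso (stalkIso e)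
  obtain ⟨eR⟩ := nonempty_dualObj_stalk_iso (ModuleCat.of R R)
  have e' := starDualSelfIso R
  have eR := eR ≪≫ (shiftFunctor _ (1 : ℤ)).mapIso (stalkIso e')
  refine homZero_of_mem_thru_shift (isTwoSilt_dualObj hT).2.2.2 hπ (N := dualObj (stalk M₀))
    (homZero_of_id_stalk_shift_notMem hπ ?_ fun hP => ?_) fun f => ?_
  · rw [← dualMap_id]
    exact thru_iso eR (dualMap_mem_thru (id_stalk_mem_thru_regular M₀))
  · refine id_notMem_thru_of_isBasic hb.isBasic (Iso.refl _) (mem_thru_of_dualMap ?_)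
    rw [dualMap_id]
    have := thru_precomp eP.hom (thru_postcomp hP eP.inv)
    rwa [Category.id_comp, Iso.hom_inv_id] at this
  · have := thru_postcomp (mem_thru_dualObj (h.mem_thru_stalk hT.2.2.1 hM (P := P)) (f ≫ eP.inv))
      eP.hom
    rwa [Category.assoc, Iso.inv_hom_id, Category.comp_id] at this

lemma homZero_neg_one_dualObj [IsArtinianRing R] (hπ : π ≠ 0)
    (e : (starDual R).obj (Opposite.op P) ≅ P) {T : KbProj R} (hT : IsTwoSilt T)
    (h : HomZero (-1) S T) : HomZero 0 S (dualObj T) := by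
  obtain ⟨M₀, _, _, hM, hb, -⟩ := exists_complement P hπ
  have hl : IsLocalRing (End (stalk P)) := (isLocalRing_end_stalk_iff P).2 inferInstance
  obtain ⟨eP⟩ := nonempty_dualObj_stalk_shift_iso P
  have eP := eP ≪≫ stalkIso e
  obtain ⟨eR⟩ := nonempty_dualObj_stalk_shift_iso (ModuleCat.of R R)
  have e' := starDualSelfIso R
  have eR := eR ≪≫ stalkIso e'
  refine homZero_of_mem_thru (isTwoSilt_dualObj hT).2.2.1 hπ
    (N := dualObj ((stalk M₀)⟦(1 : ℤ)⟧)) (homZero_of_id_stalk_notMem hπ ?_ fun hP => ?_) fun f => ?_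
  · rw [← dualMap_id]
    exact thru_iso eR (dualMap_mem_thru (id_map_mem_thru _ (id_stalk_mem_thru_regular M₀)))
  · refine id_notMem_thru_of_isBasic hb.isBasic (Iso.refl _)
      (mem_thru_of_map (shiftFunctor (KbProj R) (1 : ℤ)) (mem_thru_of_dualMap ?_))
    rw [CategoryTheory.Functor.map_id, dualMap_id]
    have := thru_precomp eP.hom (thru_postcomp hP eP.inv)
    rwa [Category.id_comp, Iso.hom_inv_id] at this
  · have := thru_precomp eP.inv
      (mem_thru_dualObj (h.mem_thru_stalk_shift hT.2.2.2 hM (P := P)) (eP.hom ≫ f))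
    rwa [Iso.inv_hom_id_assoc] at this

variable (R) in
/-- The action of the duality on isomorphism classes. -/
def dualClass : KbProjClass R → KbProjClass R :=
  Quotient.map dualObj fun _ _ ⟨e⟩ => ⟨dualIso e⟩

lemma dualClass_isoClass (T : KbProj R) : dualClass R (isoClass T) = isoClass (dualObj T) := rfl

lemma dualClass_dualClass (t : KbProjClass R) : dualClass R (dualClass R t) = t := by
  induction t using Quotient.inductionOn with
  | h T => exact Quotient.sound ⟨(dualEval T).symm⟩

lemma nonempty_twoSiltMinus_equiv_and_card (K : Type*) [Field K] [Algebra K R]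
    [FiniteDimensional K R] {P : ModuleCat.{u} R} [Module.Finite R P] [Module.Projective R P]
    (hP : Indecomposable P) (e : (starDual R).obj (Opposite.op P) ≅ P) :
    Nonempty (twoSiltMinus P ≃ twoSiltPlus P) ∧
      Cardinal.mk (twoSilt R) = 2 * Cardinal.mk (twoSiltMinus P) := by
  have : IsArtinianRing R := IsArtinianRing.of_finite K R
  have : Nontrivial P := by
    by_contra hn
    rw [not_nontrivial_iff_subsingleton] at hn
    exact hP.1 (ModuleCat.isZero_of_subsingleton P)
  have : IsLocalRing (End P) := isLocalRing_end_of_indecomposable (isFiniteLength_of_finite K P) hP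
  obtain ⟨S, _, π, hπ⟩ := exists_simple_quotient (P := P)
  have h₁ : ∀ t ∈ twoSiltMinus P, dualClass R t ∈ twoSiltPlus P := by
    intro t ht
    obtain ⟨T, rfl, hT, -⟩ := id ht
    rw [dualClass_isoClass, isoClass_mem_twoSiltPlus_iff K hπ (isTwoSilt_dualObj hT)]
    exact homZero_dualObj hπ e hT ((isoClass_mem_twoSiltMinus_iff K hπ hT).1 ht)
  have h₂ : ∀ t ∈ twoSiltPlus P, dualClass R t ∈ twoSiltMinus P := by
    intro t ht
    obtain ⟨T, rfl, hT, -⟩ := id ht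
    rw [dualClass_isoClass, isoClass_mem_twoSiltMinus_iff K hπ (isTwoSilt_dualObj hT)]
    exact homZero_neg_one_dualObj hπ e hT ((isoClass_mem_twoSiltPlus_iff K hπ hT).1 ht)
  let φ : twoSiltMinus P ≃ twoSiltPlus P :=
    { toFun := fun t => ⟨dualClass R t, h₁ t t.2⟩
      invFun := fun t => ⟨dualClass R t, h₂ t t.2⟩
      left_inv := fun t => Subtype.ext (dualClass_dualClass _)
      right_inv := fun t => Subtype.ext (dualClass_dualClass _) }
  refine ⟨⟨φ⟩, ?_⟩
  have hu : twoSilt R = twoSiltMinus P ∪ twoSiltPlus P := by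
    ext t
    constructor
    · rintro ⟨T, rfl, hT⟩
      have := isoClass_mem_twoSiltPlus_iff_notMem K hπ hT
      rw [Set.mem_union]
      tauto
    · rintro (⟨T, rfl, hT, -⟩ | ⟨T, rfl, hT, -⟩) <;> exact ⟨T, rfl, hT⟩
  have hd : Disjoint (twoSiltMinus P) (twoSiltPlus P) := by
    rw [Set.disjoint_right]
    intro t ht
    obtain ⟨T, rfl, hT, -⟩ := id ht
    exact (isoClass_mem_twoSiltPlus_iff_notMem K hπ hT).1 ht
  rw [hu, Cardinal.mk_union_of_disjoint hd, ← Cardinal.mk_congr φ, two_mul]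

end Bijection

/-! ### Cells, the involution and idempotents -/

namespace CellDatum

variable {K : Type v} [Field K] {Λ : Type u} [Ring Λ] [Algebra K Λ] {I : Type} [PartialOrder I]
  {M : I → Type} [∀ i, Fintype (M i)] (D : CellDatum K Λ I M)

/-- The span of the basis elements in the cells below `i`. -/
def below (i : I) : Submodule K Λ :=
  Submodule.span K {x : Λ | ∃ (j : I) (U V : M j), j < i ∧ x = D.C ⟨j, U, V⟩}

/-- The involution of a cellular algebra makes it a ring with involution. -/
@[reducible]
def starRing : StarRing Λ where
  star := D.inv
  star_involutive := D.inv_inv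
  star_mul := D.inv_mul
  star_add := D.inv.map_add

lemma inv_mem_below {i : I} {x : Λ} (hx : x ∈ D.below i) : D.inv x ∈ D.below i := by
  have : D.below i ≤ (D.below i).comap D.inv := by
    refine Submodule.span_le.2 ?_
    rintro _ ⟨j, U, V, hj, rfl⟩
    exact Submodule.subset_span ⟨j, V, U, hj, D.inv_C j U V⟩
  exact this hx

lemma repr_of_mem_below {i : I} {x : Λ} (hx : x ∈ D.below i) (S T : M i) :
    D.C.repr x ⟨i, S, T⟩ = 0 := by
  classical
  have : D.below i ≤ LinearMap.ker (D.C.coord ⟨i, S, T⟩) := by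
    refine Submodule.span_le.2 ?_
    rintro _ ⟨j, U, V, hj, rfl⟩
    change D.C.repr (D.C ⟨j, U, V⟩) ⟨i, S, T⟩ = 0
    rw [D.C.repr_self, Finsupp.single_apply, if_neg]
    intro h
    exact hj.ne (congrArg Sigma.fst h)
  exact this hx

lemma C_mul (a : Λ) (i : I) (T : M i) : ∃ r : M i → K, ∀ S : M i,
    D.C ⟨i, S, T⟩ * a - ∑ T' : M i, r T' • D.C ⟨i, S, T'⟩ ∈ D.below i := by
  obtain ⟨r, hr⟩ := D.mul_C (D.inv a) i T
  refine ⟨r, fun S => ?_⟩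
  have := D.inv_mem_below (hr S)
  rw [map_sub, D.inv_mul, D.inv_inv, D.inv_C, map_sum] at this
  simpa only [map_smul, D.inv_C] using this

/-- The bilinear form attached to a cell and an element of the algebra. -/
lemma exists_form (a : Λ) (i : I) (S T : M i) : ∃ c : K, ∀ X Y : M i,
    D.C ⟨i, X, S⟩ * a * D.C ⟨i, T, Y⟩ - c • D.C ⟨i, X, Y⟩ ∈ D.below i := by
  classical
  choose r hr using fun X => D.mul_C (D.C ⟨i, X, S⟩ * a) i T
  choose r' hr' using fun Y => D.C_mul (a * D.C ⟨i, T, Y⟩) i S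
  -- Expanding the product from the left only changes the first index, from the right only the
  -- second. Comparing coefficients at `(X', Y)` leaves the diagonal, with a value independent of
  -- `X`.
  have key : ∀ X Y X', r X X' = if X = X' then r' Y Y else 0 := fun X Y X' => by
    have h₁ : D.C ⟨i, X, S⟩ * a * D.C ⟨i, T, Y⟩ - ∑ X', r X X' • D.C ⟨i, X', Y⟩ ∈ D.below i :=
      hr X Y
    have h := sub_mem (hr' Y X) h₁
    rw [mul_assoc, sub_sub_sub_cancel_left] at h
    have h := D.repr_of_mem_below h X' Y
    rw [map_sub, map_sum, map_sum, Finsupp.sub_apply, Finsupp.finsetSum_apply,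
      Finsupp.finsetSum_apply] at h
    simp only [map_smul, Module.Basis.repr_self, Finsupp.smul_apply, Finsupp.single_apply,
      Sigma.mk.injEq, heq_eq_eq, true_and, Prod.mk.injEq, and_true, smul_eq_mul, mul_ite,
      mul_one, mul_zero, Finset.sum_ite_eq', Finset.mem_univ, if_true] at h
    rw [sub_eq_zero.1 h]
    split_ifs with hX
    · simp [hX]
    · simp [hX]
  -- The left side of `key` does not involve `Y`, so any index serves to name the common scalar; `Y
  -- = T` is at hand.
  refine ⟨r' T T, fun X Y => ?_⟩
  have h : ∑ X', r X X' • D.C ⟨i, X', Y⟩ = r' T T • D.C ⟨i, X, Y⟩ := by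
    simp_rw [key X T]
    simp
  rw [← h]
  exact hr X Y

/-- An idempotent which is not killed by a local quotient is linked to its image under the
involution. -/
lemma exists_mul_inv_mul_notMem [Finite I] (N : Submodule K Λ) (h1 : (1 : Λ) ∉ N) (e : Λ)
    (he : ∀ x y, x ∉ N → y ∉ N → x * e * y ∉ N) : ∃ a b, a * D.inv e * b ∉ N := by
  -- Take a minimal cell not contained in `N`; one exists as the basis spans `1 ∉ N`. Minimality
  -- puts all lower cells in `N`, so congruences modulo lower cells hold modulo `N`.
  obtain ⟨i, ⟨S, T, hST⟩, hmin⟩ := WellFounded.has_min (wellFounded_lt (α := I))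
    {i | ∃ S T, D.C ⟨i, S, T⟩ ∉ N} (by
      by_contra hne
      rw [Set.not_nonempty_iff_eq_empty, Set.eq_empty_iff_forall_notMem] at hne
      apply h1
      have : (1 : Λ) ∈ Submodule.span K (Set.range D.C) := D.C.span_eq ▸ Submodule.mem_top
      refine Submodule.span_le.2 ?_ this
      rintro _ ⟨⟨i, S, T⟩, rfl⟩
      by_contra h
      exact hne i ⟨S, T, h⟩)
  have hN : D.below i ≤ N := by
    refine Submodule.span_le.2 ?_
    rintro _ ⟨j, U, V, hj, rfl⟩
    by_contra h
    exact hmin j ⟨U, V, h⟩ hj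
  obtain ⟨c, hc⟩ := D.exists_form e i T S
  obtain ⟨c', hc'⟩ := D.exists_form (D.inv e) i S T
  -- The involution turns `C_ST e C_ST ≡ c C_ST` into `C_TS e* C_TS ≡ c C_TS`, where `e* = D.inv e`;
  -- the latter product also has scalar `c'`.
  have hcc : c = c' := by
    have h₁ := D.inv_mem_below (hc S T)
    rw [map_sub, D.inv_mul, D.inv_mul, map_smul, D.inv_C, ← mul_assoc] at h₁
    have h := sub_mem (hc' T S) h₁
    rw [sub_sub_sub_cancel_left, ← sub_smul] at h
    have h := D.repr_of_mem_below h T S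
    rw [map_smul, Module.Basis.repr_self, Finsupp.smul_apply, Finsupp.single_eq_same, smul_eq_mul,
      mul_one] at h
    exact sub_eq_zero.1 h
  have hc0 : c ≠ 0 := by
    intro h0
    have := hN (hc S T)
    rw [h0, zero_smul, sub_zero] at this
    exact he _ _ hST hST this
  refine ⟨D.C ⟨i, S, S⟩, D.C ⟨i, T, T⟩, fun h => hST ?_⟩
  have h' := sub_mem h (hN (hc' S T))
  rw [sub_sub_cancel, ← hcc] at h'
  exact (Submodule.smul_mem_iff N hc0).1 h'

end CellDatum

/-! ### Summands of the regular module and their duals -/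

section SelfDual

variable {R : Type u} [Ring R]

/-- Right multiplication, as an endomorphism of the regular module. -/
noncomputable def mulRightHom (x : R) : ModuleCat.of R R ⟶ ModuleCat.of R R :=
  elemHom (N := ModuleCat.of R R) x

lemma mulRightHom_add (x y : R) : mulRightHom (x + y) = mulRightHom x + mulRightHom y := by
  ext; simp [mulRightHom, elemHom]

lemma mulRightHom_one : mulRightHom (1 : R) = 𝟙 _ :=
  (eq_elemHom (𝟙 (ModuleCat.of R R))).symm

lemma mulRightHom_comp (x y : R) : mulRightHom x ≫ mulRightHom y = mulRightHom (x * y) :=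
  (elemHom_comp (N := ModuleCat.of R R) x (mulRightHom y)).trans (by rfl)

lemma mulRightHom_comp_assoc (x y : R) {N : ModuleCat.{u} R} (f : ModuleCat.of R R ⟶ N) :
    mulRightHom x ≫ mulRightHom y ≫ f = mulRightHom (x * y) ≫ f := by
  rw [← mulRightHom_comp, Category.assoc]

variable {P : ModuleCat.{u} R} (t : Retract P (ModuleCat.of R R))

/-- The idempotent attached to a retract of the regular module. -/
def retractIdem : R := (t.r ≫ t.i).hom (1 : R)

/-- The endomorphism of a retract of the regular module given by right multiplication. -/
noncomputable def retractMul (x : R) : P ⟶ P := t.i ≫ mulRightHom x ≫ t.r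

lemma retract_r_comp_i : t.r ≫ t.i = mulRightHom (retractIdem t) :=
  eq_elemHom (t.r ≫ t.i)

lemma retractMul_comp (x y : R) :
    retractMul t x ≫ retractMul t y = retractMul t (x * retractIdem t * y) := by
  simp only [retractMul, Category.assoc]
  rw [← Category.assoc t.r t.i, retract_r_comp_i, mulRightHom_comp_assoc, mulRightHom_comp_assoc,
    mul_assoc]

lemma retractMul_one : retractMul t 1 = 𝟙 P := by
  rw [retractMul, mulRightHom_one, Category.id_comp, t.retract]

lemma retractMul_add (x y : R) : retractMul t (x + y) = retractMul t x + retractMul t y := by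
  simp only [retractMul]
  rw [← Preadditive.comp_add, ← Preadditive.add_comp, ← mulRightHom_add]

lemma retractMul_mul_idem (x : R) : retractMul t (x * retractIdem t) = retractMul t x := by
  have := retractMul_comp t x 1
  rw [retractMul_one, Category.comp_id, mul_one] at this
  exact this.symm

section Linear

variable {K : Type*} [Field K] [Algebra K R]

lemma retractMul_smul (k : K) (x : R) :
    retractMul t (k • x) = retractMul t x ≫ retractMul t (algebraMap K R k) := by
  rw [retractMul_comp, ← Algebra.commutes, ← mul_assoc, retractMul_mul_idem, Algebra.smul_def]

lemma isIso_retractMul_algebraMap {k : K} (hk : k ≠ 0) :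
    IsIso (retractMul t (algebraMap K R k)) := by
  have key : ∀ a b : K, a * b = 1 →
      retractMul t (algebraMap K R a) ≫ retractMul t (algebraMap K R b) = 𝟙 P := fun a b hab => by
    rw [← retractMul_smul, Algebra.smul_def, ← map_mul, mul_comm, hab, map_one, retractMul_one]
  exact ⟨_, key k k⁻¹ (mul_inv_cancel₀ hk), key k⁻¹ k (inv_mul_cancel₀ hk)⟩

lemma not_isIso_retractMul_zero [IsLocalRing (End P)] : ¬ IsIso (retractMul t 0) := fun h => by
  have h0 : retractMul t 0 = 0 := by
    simpa using retractMul_add t 0 0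
  rw [h0] at h
  refine not_isZero_of_isLocalRing_end ((IsZero.iff_id_eq_zero P).2 ?_)
  rw [← IsIso.hom_inv_id (0 : P ⟶ P), zero_comp]

variable (K) in
/-- The elements which do not act invertibly on a module with local endomorphism ring. -/
def nonIso [IsLocalRing (End P)] : Submodule K R where
  carrier := {x | ¬ IsIso (retractMul t x)}
  zero_mem' := not_isIso_retractMul_zero t
  add_mem' {x y} hx hy h := by
    rw [retractMul_add] at h
    obtain ⟨k, -, hk⟩ := exists_isIso_of_isIso_sum Finset.univ ![retractMul t x, retractMul t y]
      (by simpa using h)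
    fin_cases k
    · exact hx hk
    · exact hy hk
  smul_mem' k x hx h := by
    by_cases hk : k = 0
    · rw [hk, zero_smul] at h
      exact not_isIso_retractMul_zero t h
    · rw [retractMul_smul] at h
      have := isIso_retractMul_algebraMap t hk
      exact hx (IsIso.of_isIso_comp_right _ (retractMul t (algebraMap K R k)))

end Linear

variable [StarRing R]

/-- Consequently the dual of the summand of `R` cut out by an idempotent is the summand cut out by
its `star`. -/
lemma starDualSelfIso_conj (x : R) :
    (starDualSelfIso R).inv ≫ (starDual R).map (mulRightHom x).op ≫ (starDualSelfIso R).hom =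
      mulRightHom (star x) := by
  rw [Iso.inv_comp_eq]
  ext φ
  change star ((show StarDual (R := R) R from φ) ((1 : R) • x)) =
    star ((show StarDual (R := R) R from φ) 1) • star x
  rw [one_smul, smul_eq_mul, ← star_mul, ← StarDual.map_smul, smul_eq_mul, mul_one]

/-- Multiplying by `a`, projecting through the summand of `star (retractIdem t)`, which is `P*`, and
multiplying by `b` gives an automorphism of `P` that factors through `P*`. -/
lemma nonempty_retract_starDual {a b : R}
    (h : IsIso (retractMul t (a * star (retractIdem t) * b))) :
    Nonempty (Retract P ((starDual R).obj (Opposite.op P))) := by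
  let f : P ⟶ (starDual R).obj (Opposite.op P) :=
    t.i ≫ mulRightHom a ≫ (starDualSelfIso R).inv ≫ (starDual R).map t.i.op
  let g : (starDual R).obj (Opposite.op P) ⟶ P :=
    (starDual R).map t.r.op ≫ (starDualSelfIso R).hom ≫ mulRightHom b ≫ t.r
  have hfg : f ≫ g = retractMul t (a * star (retractIdem t) * b) := by
    have h₁ : (starDual R).map t.i.op ≫ (starDual R).map t.r.op =
        (starDual R).map (mulRightHom (retractIdem t)).op := by
      rw [← Functor.map_comp, ← op_comp, retract_r_comp_i]
    have h₂ := starDualSelfIso_conj (retractIdem t)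
    rw [← h₁] at h₂
    simp only [Category.assoc] at h₂
    simp only [f, g, Category.assoc, retractMul]
    rw [← mulRightHom_comp, ← mulRightHom_comp, ← h₂]
    simp only [Category.assoc]
  have : IsIso (f ≫ g) := hfg ▸ h
  exact exists_retract_of_isIso f g

omit [StarRing R] in
lemma nonempty_iso_of_retract_retract {P Q : ModuleCat.{u} R} [IsArtinian R P] (r : Retract P Q)
    (s : Retract Q P) : Nonempty (Q ≅ P) := by
  have h : (r.i ≫ s.i) ≫ (s.r ≫ r.r) = 𝟙 P := by
    rw [Category.assoc, reassoc_of% s.retract, r.retract]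
  have hm : Mono (r.i ≫ s.i) := mono_of_mono_fac h
  have hi : IsIso (r.i ≫ s.i) := (ConcreteCategory.isIso_iff_bijective _).2
    (IsArtinian.bijective_of_injective_endomorphism (r.i ≫ s.i).hom
      ((ModuleCat.mono_iff_injective _).1 hm))
  have : Epi s.i := epi_of_epi r.i s.i
  have : IsIso s.i := isIso_of_mono_of_epi _
  exact ⟨asIso s.i⟩

/-- Dualising the retraction makes `P*` a retract of `P** ≅ P`; two modules of finite length that
are retracts of each other are isomorphic. -/
lemma nonempty_starDual_iso_of_retract [IsArtinianRing R] [Module.Finite R P]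
    [Module.Projective R P] (r : Retract P ((starDual R).obj (Opposite.op P))) :
    Nonempty ((starDual R).obj (Opposite.op P) ≅ P) := by
  have := isIso_starDualEval_app (M := P) ⟨inferInstance, inferInstance⟩
  let e : P ≅ (starDual R).obj (Opposite.op ((starDual R).obj (Opposite.op P))) :=
    asIso ((starDualEval R).app P)
  have s : Retract ((starDual R).obj (Opposite.op P)) P :=
    ⟨(starDual R).map r.r.op ≫ e.inv, e.hom ≫ (starDual R).map r.i.op, by
      rw [Category.assoc, Iso.inv_hom_id_assoc, ← Functor.map_comp, ← op_comp, r.retract, op_id,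
        CategoryTheory.Functor.map_id]⟩
  exact nonempty_iso_of_retract_retract r s

end SelfDual

/-! ### Self-duality of projectives over a cellular algebra -/

section Cellular

variable {K : Type v} [Field K] {Λ : Type u} [Ring Λ] [Algebra K Λ] [FiniteDimensional K Λ]
  {I : Type} [PartialOrder I] [Finite I] {M : I → Type} [∀ i, Fintype (M i)]

/-- Over a cellular algebra, indecomposable projective modules are self-dual. -/
lemma CellDatum.nonempty_starDual_iso (D : CellDatum K Λ I M) (P : ModuleCat.{u} Λᵐᵒᵖ)
    [Module.Finite Λᵐᵒᵖ P] [Module.Projective Λᵐᵒᵖ P] (hP : Indecomposable P) :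
    letI := D.starRing
    Nonempty ((starDual Λᵐᵒᵖ).obj (Opposite.op P) ≅ P) := by
  let _ := D.starRing
  have : IsArtinianRing Λᵐᵒᵖ := IsArtinianRing.of_finite K Λᵐᵒᵖ
  have : IsLocalRing (End P) := isLocalRing_end_of_indecomposable (isFiniteLength_of_finite K P) hP
  obtain ⟨t⟩ := retract_of_id_mem_thru (id_mem_thru_of_fgProj (R := Λᵐᵒᵖ) (Q := P)
    ⟨inferInstance, inferInstance⟩)
  obtain ⟨a, b, hab⟩ := D.exists_mul_inv_mul_notMem
    ((nonIso t K).comap (MulOpposite.opLinearEquiv K).toLinearMap)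
    (fun h => h (by
      change IsIso (retractMul t (1 : Λᵐᵒᵖ))
      rw [retractMul_one]
      infer_instance))
    (retractIdem t).unop
    -- In the opposite ring `x * e * y` becomes `op y * op e * op x`, which acts on `P` as the
    -- composite of the two invertible actions.
    (fun x y hx hy h => h (by
      have hx : IsIso (retractMul t (MulOpposite.op x)) := not_not.1 hx
      have hy : IsIso (retractMul t (MulOpposite.op y)) := not_not.1 hy
      change IsIso (retractMul t (MulOpposite.op (x * (retractIdem t).unop * y)))
      have := retractMul_comp t (MulOpposite.op y) (MulOpposite.op x)
      rw [MulOpposite.op_mul, MulOpposite.op_mul, MulOpposite.op_unop, ← mul_assoc, ← this]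
      infer_instance))
  have hab : IsIso (retractMul t (MulOpposite.op (a * D.inv (retractIdem t).unop * b))) :=
    not_not.1 hab
  rw [MulOpposite.op_mul, MulOpposite.op_mul, ← mul_assoc] at hab
  obtain ⟨r⟩ := nonempty_retract_starDual t hab
  exact nonempty_starDual_iso_of_retract r

end Cellular

theorem theorem2p6 {K : Type v} [Field K] [IsAlgClosed K]
    {Λ : Type u} [Ring Λ] [Algebra K Λ] [FiniteDimensional K Λ] (hΛ : IsCellularAlgebra K Λ)
    (P : ModuleCat.{u} Λᵐᵒᵖ) [Module.Finite Λᵐᵒᵖ P] [Module.Projective Λᵐᵒᵖ P]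
    (hP : Indecomposable P) :
    Nonempty (twoSiltMinus P ≃ twoSiltPlus P) ∧
      Cardinal.mk (twoSilt Λᵐᵒᵖ) = 2 * Cardinal.mk (twoSiltMinus P) := by
  obtain ⟨I, _, _, M, _, ⟨D⟩⟩ := hΛ
  let _ := D.starRing
  obtain ⟨e⟩ := D.nonempty_starDual_iso P hP
  exact nonempty_twoSiltMinus_equiv_and_card K hP e
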